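/- Let $p$ be a prime, $K$ a number field, $\mathfrak p\mid p$ a prime ideal of $\mathcal O_K$, $v_K$ the corresponding discrete valuation, normalized so that a uniformizer has value $1$, and $R$ its valuation ring. Let $L/K$ be a Galois extension of degree $p$ with group $G$ which is totally ramified at $\mathfrak p$, let $R_L$ be the integral closure of $R$ in $L$, let $v_L$ be the unique extension of $v_K$ to $L$ (so that uniformizers of $L$ have value $1/p$), let $\sigma$ be a generator of $G$, let $\pi_L\in L$ be a uniformizer, and let the integer $m$ be defined by $v_L(\sigma(\pi_L)-\pi_L)=m/p$. Let $\phi\in K[x]$ be the minimal polynomial of $\pi_L$ over $K$, and put $y:=(x-\pi_L)/\pi_L^m\in L(x)$, so that $L(x)=L(y)$. Let $Y=\mathbb P^1_{R_L}$ be the $R_L$-model of $\mathbb P^1_L$ (with function field $L(x)$) on which $y$ is the affine coordinate. Then the natural action of $G$ on $L(x)$ (on the coefficients, fixing $x$) extends to an action on $Y$, and the quotient scheme $X=Y/G$ exists; it is an integral scheme over $R$ with function field $K(x)$. Its special fiber is irreducible, and the set $V(X)$ of valuations of $K(x)$ extending $v_K$ whose valuation ring is the local ring of $X$ at the generic point of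 an irreducible component of the special fiber is \[ V(X)=\{v\},\qquad v=[\,v_0,\ v_1(x)=1/p,\ v(\phi)=m\,]. \] Here $v$ is the inductive valuation in the sense of MacLane: $v_0$ is the Gauss valuation on $K(x)$ with respect to $x$ and $v_K$; $x$ is a key polynomial for $v_0$ with $1/p>v_0(x)$, and $v_1$ is the corresponding augmentation $v_1(\sum_i a_ix^i)=\min_i (v_0(a_i)+i/p)$ for $a_i\in K$; $\phi$ is a key polynomial for $v_1$ with $m>v_1(\phi)$, and $v(\sum_i a_i\phi^i)=\min_i(v_1(a_i)+im)$ for $a_i\in K[x]$ with $\deg a_i<\deg\phi$. Moreover, $v$ is the restriction to $K(x)$ of the Gauss valuation $w$ on $L(y)$ with respect to $y$ and $v_L$, $w(\sum_i c_iy^i)=\min_i v_L(c_i)$ for $c_i\in L$. -/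

import Mathlib

open Polynomial AlgebraicGeometry CategoryTheory
open scoped WithZero NumberField

universe u

noncomputable section

namespace WildQuotient

/-! ### Valuations with values in `ℚ ∪ {∞}` -/

section Valuations

variable {F : Type u} [Field F]

open Classical in
/-- The additive valuation `c ↦ -log (μ c) / e` attached to a multiplicative valuation `μ` with
values in `ℤᵐ⁰`: it sends a uniformizer of `μ` to `1 / e`. -/
def ratValuation (μ : Valuation F ℤᵐ⁰) (e : ℕ) : AddValuation F (WithTop ℚ) :=
  AddValuation.of
    (fun c => if c = 0 then ⊤ else (((-(WithZero.log (μ c)) : ℤ) / (e : ℚ) : ℚ) : WithTop ℚ))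
    (by simp) (by simp)
    (by
      intro a b
      by_cases ha : a = 0
      · simp [ha]
      by_cases hb : b = 0
      · simp [hb]
      by_cases hab : a + b = 0
      · simp [hab]
      simp only [ha, hb, hab, if_false]
      have hm := μ.map_add a b
      have ha' : μ a ≠ 0 := (Valuation.ne_zero_iff μ).2 ha
      have hb' : μ b ≠ 0 := (Valuation.ne_zero_iff μ).2 hb
      have hab' : μ (a + b) ≠ 0 := (Valuation.ne_zero_iff μ).2 hab
      rcases le_max_iff.1 hm with h | h
      · refine le_trans (min_le_left _ _) (WithTop.coe_le_coe.2 ?_)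
        have := (WithZero.log_le_log hab' ha').2 h
        gcongr
      · refine le_trans (min_le_right _ _) (WithTop.coe_le_coe.2 ?_)
        have := (WithZero.log_le_log hab' hb').2 h
        gcongr)
    (by
      intro a b
      by_cases ha : a = 0
      · simp [ha]
      by_cases hb : b = 0
      · simp [hb]
      have ha' : μ a ≠ 0 := (Valuation.ne_zero_iff μ).2 ha
      have hb' : μ b ≠ 0 := (Valuation.ne_zero_iff μ).2 hb
      simp only [ha, hb, mul_eq_zero, or_self, if_false, map_mul, WithZero.log_mul ha' hb']
      rw [← WithTop.coe_add]
      congr 1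
      push_cast
      ring)

/-- `w` is the Gauss valuation on `E = F(t)` with respect to the parameter `t` and the valuation
`v` of `F`: `w (∑ cᵢ tⁱ) = min v (cᵢ)`. -/
def IsGaussValuation {E : Type u} [Field E] [Algebra F E] (v : AddValuation F (WithTop ℚ)) (t : E)
    (w : AddValuation E (WithTop ℚ)) : Prop :=
  ∀ g : F[X], w (aeval t g) = g.support.inf fun i => v (g.coeff i)

/-- The value `v(f)` of a polynomial `f`, for a valuation `v` on `F(x)`. -/
def polyVal (v : AddValuation (RatFunc F) (WithTop ℚ)) (f : F[X]) : WithTop ℚ :=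
  v (algebraMap F[X] (RatFunc F) f)

/-- `f` and `g` are `v`-equivalent: they are equal or `v(f - g) > v(f)`. -/
def VEquiv (v : AddValuation (RatFunc F) (WithTop ℚ)) (f g : F[X]) : Prop :=
  f = g ∨ polyVal v f < polyVal v (f - g)

/-- `f` equivalence-divides `g` with respect to `v`. -/
def VDvd (v : AddValuation (RatFunc F) (WithTop ℚ)) (f g : F[X]) : Prop :=
  ∃ h : F[X], VEquiv v g (f * h)

/-- MacLane's key polynomials over the valuation `v` of `F(x)` (which extends `v₀` on `F`):
nonconstant, monic, integral, `v`-irreducible and `v`-minimal. -/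
structure IsKeyPolynomial (v₀ : AddValuation F (WithTop ℚ))
    (v : AddValuation (RatFunc F) (WithTop ℚ)) (φ : F[X]) : Prop where
  monic : φ.Monic
  degree_pos : 0 < φ.natDegree
  integral : ∀ i, 0 ≤ v₀ (φ.coeff i)
  irreducible : ∀ f g : F[X], VDvd v φ (f * g) → VDvd v φ f ∨ VDvd v φ g
  minimal : ∀ f : F[X], f ≠ 0 → VDvd v φ f → φ.natDegree ≤ f.natDegree

/-- `v' = [v, v'(φ) = r]` is the augmentation of `v` by the key polynomial `φ` and the value
`r > v(φ)`: on `φ`-adic expansions `v'(∑ aᵢ φⁱ) = min (v(aᵢ) + i r)`, where `deg aᵢ < deg φ`. -/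
structure IsAugmentation (v₀ : AddValuation F (WithTop ℚ))
    (v : AddValuation (RatFunc F) (WithTop ℚ)) (φ : F[X]) (r : ℚ)
    (v' : AddValuation (RatFunc F) (WithTop ℚ)) : Prop where
  isKey : IsKeyPolynomial v₀ v φ
  lt : polyVal v φ < (r : WithTop ℚ)
  expansion : ∀ (n : ℕ) (a : ℕ → F[X]), (∀ i, (a i).degree < φ.degree) →
    polyVal v' (∑ i ∈ Finset.range n, a i * φ ^ i) =
      (Finset.range n).inf fun i => polyVal v (a i) + (((i : ℚ) * r : ℚ) : WithTop ℚ)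

/-- `IsInductiveValuation v₀ [(φ₁, r₁), …, (φₙ, rₙ)] v` says that `v` is the inductive valuation
`[v_Gauss, v₁(φ₁) = r₁, …, vₙ(φₙ) = rₙ]` on `F(x)`: it arises from the Gauss valuation with
respect to `x` by these successive augmentations. -/
inductive IsInductiveValuation (v₀ : AddValuation F (WithTop ℚ)) :
    List (F[X] × ℚ) → AddValuation (RatFunc F) (WithTop ℚ) → Prop
  | gauss (v : AddValuation (RatFunc F) (WithTop ℚ)) :
      IsGaussValuation v₀ (RatFunc.X : RatFunc F) v → IsInductiveValuation v₀ [] v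
  | augment (l : List (F[X] × ℚ)) (v v' : AddValuation (RatFunc F) (WithTop ℚ))
      (φ : F[X]) (r : ℚ) : IsInductiveValuation v₀ l v → IsAugmentation v₀ v φ r v' →
      IsInductiveValuation v₀ (l ++ [(φ, r)]) v'

/-- The homomorphism `F(x) → E(x)` which is `τ` on coefficients and fixes `x`. -/
def coeffMap {E : Type u} [Field E] (τ : F →+* E) : RatFunc F →+* RatFunc E :=
  RatFunc.mapRingHom (Polynomial.mapRingHom τ)
    (nonZeroDivisors_le_comap_nonZeroDivisors_of_injective _
      (Polynomial.map_injective τ τ.injective))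

end Valuations

/-! ### The projective line over a ring -/

section ProjectiveLine

attribute [local instance] MvPolynomial.gradedAlgebra

/-- The projective line over `A`, with homogeneous coordinates `X 0`, `X 1`. -/
abbrev P1 (A : Type u) [CommRing A] : Scheme.{u} :=
  Proj (MvPolynomial.homogeneousSubmodule (Fin 2) A)

/-- The structure morphism of the projective line. -/
def P1.toSpec (A : Type u) [CommRing A] : P1 A ⟶ Spec (CommRingCat.of A) :=
  Proj.toSpecZero (MvPolynomial.homogeneousSubmodule (Fin 2) A) ≫
    Spec.map (CommRingCat.ofHom
      (algebraMap A (MvPolynomial.homogeneousSubmodule (Fin 2) A 0)))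

variable {A F : Type u} [CommRing A] [Field F] [Algebra A F]

/-- Evaluation at the point `[t : 1]` of functions on the chart `X 1 ≠ 0`; it sends the
affine coordinate `X 0 / X 1` to `t`. -/
def P1.evalAt (t : F) :
    HomogeneousLocalization.Away (MvPolynomial.homogeneousSubmodule (Fin 2) A)
      (MvPolynomial.X 1) →+* F :=
  (IsLocalization.Away.lift (S := Localization.Away (MvPolynomial.X 1 : MvPolynomial (Fin 2) A))
    (MvPolynomial.X 1) (g := ((MvPolynomial.aeval ![t, 1] : MvPolynomial (Fin 2) A →ₐ[A] F) :
      MvPolynomial (Fin 2) A →+* F)) (by simp)).comp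
    (algebraMap (HomogeneousLocalization.Away
      (MvPolynomial.homogeneousSubmodule (Fin 2) A) (MvPolynomial.X 1)) _)

/-- The `F`-valued point `[t : 1]` of the projective line. -/
def P1.point (t : F) : Spec (CommRingCat.of F) ⟶ P1 A :=
  Spec.map (CommRingCat.ofHom (P1.evalAt t)) ≫
    Proj.awayι (MvPolynomial.homogeneousSubmodule (Fin 2) A) (MvPolynomial.X 1)
      ((MvPolynomial.mem_homogeneousSubmodule _ _).2 (MvPolynomial.isHomogeneous_X A 1)) one_pos

end ProjectiveLine

/-! ### Quotients of schemes by groups -/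

section Quotients

variable {X Y : Scheme.{u}}

theorem preimage_le_of_comp_eq (a : Y ⟶ Y) (q : Y ⟶ X) (h : a ≫ q = q) (U : X.Opens) :
    q ⁻¹ᵁ U ≤ a ⁻¹ᵁ (q ⁻¹ᵁ U) := by
  rw [← Scheme.Hom.comp_preimage, h]

/-- `q : Y ⟶ X` is the quotient of `Y` by the action `ρ` of `G`: it is the quotient by `G` on
topological spaces, and the functions on `X` are the `G`-invariant functions on `Y`. -/
structure IsQuotient {G : Type*} [Group G] (ρ : G →* Aut Y) (q : Y ⟶ X) : Prop where
  invariant : ∀ g, (ρ g).hom ≫ q = q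
  isQuotientMap : Topology.IsQuotientMap q
  orbits : ∀ y y' : Y, q y = q y' → ∃ g, (ρ g).hom y = y'
  injective : ∀ U : X.Opens, Function.Injective (q.app U)
  sections : ∀ (U : X.Opens) (s : Γ(Y, q ⁻¹ᵁ U)),
    (∃ r : Γ(X, U), q.app U r = s) ↔
      ∀ g, (ρ g).hom.appLE (q ⁻¹ᵁ U) (q ⁻¹ᵁ U)
        (preimage_le_of_comp_eq _ q (invariant g) U) s = s

end Quotients

/-! ### Special fibers and their components -/

section SpecialFiber

variable {R : Type u} [CommRing R] [IsLocalRing R] {X : Scheme.{u}}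

/-- The underlying closed subset of the special fiber of a scheme over a local ring. -/
def specialFiber (f : X ⟶ Spec (CommRingCat.of R)) : Set X :=
  f ⁻¹' {IsLocalRing.closedPoint R}

/-- `ξ` is the generic point of an irreducible component of the special fiber. -/
def IsComponentPoint (f : X ⟶ Spec (CommRingCat.of R)) (ξ : X) : Prop :=
  ∃ Z : Set X, Maximal (fun S => IsIrreducible S ∧ S ⊆ specialFiber f) Z ∧ IsGenericPoint ξ Z

/-- The set `V(X)` of valuations of the function field of `X`, identified with `F` by `ι`, which
correspond to the irreducible components of the special fiber of `X`: the valuation ring is the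
local ring of `X` at the generic point of the component, and the valuation is normalized so that
it extends the given valuation `v₀` of the base field `K`. -/
def componentValuations {K F : Type u} [Field K] [Field F] [Algebra K F] [IsIntegral X]
    (v₀ : AddValuation K (WithTop ℚ)) (f : X ⟶ Spec (CommRingCat.of R))
    (ι : X.functionField ≃+* F) : Set (AddValuation F (WithTop ℚ)) :=
  {v | (∀ c : K, v (algebraMap K F c) = v₀ c) ∧ ∃ ξ : X, IsComponentPoint f ξ ∧
    ∀ h : X.functionField,
      0 ≤ v (ι h) ↔ h ∈ (algebraMap (X.presheaf.stalk ξ) X.functionField).range}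

end SpecialFiber

/-! ### The quotient model of the projective line -/

section Model

variable {K L : Type u} [Field K] [NumberField K] [Field L] [Algebra K L]

/-- The valuation ring `R` of `v_K`, for the prime ideal `𝔭` of `K`. -/
abbrev baseRing (𝔭 : IsDedekindDomain.HeightOneSpectrum (𝓞 K)) : ValuationSubring K :=
  (𝔭.valuation K).valuationSubring

variable (L) in
/-- The integral closure `R_L` of `R` in `L`. -/
abbrev extRing (𝔭 : IsDedekindDomain.HeightOneSpectrum (𝓞 K)) : Type u :=
  integralClosure (baseRing 𝔭) L

/-- The rational function `y = (x - π_L) / π_L ^ m` in `L(x)`. -/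
def yCoord (πL : L) (m : ℕ) : RatFunc L :=
  (RatFunc.X - RatFunc.C πL) / RatFunc.C πL ^ m

/-- The generic point `Spec L(x) ⟶ Y` of the model `Y = ℙ¹` over `R_L` of `ℙ¹` over `L`, on which
`y` is the affine coordinate. It identifies the function field of `Y` with `L(x) = L(y)`. -/
def genericPointY (𝔭 : IsDedekindDomain.HeightOneSpectrum (𝓞 K)) (πL : L) (m : ℕ) :
    Spec (CommRingCat.of (RatFunc L)) ⟶ P1 (extRing L 𝔭) :=
  P1.point (yCoord πL m)

/-- The quotient `X = Y / Gal(L/K)` of the model `Y`, an integral scheme over `R` together with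
the identification of its function field with `K(x)`. -/
structure QuotientModel (𝔭 : IsDedekindDomain.HeightOneSpectrum (𝓞 K)) (πL : L) (m : ℕ) where
  /-- The action on `Y` extending the natural action on `ℙ¹_L`; on functions, `g` acts on the
  coefficients and fixes `x`. -/
  ρ : Gal(L/K) →* Aut (P1 (extRing L 𝔭))
  ρ_compat : ∀ g : Gal(L/K), genericPointY 𝔭 πL m ≫ (ρ g).hom =
    Spec.map (CommRingCat.ofHom (coeffMap (g⁻¹ : Gal(L/K)).toRingEquiv.toRingHom)) ≫
      genericPointY 𝔭 πL m
  /-- The quotient scheme. -/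
  X : Scheme.{u}
  /-- The quotient map. -/
  q : P1 (extRing L 𝔭) ⟶ X
  isQuotient : IsQuotient ρ q
  isIntegral : IsIntegral X
  /-- The structure morphism. -/
  f : X ⟶ Spec (CommRingCat.of (baseRing 𝔭))
  f_compat : q ≫ f = P1.toSpec (extRing L 𝔭) ≫
    Spec.map (CommRingCat.ofHom (algebraMap (baseRing 𝔭) (extRing L 𝔭)))
  /-- The identification of the function field with `K(x)`, compatible with the one of `Y`. -/
  ι : X.functionField ≃+* RatFunc K
  ι_compat : genericPointY 𝔭 πL m ≫ q =
    Spec.map (CommRingCat.ofHom (coeffMap (algebraMap K L))) ≫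
      Spec.map (CommRingCat.ofHom ι.toRingHom) ≫ X.fromSpecStalk (genericPoint X)

attribute [instance] QuotientModel.isIntegral

end Model

end WildQuotient

end

/-!
The proof compares everything with the Gauss valuation `w` of `L(x)` with respect to the
coordinate `y = (x - π) / π ^ m`, where `π` is the given uniformizer of `L`.

*The valuation.* Let `v` be the restriction of `w` to `K(x)`. It is the second of two restrictions
of Gauss valuations of discs: the disc around `0` with radius given by `π` yields `[v₀, v₁ x = 1/p]`
(`stageOne`), and the disc around `π` with radius given by `π ^ m` yields `v` (`stageTwo`). A
valuation `w' ≥ v'` which agrees with `v'` below the degree of a monic polynomial `φ` and is larger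
at `φ` makes `φ` a key polynomial, because equivalence-divisibility by `φ` then means `v' f < w' f`
(`vDvd_iff_lt`), and the expansion formula follows from an upper bound for `w' (a + φ q)`
(`isAugmentation_of_le`). For the minimal polynomial `φ` of `π` the bound is the value at the centre
`π` of the disc, where `φ` vanishes; polynomials of degree less than `p` have the value at `π`
predicted by their terms since the values of the terms are distinct modulo `ℤ`. All conjugates of
`π` lie in the disc around `π`, so `v φ = m` (`polyVal_stageTwo_minpoly`), and wild ramification
gives `v φ > 1 = v₁ φ` (`one_lt_m`).

*The quotient.* By the choice of `m`, an element `g` of the Galois group maps `y` to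
`(π / g π) ^ m * y + (π - g π) / (g π) ^ m`, whose coefficients lie in `R_L` (`isAffineCocycle`).
Hence the group acts on the graded ring `R_L[X₀, X₁]`. Invariant forms without a common zero exist,
namely `X₁` and the norm of `X₀` (`coversProj`), so the homogeneous spectrum of the ring of
invariants is the quotient (`isQuotient_projMap`). Its function field is `K(x)` by Galois descent
for rational functions (`fieldRange_eq_of_cocycle`).

*The special fiber.* For any quotient model, the local ring of `ℙ¹` over `R_L` at the generic point
`z` of the special fiber (`gaussPoint`) is the valuation ring of `w`, and `z` specializes to every
point of the special fiber, because a form in the maximal ideal at `z` is divisible by `π`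
(`gaussPoint_specializes`). So `z` is fixed by the group, the special fiber of the quotient is the
closure of the image of `z` (`isGenericPoint_specialFiber`), and the local ring there is the part of
the valuation ring of `w` in `K(x)`, that is, the valuation ring of `v` (`mem_range_stalk_iff`).
Finally `v` is the only valuation with this valuation ring that extends the valuation of `K`, since
its values lie in `(1/p) ℤ` (`eq_stageTwo`).
-/

noncomputable section

namespace WildQuotient

/-! ### Gauss valuations -/

section Gauss

variable {F : Type u} [Field F] (v : AddValuation F (WithTop ℚ))

/-- The minimum of the valuations of the coefficients of a polynomial. -/
def gaussInf (f : F[X]) : WithTop ℚ := f.support.inf fun i => v (f.coeff i)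

lemma gaussInf_le (f : F[X]) (i : ℕ) : gaussInf v f ≤ v (f.coeff i) := by
  by_cases h : i ∈ f.support
  · exact Finset.inf_le (f := fun i => v (f.coeff i)) h
  · rw [notMem_support_iff.1 h, v.map_zero]
    exact le_top

variable {v} in
lemma le_gaussInf {f : F[X]} {c : WithTop ℚ} (h : ∀ i, c ≤ v (f.coeff i)) : c ≤ gaussInf v f :=
  Finset.le_inf fun i _ => h i

lemma exists_gaussInf_eq_first (f : F[X]) (hf : f ≠ 0) :
    ∃ i, v (f.coeff i) = gaussInf v f ∧ ∀ j < i, gaussInf v f < v (f.coeff j) := by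
  classical
  have hex : ∃ i, v (f.coeff i) = gaussInf v f := by
    obtain ⟨i, _, hi⟩ := Finset.exists_mem_eq_inf f.support (support_nonempty.2 hf)
      fun i => v (f.coeff i)
    exact ⟨i, hi.symm⟩
  exact ⟨Nat.find hex, Nat.find_spec hex, fun j hj =>
    lt_of_le_of_ne (gaussInf_le v f j) fun h => Nat.find_min hex hj h.symm⟩

lemma gaussInf_eq_top_iff (f : F[X]) : gaussInf v f = ⊤ ↔ f = 0 := by
  constructor
  · intro h
    ext i
    have := gaussInf_le v f i
    rw [h, top_le_iff, v.top_iff] at this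
    simpa using this
  · rintro rfl
    simp [gaussInf]

lemma gaussInf_add_le (f g : F[X]) : min (gaussInf v f) (gaussInf v g) ≤ gaussInf v (f + g) :=
  le_gaussInf fun i => by
    rw [coeff_add]
    exact (min_le_min (gaussInf_le v f i) (gaussInf_le v g i)).trans (v.map_add _ _)

/-- Gauss's lemma: among the products of coefficients contributing to the coefficient of `f * g`
at the sum of the first indices where the minimum is attained, exactly one has minimal value. -/
lemma gaussInf_mul (f g : F[X]) : gaussInf v (f * g) = gaussInf v f + gaussInf v g := by
  classical
  by_cases hf : f = 0
  · simp [hf, (gaussInf_eq_top_iff v (0 : F[X])).2 rfl]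
  by_cases hg : g = 0
  · simp [hg, (gaussInf_eq_top_iff v (0 : F[X])).2 rfl]
  refine le_antisymm ?_ (le_gaussInf fun k => ?_)
  · obtain ⟨i, hi, hi'⟩ := exists_gaussInf_eq_first v f hf
    obtain ⟨j, hj, hj'⟩ := exists_gaussInf_eq_first v g hg
    have hft : gaussInf v f ≠ ⊤ := fun h => hf ((gaussInf_eq_top_iff v f).1 h)
    have hgt : gaussInf v g ≠ ⊤ := fun h => hg ((gaussInf_eq_top_iff v g).1 h)
    refine (gaussInf_le v (f * g) (i + j)).trans_eq ?_
    have hmem : (i, j) ∈ Finset.HasAntidiagonal.antidiagonal (i + j) := by simp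
    rw [coeff_mul, ← Finset.add_sum_erase _ _ hmem]
    have hval : v (f.coeff i * g.coeff j) = gaussInf v f + gaussInf v g := by
      rw [v.map_mul, hi, hj]
    rw [v.map_add_eq_of_lt_left, hval]
    rw [hval]
    refine v.map_lt_sum (WithTop.add_ne_top.2 ⟨hft, hgt⟩) fun x hx => ?_
    obtain ⟨a, b⟩ := x
    simp only [Finset.mem_erase, ne_eq, Prod.mk.injEq,
      Finset.HasAntidiagonal.mem_antidiagonal] at hx
    rw [v.map_mul]
    rcases lt_trichotomy a i with h | h | h
    · exact WithTop.add_lt_add_of_lt_of_le hgt (hi' a h) (gaussInf_le v g b)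
    · omega
    · exact WithTop.add_lt_add_of_le_of_lt hft (gaussInf_le v f a) (hj' b (by omega))
  · rw [coeff_mul]
    refine v.map_le_sum fun x _ => ?_
    rw [v.map_mul]
    exact add_le_add (gaussInf_le v f _) (gaussInf_le v g _)

/-- The Gauss valuation on polynomials. -/
def gaussPoly : AddValuation F[X] (WithTop ℚ) :=
  AddValuation.of (gaussInf v) ((gaussInf_eq_top_iff v 0).2 rfl)
    (by
      rw [gaussInf, ← C_1, support_C one_ne_zero]
      simp)
    (gaussInf_add_le v) (gaussInf_mul v)

lemma gaussPoly_apply (f : F[X]) : gaussPoly v f = gaussInf v f := rfl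

lemma nonZeroDivisors_le_supp_gaussPoly : nonZeroDivisors F[X] ≤
    (AddValuation.toValuation (gaussPoly v)).supp.primeCompl :=
  fun f hf hf' => nonZeroDivisors.ne_zero hf ((gaussInf_eq_top_iff v f).1 hf')

/-- The Gauss valuation on `F(x)` with respect to the parameter `x`. -/
def gaussRat : AddValuation (RatFunc F) (WithTop ℚ) :=
  AddValuation.ofValuation ((AddValuation.toValuation (gaussPoly v)).extendToLocalization
    (nonZeroDivisors_le_supp_gaussPoly v) (RatFunc F))

lemma gaussRat_algebraMap (f : F[X]) :
    gaussRat v (algebraMap F[X] (RatFunc F) f) = gaussInf v f :=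
  Valuation.extendToLocalization_apply_map_apply (Γ := Multiplicative (WithTop ℚ)ᵒᵈ)
    (AddValuation.toValuation (gaussPoly v)) (nonZeroDivisors_le_supp_gaussPoly v) (RatFunc F) f

/-- The endomorphism `x ↦ b x + a` of `F(x)`. -/
def affineSubst (a b : F) (hb : b ≠ 0) : RatFunc F →ₐ[F] RatFunc F :=
  RatFunc.mapAlgHom (aeval (C b * X + C a)) <| by
    refine nonZeroDivisors_le_comap_nonZeroDivisors_of_injective _ ?_
    rw [injective_iff_map_eq_zero]
    intro f hf
    have : (f.comp (C b * X + C a)) = 0 := hf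
    rw [comp_eq_zero_iff] at this
    rcases this with h | ⟨_, h⟩
    · exact h
    · have := congrArg (coeff · 1) h
      simp at this
      exact absurd this hb

/-- The Gauss valuation on `F(x)` with respect to the parameter `(x - a) / b`. -/
def discVal (a b : F) (hb : b ≠ 0) : AddValuation (RatFunc F) (WithTop ℚ) :=
  (gaussRat v).comap (affineSubst a b hb).toRingHom

lemma affineSubst_X (a b : F) (hb : b ≠ 0) :
    affineSubst a b hb RatFunc.X = RatFunc.C b * RatFunc.X + RatFunc.C a := by
  rw [affineSubst, RatFunc.coe_mapAlgHom_eq_coe_map, ← RatFunc.algebraMap_X,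
    ← div_one (algebraMap F[X] (RatFunc F) X), ← map_one (algebraMap F[X] (RatFunc F)),
    RatFunc.map_apply_div]
  simp

lemma affineSubst_C (a b : F) (hb : b ≠ 0) (c : F) :
    affineSubst a b hb (RatFunc.C c) = RatFunc.C c := by
  rw [← RatFunc.algebraMap_eq_C]
  exact (affineSubst a b hb).commutes c

lemma affineSubst_param (a b : F) (hb : b ≠ 0) :
    affineSubst a b hb ((RatFunc.X - RatFunc.C a) / RatFunc.C b) = RatFunc.X := by
  have : (RatFunc.C b : RatFunc F) ≠ 0 := by simpa using hb
  rw [map_div₀, map_sub, affineSubst_X, affineSubst_C, affineSubst_C]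
  field_simp
  ring

lemma isGaussValuation_discVal (a b : F) (hb : b ≠ 0) :
    IsGaussValuation v ((RatFunc.X - RatFunc.C a) / RatFunc.C b) (discVal v a b hb) := by
  intro g
  change gaussRat v (affineSubst a b hb _) = _
  rw [← Polynomial.aeval_algHom_apply, affineSubst_param, RatFunc.aeval_X_left_eq_algebraMap,
    gaussRat_algebraMap]
  rfl

variable {v}

section Properties

variable {E : Type u} [Field E] [Algebra F E] {t : E} {w : AddValuation E (WithTop ℚ)}

lemma IsGaussValuation.apply (hw : IsGaussValuation v t w) (g : F[X]) :
    w (aeval t g) = gaussInf v g := hw g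

lemma gaussInf_C (c : F) : gaussInf v (C c) = v c := by
  by_cases h : c = 0
  · simp [h, gaussInf]
  · simp [gaussInf, support_C h]

lemma IsGaussValuation.map_algebraMap (hw : IsGaussValuation v t w) (c : F) :
    w (algebraMap F E c) = v c := by
  rw [← aeval_C t c, hw.apply, gaussInf_C]

/-- `w (b t + a) = min (v b, v a)`. -/
lemma IsGaussValuation.linear (hw : IsGaussValuation v t w) (a b : F) :
    w (algebraMap F E b * t + algebraMap F E a) = min (v b) (v a) := by
  have : algebraMap F E b * t + algebraMap F E a = aeval t (C b * X + C a) := by simp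
  rw [this, hw.apply]
  refine le_antisymm (le_min ?_ ?_) (le_gaussInf fun i => ?_)
  · exact (gaussInf_le v _ 1).trans_eq (congrArg v (by simp [coeff_C]))
  · exact (gaussInf_le v _ 0).trans_eq (congrArg v (by simp))
  · have : (C b * X + C a).coeff i = if i = 0 then a else if i = 1 then b else 0 := by
      rcases i with _ | _ | i <;> simp [coeff_X, coeff_C]
    rw [this]
    split_ifs
    exacts [min_le_right _ _, min_le_left _ _, by simp]

/-- The value of the Gauss valuation is at most the value at the centre of the disc. -/
lemma IsGaussValuation.le_eval_zero (hw : IsGaussValuation v t w) (g : F[X]) :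
    w (aeval t g) ≤ v (g.eval 0) := by
  rw [hw.apply, ← coeff_zero_eq_eval_zero]
  exact gaussInf_le v g 0

end Properties

end Gauss

/-! ### The extension of the valuation to a totally ramified extension -/

section Ramified

open IsDedekindDomain

variable {F : Type u} [Field F]

lemma ratValuation_of_ne_zero (μ : Valuation F ℤᵐ⁰) (e : ℕ) {c : F} (hc : c ≠ 0) :
    ratValuation μ e c = (((-(WithZero.log (μ c)) : ℤ) / (e : ℚ) : ℚ) : WithTop ℚ) :=
  if_neg hc

lemma ratValuation_of_eq_exp (μ : Valuation F ℤᵐ⁰) (e : ℕ) {c : F} {n : ℤ}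
    (hc : μ c = WithZero.exp (-n)) : ratValuation μ e c = (((n : ℚ) / e : ℚ) : WithTop ℚ) := by
  have h0 : c ≠ 0 := by
    rintro rfl
    exact WithZero.exp_ne_zero (hc.symm.trans (map_zero μ))
  rw [ratValuation_of_ne_zero μ e h0, hc]
  simp

lemma ratValuation_nonneg_iff (μ : Valuation F ℤᵐ⁰) {e : ℕ} (he : 0 < e) (c : F) :
    0 ≤ ratValuation μ e c ↔ μ c ≤ 1 := by
  by_cases hc : c = 0
  · simp [hc]
  have hμ : μ c ≠ 0 := (Valuation.ne_zero_iff μ).2 hc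
  rw [ratValuation_of_ne_zero μ e hc, ← WithTop.coe_zero, WithTop.coe_le_coe,
    ← WithZero.log_le_log hμ one_ne_zero, WithZero.log_one]
  have : (0 : ℚ) < e := by exact_mod_cast he
  rw [le_div_iff₀ this, zero_mul]
  push_cast
  constructor <;> intro h
  · exact_mod_cast neg_nonneg.1 h
  · exact neg_nonneg.2 (by exact_mod_cast h)

lemma ratValuation_pos_iff (μ : Valuation F ℤᵐ⁰) {e : ℕ} (he : 0 < e) (c : F) :
    0 < ratValuation μ e c ↔ μ c < 1 := by
  by_cases hc : c = 0
  · simp [hc]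
  have hμ : μ c ≠ 0 := (Valuation.ne_zero_iff μ).2 hc
  rw [ratValuation_of_ne_zero μ e hc, ← WithTop.coe_zero, WithTop.coe_lt_coe,
    ← WithZero.log_lt_log hμ one_ne_zero, WithZero.log_one]
  have : (0 : ℚ) < e := by exact_mod_cast he
  rw [lt_div_iff₀ this, zero_mul]
  push_cast
  constructor <;> intro h
  · exact_mod_cast neg_pos.1 h
  · exact neg_pos.2 (by exact_mod_cast h)

variable {K L : Type u} [Field K] [NumberField K] [Field L] [NumberField L] [Algebra K L]
  {p : ℕ} {𝔭 : HeightOneSpectrum (𝓞 K)} {𝔓 : HeightOneSpectrum (𝓞 L)}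

omit [NumberField L] in
lemma liesOver_of_map_eq_pow (hp : p ≠ 0)
    (hram : 𝔭.asIdeal.map (algebraMap (𝓞 K) (𝓞 L)) = 𝔓.asIdeal ^ p) :
    𝔓.asIdeal.LiesOver 𝔭.asIdeal := by
  constructor
  refine 𝔭.isMaximal.eq_of_le ?_
    (Ideal.map_le_iff_le_comap.1 (hram.le.trans (Ideal.pow_le_self hp)))
  exact (𝔓.isPrime.under (𝓞 K)).ne_top

lemma valuation_algebraMap_eq_pow (hp : p ≠ 0)
    (hram : 𝔭.asIdeal.map (algebraMap (𝓞 K) (𝓞 L)) = 𝔓.asIdeal ^ p) (c : K) :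
    𝔓.valuation L (algebraMap K L c) = 𝔭.valuation K c ^ p := by
  have := liesOver_of_map_eq_pow hp hram
  have he : 𝔭.asIdeal.ramificationIdx' 𝔓.asIdeal = p := by
    refine Ideal.ramificationIdx'_spec hram.le ?_
    rw [hram]
    intro h
    have h1 : 𝔓.asIdeal ^ p ≠ 0 := pow_ne_zero _ 𝔓.ne_bot
    have := Ideal.pow_right_strictAnti 𝔓.asIdeal 𝔓.ne_bot 𝔓.isPrime.ne_top (Nat.lt_succ_self p)
    exact absurd h this.not_ge
  rw [← HeightOneSpectrum.valuation_liesOver L 𝔭 𝔓, he]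

lemma ratValuation_algebraMap (hp : p ≠ 0)
    (hram : 𝔭.asIdeal.map (algebraMap (𝓞 K) (𝓞 L)) = 𝔓.asIdeal ^ p) (c : K) :
    ratValuation (𝔓.valuation L) p (algebraMap K L c) = ratValuation (𝔭.valuation K) 1 c := by
  by_cases hc : c = 0
  · simp [hc]
  rw [ratValuation_of_ne_zero _ _ hc, ratValuation_of_ne_zero _ _ (by simpa using hc),
    valuation_algebraMap_eq_pow hp hram, WithZero.log_pow]
  congr 1
  have : (p : ℚ) ≠ 0 := by exact_mod_cast hp
  rw [nsmul_eq_mul]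
  push_cast
  field_simp

omit [NumberField K] in
lemma comap_mapRingEquiv_eq (hp : p ≠ 0)
    (hram : 𝔭.asIdeal.map (algebraMap (𝓞 K) (𝓞 L)) = 𝔓.asIdeal ^ p) (g : Gal(L/K)) :
    𝔓.asIdeal.comap (NumberField.RingOfIntegers.mapRingEquiv g.toRingEquiv) = 𝔓.asIdeal := by
  set e := NumberField.RingOfIntegers.mapRingEquiv (g.toRingEquiv : L ≃+* L)
  have hprime : (𝔓.asIdeal.comap e).IsPrime := 𝔓.isPrime.comap e
  refine (𝔓.isMaximal.eq_of_le hprime.ne_top ?_).symm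
  have h : 𝔓.asIdeal ^ p ≤ 𝔓.asIdeal.comap e := by
    rw [← hram, Ideal.map_le_iff_le_comap]
    intro a ha
    have hfix : e (algebraMap (𝓞 K) (𝓞 L) a) = algebraMap (𝓞 K) (𝓞 L) a := by
      ext
      exact g.commutes _
    rw [Ideal.mem_comap, Ideal.mem_comap, hfix]
    exact Ideal.pow_le_self hp (hram ▸ Ideal.mem_map_of_mem _ ha)
  exact hprime.le_of_pow_le h

omit [NumberField K] in
/-- As `𝔓` is the only prime above `𝔭`, its valuation is invariant under the Galois group. -/
lemma valuation_gal (hp : p ≠ 0)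
    (hram : 𝔭.asIdeal.map (algebraMap (𝓞 K) (𝓞 L)) = 𝔓.asIdeal ^ p) (g : Gal(L/K)) (a : L) :
    𝔓.valuation L (g a) = 𝔓.valuation L a := by
  have key : ∀ (g : Gal(L/K)) (r : 𝓞 L),
      𝔓.intValuation (NumberField.RingOfIntegers.mapRingEquiv g.toRingEquiv r)
        ≤ 𝔓.intValuation r := by
    intro g r
    by_cases hr : r = 0
    · simp [hr]
    rw [HeightOneSpectrum.intValuation_if_neg 𝔓 hr, HeightOneSpectrum.intValuation_le_pow_iff_mem]
    have hmem : r ∈ 𝔓.asIdeal ^ (Associates.mk 𝔓.asIdeal).count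
        (Associates.mk (Ideal.span {r})).factors := by
      rw [← HeightOneSpectrum.intValuation_le_pow_iff_mem,
        HeightOneSpectrum.intValuation_if_neg 𝔓 hr]
    have := Ideal.mem_map_of_mem (NumberField.RingOfIntegers.mapRingEquiv g.toRingEquiv) hmem
    rw [Ideal.map_pow] at this
    refine Ideal.pow_right_mono ?_ _ this
    rw [Ideal.map_le_iff_le_comap, comap_mapRingEquiv_eq hp hram]
  have key' : ∀ (g : Gal(L/K)) (r : 𝓞 L),
      𝔓.intValuation (NumberField.RingOfIntegers.mapRingEquiv g.toRingEquiv r)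
        = 𝔓.intValuation r := by
    intro g r
    refine le_antisymm (key g r) ?_
    convert key g⁻¹ (NumberField.RingOfIntegers.mapRingEquiv g.toRingEquiv r) using 2
    ext
    exact (g.symm_apply_apply _).symm
  obtain ⟨r, s, hs, rfl⟩ := IsFractionRing.div_surjective (A := 𝓞 L) a
  have hg : ∀ r : 𝓞 L, g (algebraMap (𝓞 L) L r) =
    algebraMap (𝓞 L) L (NumberField.RingOfIntegers.mapRingEquiv g.toRingEquiv r) := fun r => rfl
  rw [map_div₀, map_div₀, map_div₀, hg, hg]
  simp only [HeightOneSpectrum.valuation_of_algebraMap, key']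

omit [NumberField K] in
lemma ratValuation_gal (hp : p ≠ 0)
    (hram : 𝔭.asIdeal.map (algebraMap (𝓞 K) (𝓞 L)) = 𝔓.asIdeal ^ p) (g : Gal(L/K)) (a : L) :
    ratValuation (𝔓.valuation L) p (g a) = ratValuation (𝔓.valuation L) p a := by
  by_cases ha : a = 0
  · simp [ha]
  rw [ratValuation_of_ne_zero _ _ ha, ratValuation_of_ne_zero _ _ (by simpa using ha),
    valuation_gal hp hram]

end Ramified

/-! ### Criteria for key polynomials and augmentations -/

section Augmentation

variable {R : Type*} [CommRing R] {F : Type u} [Field F]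

lemma map_prod_addValuation (v : AddValuation R (WithTop ℚ)) {ι : Type*} (s : Finset ι)
    (f : ι → R) : v (∏ i ∈ s, f i) = ∑ i ∈ s, v (f i) := by
  classical
  induction s using Finset.induction_on with
  | empty => simp
  | insert a s ha ih => rw [Finset.prod_insert ha, Finset.sum_insert ha, v.map_mul, ih]

/-- If the summands have pairwise distinct values, the value of the sum is the minimum. -/
lemma map_sum_of_injOn (v : AddValuation R (WithTop ℚ)) {ι : Type*} (s : Finset ι)
    (f : ι → R) (h : Set.InjOn (fun i => v (f i)) s) :
    v (∑ i ∈ s, f i) = s.inf fun i => v (f i) := by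
  classical
  induction s using Finset.induction_on with
  | empty => simp
  | insert a s ha ih =>
    have ih' := ih (h.mono (by simp))
    rw [Finset.sum_insert ha, Finset.inf_insert]
    rcases s.eq_empty_or_nonempty with rfl | hs
    · simp
    rw [v.map_add_of_distinct_val, ih']
    obtain ⟨j, hj, hj'⟩ := Finset.exists_mem_eq_inf s hs fun i => v (f i)
    rw [ih', hj']
    intro heq
    have := h (by simp) (by simp [hj]) heq
    exact ha (this ▸ hj)

variable (v : AddValuation (RatFunc F) (WithTop ℚ)) (f g : F[X])

lemma polyVal_add : min (polyVal v f) (polyVal v g) ≤ polyVal v (f + g) := by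
  simpa only [polyVal, map_add] using v.map_add _ _

lemma polyVal_sub : min (polyVal v f) (polyVal v g) ≤ polyVal v (f - g) := by
  simpa only [polyVal, map_sub] using v.map_sub _ _

lemma polyVal_mul : polyVal v (f * g) = polyVal v f + polyVal v g := by
  simp only [polyVal, map_mul, v.map_mul]

lemma polyVal_zero : polyVal v (0 : F[X]) = ⊤ := by simp [polyVal]

variable {v} {w : AddValuation (RatFunc F) (WithTop ℚ)} {φ : F[X]}

/-- Let `v ≤ w` be valuations which agree on polynomials of degree less than that of the monic
polynomial `φ`, with `v φ < w φ`. Then `φ` equivalence-divides exactly those polynomials on which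
`v` and `w` differ. -/
lemma vDvd_iff_lt (hφ : φ.Monic) (hle : ∀ f, polyVal v f ≤ polyVal w f)
    (heq : ∀ f : F[X], f.degree < φ.degree → polyVal v f = polyVal w f)
    (hlt : polyVal v φ < polyVal w φ) (f : F[X]) :
    VDvd v φ f ↔ f = 0 ∨ polyVal v f < polyVal w f := by
  have hmul : ∀ q : F[X], q ≠ 0 → polyVal v (φ * q) < polyVal w (φ * q) := by
    intro q hq
    rw [polyVal_mul, polyVal_mul]
    refine WithTop.add_lt_add_of_lt_of_le ?_ hlt (hle q)
    rw [polyVal, v.ne_top_iff]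
    simpa using hq
  constructor
  · rintro ⟨h, rfl | h'⟩
    · by_cases hh : h = 0
      · simp [hh]
      · exact Or.inr (hmul h hh)
    · right
      by_cases hh : h = 0
      · simp [hh] at h'
      have h1 : polyVal v (φ * h) = polyVal v f := by
        have h2 : polyVal v f < v (algebraMap F[X] (RatFunc F) (φ * h) - algebraMap F[X] _ f) := by
          rw [← AddValuation.map_sub_swap, ← map_sub]
          exact h'
        exact v.map_eq_of_lt_sub h2
      have h2 : f = (f - φ * h) + φ * h := by ring
      have h3 := polyVal_add w (f - φ * h) (φ * h)
      rw [← h2] at h3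
      exact (lt_min (h'.trans_le (hle _)) (h1 ▸ hmul h hh)).trans_le h3
  · rintro (rfl | h)
    · exact ⟨0, Or.inl (by simp)⟩
    have hdiv := modByMonic_add_div f φ
    set r := f %ₘ φ with hr
    set q := f /ₘ φ with hq
    have hrv := heq r (degree_modByMonic_lt f hφ)
    refine ⟨q, Or.inr ?_⟩
    have hfr : f - φ * q = r := by rw [← hdiv]; ring
    rw [hfr]
    by_contra! hcon
    have hqv : polyVal v r ≤ polyVal v (φ * q) := by
      have := polyVal_sub v f r
      rw [show f - r = φ * q by rw [← hdiv]; ring] at this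
      exact (le_min hcon le_rfl).trans this
    by_cases hq0 : q = 0
    · rw [hq0, mul_zero, add_zero] at hdiv
      rw [hdiv] at hrv
      exact h.ne hrv
    have h1 : polyVal w r < polyVal w (φ * q) := hrv ▸ hqv.trans_lt (hmul q hq0)
    have h2 : polyVal w f = polyVal w r := by
      rw [← hdiv]
      simp only [polyVal, map_add]
      exact w.map_add_eq_of_lt_left h1
    rw [h2, ← hrv] at h
    exact absurd h hcon.not_gt

/-- A monic integral polynomial `φ` is a key polynomial over `v` as soon as there is a valuation `w
≥ v` which differs from `v` at `φ` but at no polynomial of smaller degree: by `vDvd_iff_lt`, the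
failure of equivalence-divisibility by `φ` then becomes the multiplicative condition `v f = w f`. -/
lemma isKeyPolynomial_of_lt {v₀ : AddValuation F (WithTop ℚ)} (hφ : φ.Monic)
    (hdeg : 0 < φ.natDegree) (hint : ∀ i, 0 ≤ v₀ (φ.coeff i))
    (hle : ∀ f, polyVal v f ≤ polyVal w f)
    (heq : ∀ f : F[X], f.degree < φ.degree → polyVal v f = polyVal w f)
    (hlt : polyVal v φ < polyVal w φ) : IsKeyPolynomial v₀ v φ where
  monic := hφ
  degree_pos := hdeg
  integral := hint
  irreducible f g h := by
    simp only [vDvd_iff_lt hφ hle heq hlt] at h ⊢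
    by_contra! hcon
    obtain ⟨⟨hf, hf'⟩, hg, hg'⟩ := hcon
    rcases h with h | h
    · exact (mul_ne_zero hf hg) h
    · rw [polyVal_mul, polyVal_mul] at h
      exact absurd h (add_le_add hf' hg').not_gt
  minimal f hf h := by
    rcases (vDvd_iff_lt hφ hle heq hlt f).1 h with h | h
    · exact absurd h hf
    · by_contra! hcon
      exact h.ne (heq f (degree_lt_degree hcon))

/-- An expansion formula follows from the fact that adding a multiple of `φ` to a polynomial of
smaller degree does not increase its value. -/
lemma polyVal_expansion {r : ℚ} (hr : polyVal w φ = r)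
    (hdiv : ∀ a q : F[X], a.degree < φ.degree → polyVal w (a + φ * q) ≤ polyVal w a) (n : ℕ) :
    ∀ a : ℕ → F[X], (∀ i, (a i).degree < φ.degree) →
      polyVal w (∑ i ∈ Finset.range n, a i * φ ^ i) =
        (Finset.range n).inf fun i => polyVal w (a i) + (((i : ℚ) * r : ℚ) : WithTop ℚ) := by
  induction n with
  | zero => simp [polyVal_zero]
  | succ n ih =>
    intro a ha
    have hsum : ∑ i ∈ Finset.range (n + 1), a i * φ ^ i
        = a 0 + φ * ∑ i ∈ Finset.range n, a (i + 1) * φ ^ i := by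
      rw [Finset.sum_range_succ', Finset.mul_sum, add_comm]
      congr 1
      · simp
      · exact Finset.sum_congr rfl fun i _ => by ring
    have hinf : ((Finset.range (n + 1)).inf fun i =>
        polyVal w (a i) + (((i : ℚ) * r : ℚ) : WithTop ℚ)) =
        min (polyVal w (a 0)) ((r : WithTop ℚ) + (Finset.range n).inf fun i =>
          polyVal w (a (i + 1)) + (((i : ℚ) * r : ℚ) : WithTop ℚ)) := by
      have hshift : (r : WithTop ℚ) + ((Finset.range n).inf fun i =>
          polyVal w (a (i + 1)) + (((i : ℚ) * r : ℚ) : WithTop ℚ)) =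
          (Finset.range n).inf fun i =>
            polyVal w (a (i + 1)) + ((((i + 1 : ℕ) : ℚ) * r : ℚ) : WithTop ℚ) := by
        rw [Finset.apply_inf_eq_inf_comp_of_linearOrder (fun x : WithTop ℚ => (r : WithTop ℚ) + x)
          (fun x y h => add_le_add_right h _) (by simp)]
        refine Finset.inf_congr rfl fun i _ => ?_
        simp only [Function.comp]
        rw [add_left_comm, ← WithTop.coe_add]
        congr 2
        push_cast
        ring
      rw [hshift, Finset.range_add_one', Finset.inf_insert, Finset.inf_map]
      congr 1
      simp
    rw [hinf, hsum, ← ih (fun i => a (i + 1)) fun i => ha (i + 1), ← hr, ← polyVal_mul]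
    set q := φ * ∑ i ∈ Finset.range n, a (i + 1) * φ ^ i with hq
    have h1 : polyVal w (a 0 + q) ≤ polyVal w (a 0) := hdiv _ _ (ha 0)
    refine le_antisymm (le_min h1 ?_) (polyVal_add w _ _)
    have := polyVal_sub w (a 0 + q) (a 0)
    rw [add_sub_cancel_left] at this
    exact (le_min le_rfl h1).trans this

/-- A valuation `w ≥ v` as in `isKeyPolynomial_of_lt` is the augmentation of `v` by `w φ = r`,
provided that adding multiples of `φ` does not increase the value of a polynomial of smaller degree.
-/
lemma isAugmentation_of_le {v₀ : AddValuation F (WithTop ℚ)} {r : ℚ} (hφ : φ.Monic)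
    (hdeg : 0 < φ.natDegree) (hint : ∀ i, 0 ≤ v₀ (φ.coeff i))
    (hle : ∀ f, polyVal v f ≤ polyVal w f)
    (heq : ∀ f : F[X], f.degree < φ.degree → polyVal v f = polyVal w f)
    (hr : polyVal w φ = r) (hlt : polyVal v φ < r)
    (hdiv : ∀ a q : F[X], a.degree < φ.degree → polyVal w (a + φ * q) ≤ polyVal w a) :
    IsAugmentation v₀ v φ r w where
  isKey := isKeyPolynomial_of_lt hφ hdeg hint hle heq (hr ▸ hlt)
  lt := hlt
  expansion n a ha := by
    rw [polyVal_expansion hr hdiv n a ha]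
    exact Finset.inf_congr rfl fun i _ => by rw [heq _ (ha i)]

end Augmentation

/-! ### Valuations of polynomials at a uniformizer -/

section CoeffMap

variable {F E : Type u} [Field F] [Field E] (τ : F →+* E)

lemma coeffMap_algebraMap (f : F[X]) :
    coeffMap τ (algebraMap F[X] (RatFunc F) f) = algebraMap E[X] (RatFunc E) (f.map τ) := by
  have := RatFunc.map_apply_div (Polynomial.mapRingHom τ)
    (nonZeroDivisors_le_comap_nonZeroDivisors_of_injective _
      (Polynomial.map_injective τ τ.injective)) f 1
  simpa [coeffMap, RatFunc.coe_mapRingHom_eq_coe_map] using this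

lemma coeffMap_C (c : F) : coeffMap τ (RatFunc.C c) = RatFunc.C (τ c) := by
  rw [← RatFunc.algebraMap_C, coeffMap_algebraMap, Polynomial.map_C, RatFunc.algebraMap_C]

lemma coeffMap_X : coeffMap τ RatFunc.X = RatFunc.X := by
  rw [← RatFunc.algebraMap_X, coeffMap_algebraMap, Polynomial.map_X, RatFunc.algebraMap_X]

end CoeffMap

section Weighted

variable {K : Type u} [Field K]

/-- `min (v aᵢ + i / p)` for the polynomial `∑ aᵢ xⁱ`. -/
def weightedInf (vK : AddValuation K (WithTop ℚ)) (p : ℕ) (f : K[X]) : WithTop ℚ :=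
  f.support.inf fun i => vK (f.coeff i) + (((i : ℚ) / p : ℚ) : WithTop ℚ)

variable {vK : AddValuation K (WithTop ℚ)} {p : ℕ} {E : Type u} [Field E] [Algebra K E]
  {W : AddValuation E (WithTop ℚ)} {t : E}

lemma map_term (hW : ∀ c, W (algebraMap K E c) = vK c) (ht : W t = ((1 / p : ℚ) : WithTop ℚ))
    (c : K) (i : ℕ) :
    W (algebraMap K E c * t ^ i) = vK c + (((i : ℚ) / p : ℚ) : WithTop ℚ) := by
  rw [W.map_mul, hW, W.map_pow, ht, ← WithTop.coe_nsmul, nsmul_eq_mul, mul_one_div]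

lemma aeval_eq_sum_support (f : K[X]) :
    aeval t f = ∑ i ∈ f.support, algebraMap K E (f.coeff i) * t ^ i := by
  rw [aeval_def, eval₂_eq_sum, Polynomial.sum]

lemma weightedInf_le_map (hW : ∀ c, W (algebraMap K E c) = vK c)
    (ht : W t = ((1 / p : ℚ) : WithTop ℚ)) (f : K[X]) : weightedInf vK p f ≤ W (aeval t f) := by
  rw [aeval_eq_sum_support]
  refine W.map_le_sum fun i hi => ?_
  rw [map_term hW ht]
  exact Finset.inf_le (f := fun i => vK (f.coeff i) + (((i : ℚ) / p : ℚ) : WithTop ℚ)) hi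

lemma gaussInf_le_weightedInf (f : K[X]) : gaussInf vK f ≤ weightedInf vK p f := by
  refine Finset.le_inf fun i hi => (gaussInf_le vK f i).trans (le_add_of_nonneg_right ?_)
  exact WithTop.coe_nonneg.2 (by positivity)

/-- The terms of a polynomial of degree less than `p` have distinct values at an element of
value `1 / p`, since the values of the coefficients are integers. -/
lemma map_aeval_eq_weightedInf (hp : p ≠ 0)
    (hint : ∀ c : K, c ≠ 0 → ∃ n : ℤ, vK c = ((n : ℚ) : WithTop ℚ))
    (hW : ∀ c, W (algebraMap K E c) = vK c)
    (ht : W t = ((1 / p : ℚ) : WithTop ℚ)) (f : K[X]) (hf : f.degree < p) :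
    W (aeval t f) = weightedInf vK p f := by
  rw [aeval_eq_sum_support, map_sum_of_injOn]
  · exact Finset.inf_congr rfl fun i _ => map_term hW ht _ _
  · intro i hi j hj hij
    simp only [map_term hW ht] at hij
    have hi' := mem_support_iff.1 hi
    have hj' := mem_support_iff.1 hj
    obtain ⟨a, ha⟩ := hint _ hi'
    obtain ⟨b, hb⟩ := hint _ hj'
    rw [ha, hb, ← WithTop.coe_add, ← WithTop.coe_add, WithTop.coe_inj] at hij
    have hp' : (p : ℚ) ≠ 0 := by exact_mod_cast hp
    have hij' : a * p + i = b * p + (j : ℤ) := by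
      field_simp at hij
      have : (a * p + i : ℚ) = b * p + j := by linarith
      exact_mod_cast this
    have hilt : i < p := by
      by_contra! h
      exact hi' (coeff_eq_zero_of_degree_lt (hf.trans_le (by exact_mod_cast h)))
    have hjlt : j < p := by
      by_contra! h
      exact hj' (coeff_eq_zero_of_degree_lt (hf.trans_le (by exact_mod_cast h)))
    have h1 := congrArg (· % (p : ℤ)) hij'
    simp only [Int.add_comm (_ * _), Int.add_mul_emod_self_right] at h1
    rw [Int.emod_eq_of_lt (by positivity) (by exact_mod_cast hilt),
      Int.emod_eq_of_lt (by positivity) (by exact_mod_cast hjlt)] at h1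
    exact_mod_cast h1

lemma weightedInf_le_coeff_zero (f : K[X]) : weightedInf vK p f ≤ vK (f.coeff 0) := by
  by_cases h : 0 ∈ f.support
  · refine (Finset.inf_le (f := fun i =>
      vK (f.coeff i) + (((i : ℚ) / p : ℚ) : WithTop ℚ)) h).trans_eq ?_
    simp
  · simp [notMem_support_iff.1 h]

end Weighted

/-! ### The wildly ramified extension -/

section Wild

/-- The valuation-theoretic content of the hypothesis that the cyclic extension `L / K` of prime
degree `p` is totally ramified, with uniformizer `π` of `L`, generator `σ` of the Galois group,
residue characteristic `p` and `v (σ π - π) = m / p`. -/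
structure IsWildExtension {K L : Type u} [Field K] [Field L] [Algebra K L] (p m : ℕ)
    (vK : AddValuation K (WithTop ℚ)) (vL : AddValuation L (WithTop ℚ)) (σ : Gal(L/K)) (π : L) :
    Prop where
  prime : p.Prime
  finrank : Module.finrank K L = p
  map_algebraMap : ∀ c, vL (algebraMap K L c) = vK c
  map_gal : ∀ (g : Gal(L/K)) a, vL (g a) = vL a
  int : ∀ c : K, c ≠ 0 → ∃ n : ℤ, vK c = ((n : ℚ) : WithTop ℚ)
  uniformizer : vL π = ((1 / p : ℚ) : WithTop ℚ)
  exists_uniformizer : ∃ ϖ : K, vK ϖ = 1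
  generator : ∀ g : Gal(L/K), g ∈ Subgroup.zpowers σ
  shift : vL (σ π - π) = ((m / p : ℚ) : WithTop ℚ)
  residueChar : 0 < vK p

namespace IsWildExtension

variable {K L : Type u} [Field K] [Field L] [Algebra K L] {p m : ℕ}
  {vK : AddValuation K (WithTop ℚ)} {vL : AddValuation L (WithTop ℚ)} {σ : Gal(L/K)} {π : L}
  (h : IsWildExtension p m vK vL σ π)

include h

lemma p_pos : (0 : ℚ) < p := by exact_mod_cast h.prime.pos

lemma finiteDimensional : FiniteDimensional K L :=
  Module.finite_of_finrank_pos (h.finrank ▸ h.prime.pos)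

/-- The `g` with this property form a subgroup, because `vL` is Galois invariant, and `σ` generates
the group. -/
lemma shift_le (g : Gal(L/K)) : ((m / p : ℚ) : WithTop ℚ) ≤ vL (g π - π) := by
  let H : Subgroup Gal(L/K) :=
    { carrier := {g | ((m / p : ℚ) : WithTop ℚ) ≤ vL (g π - π)}
      one_mem' := by simp
      mul_mem' := by
        intro a b ha hb
        have : (a * b) π - π = a (b π - π) + (a π - π) := by
          rw [AlgEquiv.mul_apply, map_sub]
          ring
        change _ ≤ vL ((a * b) π - π)
        rw [this]
        exact vL.map_le_add (by rw [h.map_gal]; exact hb) ha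
      inv_mem' := by
        intro a ha
        change _ ≤ vL (a⁻¹ π - π)
        have : a (a⁻¹ π - π) = -(a π - π) := by
          rw [map_sub, ← AlgEquiv.mul_apply, mul_inv_cancel, AlgEquiv.one_apply]
          ring
        rw [← h.map_gal a, this, vL.map_neg]
        exact ha }
  have : Subgroup.zpowers σ ≤ H := by
    rw [Subgroup.zpowers_le]
    exact h.shift.ge
  exact this (h.generator g)

lemma uniformizer_ne_zero : π ≠ 0 := by
  rintro rfl
  simpa using h.uniformizer

/-- The value `1 / p` of the uniformizer is not an integer. -/
lemma notMem_range : π ∉ (algebraMap K L).range := by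
  rintro ⟨c, hc⟩
  have h1 := h.map_algebraMap c
  have hc0 : c ≠ 0 := by
    rintro rfl
    exact h.uniformizer_ne_zero (by simpa using hc.symm)
  obtain ⟨n, hn⟩ := h.int c hc0
  rw [hc, h.uniformizer, hn, WithTop.coe_inj] at h1
  have hp := h.p_pos
  have h2 : (1 : ℚ) = n * p := by
    field_simp at h1
    linarith
  have h3 : (1 : ℤ) = n * p := by exact_mod_cast h2
  have h4 : (p : ℤ) ∣ 1 := ⟨n, by rw [h3, mul_comm]⟩
  exact h.prime.one_lt.ne' (by exact_mod_cast Int.eq_one_of_dvd_one (by positivity) h4)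

lemma adjoin_eq_top : IntermediateField.adjoin K {π} = ⊤ := by
  have := h.finiteDimensional
  have hdvd : Module.finrank K (IntermediateField.adjoin K {π}) ∣ p := by
    rw [← h.finrank, ← Module.finrank_mul_finrank K (IntermediateField.adjoin K {π}) L]
    exact dvd_mul_right _ _
  rcases (Nat.dvd_prime h.prime).1 hdvd with h1 | h1
  · exfalso
    rw [IntermediateField.finrank_adjoin_simple_eq_one_iff, IntermediateField.mem_bot] at h1
    exact h.notMem_range h1
  · exact IntermediateField.eq_of_le_of_finrank_eq le_top
      (by rw [h1, ← h.finrank, IntermediateField.finrank_top'])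

lemma isIntegral : IsIntegral K π := by
  have := h.finiteDimensional
  exact Algebra.IsIntegral.isIntegral π

lemma natDegree_minpoly : (minpoly K π).natDegree = p := by
  rw [← IntermediateField.adjoin.finrank h.isIntegral, h.adjoin_eq_top,
    IntermediateField.finrank_top', h.finrank]

lemma degree_minpoly : (minpoly K π).degree = p := by
  rw [degree_eq_natDegree (minpoly.ne_zero h.isIntegral), h.natDegree_minpoly]

lemma exists_aeval_eq (a : L) : ∃ f : K[X], f.degree < p ∧ aeval π f = a := by
  have ha : a ∈ Algebra.adjoin K {π} := by
    rw [← IntermediateField.adjoin_simple_toSubalgebra_of_isAlgebraic h.isIntegral.isAlgebraic,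
      h.adjoin_eq_top]
    trivial
  rw [Algebra.adjoin_singleton_eq_range_aeval] at ha
  obtain ⟨f, rfl⟩ := ha
  have hm := minpoly.monic h.isIntegral
  refine ⟨f %ₘ minpoly K π, h.degree_minpoly ▸ degree_modByMonic_lt f hm, ?_⟩
  conv_rhs => rw [← modByMonic_add_div f (minpoly K π)]
  simp

variable [IsGalois K L]

lemma minpoly_map [Fintype Gal(L/K)] :
    (minpoly K π).map (algebraMap K L) = ∏ g : Gal(L/K), (X - C (g π)) := by
  have := h.finiteDimensional
  have hcp : MulSemiringAction.charpoly Gal(L/K) π = ∏ g : Gal(L/K), (X - C (g π)) := rfl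
  rw [← hcp]
  symm
  refine eq_of_monic_of_dvd_of_natDegree_le ((minpoly.monic h.isIntegral).map _)
    (MulSemiringAction.monic_charpoly Gal(L/K) π) ?_ ?_
  · obtain ⟨f, hf⟩ : MulSemiringAction.charpoly Gal(L/K) π ∈ Polynomial.lifts (algebraMap K L) := by
      rw [lifts_iff_coeff_lifts]
      intro n
      have := (IsGalois.mem_bot_iff_fixed (F := K) (E := L)
        ((MulSemiringAction.charpoly Gal(L/K) π).coeff n)).2
          fun g => MulSemiringAction.smul_coeff_charpoly π n g
      exact IntermediateField.mem_bot.1 this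
    rw [← hf]
    refine Polynomial.map_dvd _ (minpoly.dvd K π ?_)
    rw [← eval_map_algebraMap]
    have := MulSemiringAction.eval_charpoly Gal(L/K) π
    rw [← hf] at this
    exact this
  · rw [hcp, natDegree_prod_of_monic _ _ fun g _ => monic_X_sub_C _]
    simp only [natDegree_X_sub_C, Finset.sum_const, Finset.card_univ, smul_eq_mul, mul_one,
      natDegree_map]
    rw [h.natDegree_minpoly, ← Nat.card_eq_fintype_card, IsGalois.card_aut_eq_finrank, h.finrank]

end IsWildExtension

end Wild

section Wild

namespace IsWildExtension

variable {K L : Type u} [Field K] [Field L] [Algebra K L] {p m : ℕ}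
  {vK : AddValuation K (WithTop ℚ)} {vL : AddValuation L (WithTop ℚ)} {σ : Gal(L/K)} {π : L}
  (h : IsWildExtension p m vK vL σ π)

include h

lemma map_aeval_uniformizer (f : K[X]) (hf : f.degree < p) :
    vL (aeval π f) = weightedInf vK p f :=
  map_aeval_eq_weightedInf h.prime.ne_zero h.int h.map_algebraMap h.uniformizer f hf

/-- The residue field of `L` equals that of `K`. -/
lemma exists_residue (a : L) (ha : 0 ≤ vL a) :
    ∃ c : K, 0 ≤ vK c ∧ 0 < vL (a - algebraMap K L c) := by
  obtain ⟨f, hf, rfl⟩ := h.exists_aeval_eq a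
  have hp := h.p_pos
  rw [h.map_aeval_uniformizer f hf] at ha
  refine ⟨f.coeff 0, ha.trans (weightedInf_le_coeff_zero f), ?_⟩
  have hsub : aeval π f - algebraMap K L (f.coeff 0) = aeval π (f - C (f.coeff 0)) := by simp
  have hdeg : (f - C (f.coeff 0)).degree < p :=
    (degree_sub_le _ _).trans_lt (max_lt hf (degree_C_le.trans_lt (by
      exact_mod_cast h.prime.pos)))
  rw [hsub, h.map_aeval_uniformizer _ hdeg, weightedInf, Finset.lt_inf_iff (by simp)]
  intro i hi
  have hi0 : i ≠ 0 := by
    rintro rfl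
    simp at hi
  have hcoeff : (f - C (f.coeff 0)).coeff i = f.coeff i := by simp [coeff_C, hi0]
  have hci : f.coeff i ≠ 0 := by rwa [mem_support_iff, hcoeff] at hi
  have hip : i < p := by
    by_contra! hcon
    exact hci (coeff_eq_zero_of_degree_lt (hf.trans_le (by exact_mod_cast hcon)))
  have h0 : 0 ≤ vK (f.coeff i) + (((i : ℚ) / p : ℚ) : WithTop ℚ) :=
    ha.trans (Finset.inf_le (f := fun i => vK (f.coeff i) + (((i : ℚ) / p : ℚ) : WithTop ℚ))
      (mem_support_iff.2 hci))
  rw [hcoeff]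
  obtain ⟨n, hn⟩ := h.int _ hci
  rw [hn, ← WithTop.coe_add, ← WithTop.coe_zero] at h0 ⊢
  rw [WithTop.coe_le_coe] at h0
  rw [WithTop.coe_lt_coe]
  refine lt_of_le_of_ne h0 fun heq => ?_
  have h1 : (n : ℚ) * p + i = 0 := by
    field_simp at heq
    linarith
  have h2 : n * p + (i : ℤ) = 0 := by exact_mod_cast h1
  have h3 : (p : ℤ) ∣ i := ⟨-n, by linarith⟩
  have h4 : p ∣ i := by exact_mod_cast h3
  exact absurd (Nat.le_of_dvd (Nat.pos_of_ne_zero hi0) h4) hip.not_ge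

/-- If `c ^ p` is congruent to `1`, then so is `c`, since the residue characteristic is `p`. -/
lemma pos_sub_one_of_pow {c : K} (hc : 0 ≤ vK c) (hcp : 0 < vK (c ^ p - 1)) : 0 < vK (c - 1) := by
  let O : Subring K := (AddValuation.toValuation vK).integer
  have hO : ∀ x : K, x ∈ O ↔ 0 ≤ vK x := fun x => Iff.rfl
  let c' : O := ⟨c - 1, (hO _).2 (vK.map_le_sub hc (by simp))⟩
  obtain ⟨r, hr⟩ := exists_add_pow_prime_eq h.prime (1 : O) c'
  have hr' := congrArg (Subtype.val : O → K) hr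
  simp only [c', Subring.coe_add, Subring.coe_mul, Subring.coe_pow, Subring.coe_one, one_pow,
    add_sub_cancel, Subring.coe_natCast] at hr'
  have hpr : 0 < vK (p * ((c - 1) * (r : K))) := by
    rw [vK.map_mul, vK.map_mul]
    exact h.residueChar.trans_le
      (le_add_of_nonneg_right (add_nonneg ((hO _).1 c'.2) ((hO _).1 r.2)))
  have hpow : (c - 1) ^ p = (c ^ p - 1) - p * ((c - 1) * (r : K)) := by
    rw [hr']
    ring
  have hpos : 0 < vK ((c - 1) ^ p) := by
    rw [hpow, sub_eq_add_neg]
    exact vK.map_lt_add hcp (by rwa [vK.map_neg])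
  rw [vK.map_pow] at hpos
  by_contra! hcon
  exact absurd (nsmul_nonpos hcon p) hpos.not_ge

/-- The extension is wildly ramified, so that the ramification jump is positive: the residue class
of `σ π / π` is a `p`-th root of unity in a field of characteristic `p`. -/
lemma one_lt_m [IsGalois K L] : 1 < m := by
  have hp := h.p_pos
  have hπ0 := h.uniformizer_ne_zero
  have hπt : vL π ≠ ⊤ := vL.ne_top_iff.2 hπ0
  have hpos : ∀ x : L, vL π < vL (π * x) ↔ 0 < vL x := by
    intro x
    rw [vL.map_mul]
    have := WithTop.add_lt_add_iff_left (y := 0) (z := vL x) hπt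
    rwa [add_zero] at this
  have hu : vL (σ π / π) = 0 := by
    have h1 := vL.map_mul (σ π / π) π
    rw [div_mul_cancel₀ _ hπ0, h.map_gal] at h1
    have h2 : (0 : WithTop ℚ) + vL π = vL (σ π / π) + vL π := by rw [zero_add, ← h1]
    exact ((WithTop.add_right_inj hπt).1 h2).symm
  obtain ⟨c, hc, hc'⟩ := h.exists_residue _ hu.ge
  have hσ : vL π < vL (σ π - algebraMap K L c * π) := by
    have : σ π - algebraMap K L c * π = π * (σ π / π - algebraMap K L c) := by
      field_simp
    rwa [this, hpos]
  have hiter : ∀ n : ℕ, vL π < vL ((σ ^ n) π - algebraMap K L c ^ n * π) := by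
    intro n
    induction n with
    | zero =>
      rw [pow_zero, pow_zero, one_mul, AlgEquiv.one_apply, sub_self, vL.map_zero]
      exact lt_top_iff_ne_top.2 hπt
    | succ n ih =>
      have : (σ ^ (n + 1)) π - algebraMap K L c ^ (n + 1) * π =
          σ ((σ ^ n) π - algebraMap K L c ^ n * π)
            + algebraMap K L c ^ n * (σ π - algebraMap K L c * π) := by
        rw [map_sub, map_mul, map_pow, σ.commutes, pow_succ', AlgEquiv.mul_apply]
        ring
      rw [this]
      refine vL.map_lt_add (by rwa [h.map_gal]) ?_
      rw [vL.map_mul, vL.map_pow, h.map_algebraMap]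
      exact hσ.trans_le (le_add_of_nonneg_left (nsmul_nonneg hc n))
  have := h.finiteDimensional
  have hσp : σ ^ p = 1 := by
    rw [← h.finrank, ← IsGalois.card_aut_eq_finrank]
    exact pow_card_eq_one'
  have h1 := hiter p
  have h2 : (1 : Gal(L/K)) π - algebraMap K L c ^ p * π =
      π * algebraMap K L (-(c ^ p - 1)) := by
    rw [AlgEquiv.one_apply]
    push_cast
    ring
  rw [hσp, h2, hpos, h.map_algebraMap, vK.map_neg] at h1
  have h3 := h.pos_sub_one_of_pow hc h1
  have h4 : vL π < vL (σ π - π) := by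
    have : σ π - π = (σ π - algebraMap K L c * π) + π * algebraMap K L (c - 1) := by
      rw [map_sub, map_one]
      ring
    rw [this]
    exact vL.map_lt_add hσ ((hpos _).2 (by rwa [h.map_algebraMap]))
  rw [h.shift, h.uniformizer, WithTop.coe_lt_coe, div_lt_div_iff_of_pos_right hp] at h4
  exact_mod_cast h4

/-! ### The inductive valuation -/

omit h in
lemma yCoord_eq (π : L) (m : ℕ) :
    yCoord π m = (RatFunc.X - RatFunc.C π) / RatFunc.C (π ^ m) := by
  rw [yCoord, map_pow]

omit h in
/-- The affine substitution expresses a polynomial in terms of the parameter of a disc. -/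
lemma algebraMap_eq_aeval_param (a b : L) (hb : b ≠ 0) (f : L[X]) :
    algebraMap L[X] (RatFunc L) f =
      aeval ((RatFunc.X - RatFunc.C a) / RatFunc.C b) (f.comp (C b * X + C a)) := by
  have hb' : (RatFunc.C b : RatFunc L) ≠ 0 := by simpa using hb
  rw [aeval_comp, ← RatFunc.aeval_X_left_eq_algebraMap]
  congr 2
  simp only [map_add, map_mul, aeval_C, aeval_X, RatFunc.algebraMap_eq_C]
  field_simp
  ring

/-- The Gauss valuation on `L(x)` with respect to the parameter `(x - a) / b`, restricted
to `K(x)`. -/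
def discRestrict (_ : IsWildExtension p m vK vL σ π) (a b : L) (hb : b ≠ 0) :
    AddValuation (RatFunc K) (WithTop ℚ) :=
  (discVal vL a b hb).comap (coeffMap (algebraMap K L))

lemma discRestrict_algebraMap (a b : L) (hb : b ≠ 0) (c : K) :
    h.discRestrict a b hb (algebraMap K (RatFunc K) c) = vK c := by
  change discVal vL a b hb (coeffMap (algebraMap K L) _) = _
  rw [RatFunc.algebraMap_eq_C, coeffMap_C, ← RatFunc.algebraMap_eq_C,
    (isGaussValuation_discVal vL a b hb).map_algebraMap, h.map_algebraMap]

omit h in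
lemma discVal_X_sub_C (a b : L) (hb : b ≠ 0) (d : L) :
    discVal vL a b hb (RatFunc.X - RatFunc.C d) = min (vL b) (vL (a - d)) := by
  have hb' : (RatFunc.C b : RatFunc L) ≠ 0 := by simpa using hb
  rw [← (isGaussValuation_discVal vL a b hb).linear (a - d) b]
  refine congrArg _ ?_
  rw [RatFunc.algebraMap_eq_C, map_sub]
  field_simp
  ring

omit h in
lemma discVal_le_eval (a b : L) (hb : b ≠ 0) (f : L[X]) :
    discVal vL a b hb (algebraMap L[X] (RatFunc L) f) ≤ vL (f.eval a) := by
  rw [algebraMap_eq_aeval_param a b hb]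
  refine ((isGaussValuation_discVal vL a b hb).le_eval_zero _).trans_eq ?_
  simp

lemma polyVal_discRestrict_eq (a b : L) (hb : b ≠ 0) (f : K[X]) :
    polyVal (h.discRestrict a b hb) f =
      discVal vL a b hb (algebraMap L[X] (RatFunc L) (f.map (algebraMap K L))) :=
  congrArg (discVal vL a b hb) (coeffMap_algebraMap _ f)

lemma pow_ne_zero_of_uniformizer : π ^ m ≠ 0 := pow_ne_zero _ h.uniformizer_ne_zero

lemma map_uniformizer_pow : vL (π ^ m) = ((m / p : ℚ) : WithTop ℚ) := by
  rw [vL.map_pow, h.uniformizer, ← WithTop.coe_nsmul, nsmul_eq_mul, mul_one_div]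

/-- The valuation `[v₀, v₁ x = 1 / p]`, as a restriction from `L(x)`. -/
def stageOne : AddValuation (RatFunc K) (WithTop ℚ) := h.discRestrict 0 π h.uniformizer_ne_zero

/-- The valuation `[v₀, v₁ x = 1 / p, v φ = m]`, as a restriction from `L(x)`. -/
def stageTwo : AddValuation (RatFunc K) (WithTop ℚ) :=
  h.discRestrict π (π ^ m) h.pow_ne_zero_of_uniformizer

lemma stageOne_X : h.stageOne RatFunc.X = ((1 / p : ℚ) : WithTop ℚ) := by
  change discVal vL 0 π _ (coeffMap (algebraMap K L) _) = _
  have := discVal_X_sub_C (vL := vL) 0 π h.uniformizer_ne_zero 0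
  rwa [map_zero, sub_zero, sub_zero, vL.map_zero, min_eq_left le_top, h.uniformizer,
    ← coeffMap_X (algebraMap K L)] at this

lemma stageTwo_X [IsGalois K L] : h.stageTwo RatFunc.X = ((1 / p : ℚ) : WithTop ℚ) := by
  change discVal vL π (π ^ m) _ (coeffMap (algebraMap K L) _) = _
  have := discVal_X_sub_C (vL := vL) π (π ^ m) h.pow_ne_zero_of_uniformizer 0
  rw [map_zero, sub_zero, sub_zero, h.map_uniformizer_pow, h.uniformizer, min_eq_right] at this
  · rwa [coeffMap_X]
  · rw [WithTop.coe_le_coe]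
    have := h.p_pos
    have : (1 : ℚ) ≤ m := by exact_mod_cast h.one_lt_m.le
    gcongr

/-- The value of `f` at `x = π t` is the minimum over the terms, since substituting `π t` scales the
`i`-th coefficient by `π ^ i`. -/
lemma polyVal_stageOne (f : K[X]) : polyVal h.stageOne f = weightedInf vK p f := by
  refine le_antisymm (Finset.le_inf fun i _ => ?_) ?_
  · have : ((f.map (algebraMap K L)).comp (C π * X + C 0)).coeff i =
        algebraMap K L (f.coeff i) * π ^ i := by
      rw [map_zero, add_zero, comp_C_mul_X_coeff, coeff_map]
    rw [stageOne, h.polyVal_discRestrict_eq, algebraMap_eq_aeval_param 0 π h.uniformizer_ne_zero,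
      (isGaussValuation_discVal vL 0 π h.uniformizer_ne_zero).apply,
      ← map_term h.map_algebraMap h.uniformizer, ← this]
    exact gaussInf_le vL _ i
  · rw [polyVal, ← RatFunc.aeval_X_left_eq_algebraMap]
    exact weightedInf_le_map (h.discRestrict_algebraMap _ _ _) h.stageOne_X f

variable [IsGalois K L]

lemma weightedInf_le_stageTwo (f : K[X]) : weightedInf vK p f ≤ polyVal h.stageTwo f := by
  rw [polyVal, ← RatFunc.aeval_X_left_eq_algebraMap]
  exact weightedInf_le_map (h.discRestrict_algebraMap _ _ _) h.stageTwo_X f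

lemma polyVal_stageTwo_of_degree_lt (f : K[X]) (hf : f.degree < p) :
    polyVal h.stageTwo f = weightedInf vK p f := by
  rw [polyVal, ← RatFunc.aeval_X_left_eq_algebraMap]
  exact map_aeval_eq_weightedInf h.prime.ne_zero h.int (h.discRestrict_algebraMap _ _ _)
    h.stageTwo_X f hf

lemma card_gal [Fintype Gal(L/K)] : Fintype.card Gal(L/K) = p := by
  have := h.finiteDimensional
  rw [← Nat.card_eq_fintype_card, IsGalois.card_aut_eq_finrank, h.finrank]

/-- If the `p` linear factors of the minimal polynomial of `π` over `L` have the same value `c / p`,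
then the minimal polynomial has value `c`. -/
lemma polyVal_minpoly (a b : L) (hb : b ≠ 0) {c : ℚ}
    (hc : ∀ g : Gal(L/K), min (vL b) (vL (a - g π)) = ((c / p : ℚ) : WithTop ℚ)) :
    polyVal (h.discRestrict a b hb) (minpoly K π) = c := by
  classical
  have := h.finiteDimensional
  have hp := h.p_pos
  rw [h.polyVal_discRestrict_eq, h.minpoly_map, map_prod, map_prod_addValuation]
  have : ∀ g : Gal(L/K), discVal vL a b hb (algebraMap L[X] (RatFunc L) (X - C (g π))) =
      ((c / p : ℚ) : WithTop ℚ) := by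
    intro g
    rw [map_sub, RatFunc.algebraMap_X, RatFunc.algebraMap_C, discVal_X_sub_C, hc]
  rw [Finset.sum_congr rfl fun g _ => this g, Finset.sum_const, Finset.card_univ, h.card_gal,
    ← WithTop.coe_nsmul, nsmul_eq_mul, mul_div_cancel₀ _ hp.ne']

lemma polyVal_stageOne_minpoly : polyVal h.stageOne (minpoly K π) = ((1 : ℚ) : WithTop ℚ) := by
  refine h.polyVal_minpoly _ _ _ fun g => ?_
  rw [zero_sub, vL.map_neg, h.map_gal, min_self, h.uniformizer]

lemma polyVal_stageTwo_minpoly : polyVal h.stageTwo (minpoly K π) = ((m : ℚ) : WithTop ℚ) := by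
  refine h.polyVal_minpoly _ _ _ fun g => ?_
  rw [h.map_uniformizer_pow, vL.map_sub_swap]
  exact min_eq_left (h.shift_le g)

lemma coeff_minpoly_nonneg (i : ℕ) : 0 ≤ vK ((minpoly K π).coeff i) := by
  classical
  have := h.finiteDimensional
  rw [← h.map_algebraMap, ← coeff_map, h.minpoly_map]
  refine le_trans ?_ (gaussInf_le vL _ i)
  rw [← gaussPoly_apply, map_prod_addValuation]
  refine Finset.sum_nonneg fun g _ => le_gaussInf fun j => ?_
  rw [coeff_sub]
  have hπ : 0 ≤ vL (g π) := by
    rw [h.map_gal, h.uniformizer]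
    exact WithTop.coe_nonneg.2 (by positivity)
  refine vL.map_le_sub ?_ ?_
  · rw [coeff_X]
    split_ifs <;> simp
  · rw [coeff_C]
    split_ifs
    · exact hπ
    · simp

omit [IsGalois K L] in
/-- `[v₀, v₁ x = 1 / p]` is an augmentation of the Gauss valuation. -/
lemma isAugmentation_stageOne :
    IsAugmentation vK (gaussRat vK) X (1 / p : ℚ) h.stageOne := by
  have hp := h.p_pos
  have hg : ∀ f : K[X], polyVal (gaussRat vK) f = gaussInf vK f := gaussRat_algebraMap vK
  have hC : ∀ f : K[X], f.degree < (X : K[X]).degree → f = C (f.coeff 0) := fun f hf =>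
    eq_C_of_degree_le_zero (by
      rw [degree_X] at hf
      exact Order.le_of_lt_succ hf)
  have hw : ∀ c : K, polyVal h.stageOne (C c) = vK c := fun c => by
    rw [polyVal, RatFunc.algebraMap_C, ← RatFunc.algebraMap_eq_C]
    exact h.discRestrict_algebraMap _ _ _ c
  have hX : gaussInf vK X = 0 := by
    rw [gaussInf, support_X]
    simp
  refine isAugmentation_of_le monic_X (by simp) (fun i => ?_) (fun f => ?_) (fun f hf => ?_) ?_ ?_
    fun a q ha => ?_
  · rw [coeff_X]
    split_ifs <;> simp
  · rw [hg, h.polyVal_stageOne]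
    exact gaussInf_le_weightedInf f
  · rw [hC f hf, hw, hg, gaussInf_C]
  · rw [polyVal, RatFunc.algebraMap_X, h.stageOne_X]
  · rw [hg, hX, ← WithTop.coe_zero, WithTop.coe_lt_coe]
    positivity
  · rw [hC a ha, hw, h.polyVal_stageOne]
    refine (weightedInf_le_coeff_zero _).trans_eq ?_
    simp

/-- The value of `a + φ q` is at most its value at the centre `π` of the disc defining `stageTwo`;
there `φ` vanishes, and `a`, being of degree less than `p`, takes its own value. This is the
expansion formula for `[v₀, v₁ x = 1 / p, v φ = m]`, and `1 < m` makes it an augmentation. -/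
lemma isAugmentation_stageTwo :
    IsAugmentation vK h.stageOne (minpoly K π) m h.stageTwo := by
  refine isAugmentation_of_le (minpoly.monic h.isIntegral) ?_ h.coeff_minpoly_nonneg
    (fun f => ?_) (fun f hf => ?_) h.polyVal_stageTwo_minpoly ?_ fun a q ha => ?_
  · rw [h.natDegree_minpoly]
    exact h.prime.pos
  · rw [h.polyVal_stageOne]
    exact h.weightedInf_le_stageTwo f
  · rw [h.polyVal_stageOne, h.polyVal_stageTwo_of_degree_lt f (h.degree_minpoly ▸ hf)]
  · rw [h.polyVal_stageOne_minpoly, WithTop.coe_lt_coe]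
    exact_mod_cast h.one_lt_m
  · -- Both values are compared with the value at the centre `π`, where `φ` vanishes.
    rw [h.degree_minpoly] at ha
    rw [h.polyVal_stageTwo_of_degree_lt a ha, ← h.map_aeval_uniformizer a ha, stageTwo,
      h.polyVal_discRestrict_eq]
    refine (discVal_le_eval _ _ _ _).trans_eq ?_
    rw [eval_map_algebraMap]
    simp

lemma isInductiveValuation_stageTwo : IsInductiveValuation vK
    [(Polynomial.X, 1 / (p : ℚ)), (minpoly K π, (m : ℚ))] h.stageTwo := by
  have h0 : IsInductiveValuation vK [] (gaussRat vK) := by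
    refine .gauss _ fun g => ?_
    rw [RatFunc.aeval_X_left_eq_algebraMap]
    exact gaussRat_algebraMap vK g
  exact .augment [(Polynomial.X, 1 / (p : ℚ))] h.stageOne _ _ _
    (.augment [] _ _ _ _ h0 h.isAugmentation_stageOne) h.isAugmentation_stageTwo

end IsWildExtension

end Wild

/-! ### Sections at points with values in a ring -/

section Eval

variable {X Y : Scheme.{u}} {B C : CommRingCat.{u}}

/-- The value in `B` of a section of `Y` at a `B`-valued point. -/
def evalSection (P : Spec B ⟶ Y) (V : Y.Opens) (hV : ⊤ ≤ P ⁻¹ᵁ V) : Γ(Y, V) ⟶ B :=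
  P.appLE V ⊤ hV ≫ (Scheme.ΓSpecIso B).hom

lemma evalSection_congr {P P' : Spec B ⟶ Y} (h : P = P') (V : Y.Opens) (hV : ⊤ ≤ P ⁻¹ᵁ V) :
    evalSection P V hV = evalSection P' V (h ▸ hV) := by
  subst h
  rfl

lemma evalSection_specMap (φ : B ⟶ C) (P : Spec B ⟶ Y) (V : Y.Opens) (hV : ⊤ ≤ P ⁻¹ᵁ V)
    (hV' : ⊤ ≤ (Spec.map φ ≫ P) ⁻¹ᵁ V) :
    evalSection (Spec.map φ ≫ P) V hV' = evalSection P V hV ≫ φ := by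
  have h0 : (⊤ : (Spec C).Opens) ≤ Spec.map φ ⁻¹ᵁ ⊤ := fun _ _ => trivial
  have h : (Spec.map φ).appLE ⊤ ⊤ h0 ≫ (Scheme.ΓSpecIso C).hom = (Scheme.ΓSpecIso B).hom ≫ φ := by
    rw [← Scheme.ΓSpecIso_naturality, Scheme.Hom.appTop, Scheme.Hom.app_eq_appLE]
    rfl
  rw [evalSection, evalSection, Category.assoc, ← h, ← Category.assoc,
    Scheme.Hom.appLE_comp_appLE]

lemma evalSection_appLE (P : Spec B ⟶ Y) (q : Y ⟶ X) (U : X.Opens) (V : Y.Opens)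
    (hUV : V ≤ q ⁻¹ᵁ U) (hV : ⊤ ≤ P ⁻¹ᵁ V) (hU : ⊤ ≤ (P ≫ q) ⁻¹ᵁ U) :
    q.appLE U V hUV ≫ evalSection P V hV = evalSection (P ≫ q) U hU := by
  rw [evalSection, evalSection, ← Category.assoc, Scheme.Hom.appLE_comp_appLE]

lemma evalSection_app (P : Spec B ⟶ Y) (q : Y ⟶ X) (U : X.Opens)
    (hV : ⊤ ≤ P ⁻¹ᵁ (q ⁻¹ᵁ U)) (hU : ⊤ ≤ (P ≫ q) ⁻¹ᵁ U) :
    q.app U ≫ evalSection P (q ⁻¹ᵁ U) hV = evalSection (P ≫ q) U hU := by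
  rw [Scheme.Hom.app_eq_appLE, evalSection_appLE _ _ _ _ _ _ hU]

lemma evalSection_map (P : Spec B ⟶ Y) (V V' : Y.Opens) (h : V' ≤ V) (hV' : ⊤ ≤ P ⁻¹ᵁ V')
    (hV : ⊤ ≤ P ⁻¹ᵁ V) :
    Y.presheaf.map (homOfLE h).op ≫ evalSection P V' hV' = evalSection P V hV := by
  rw [evalSection, evalSection, ← Category.assoc, Scheme.Hom.map_appLE]

/-- Sections on the range of an affine chart are the elements of the coordinate ring. -/
lemma isIso_evalSection_of_isOpenImmersion (j : Spec B ⟶ Y) [IsOpenImmersion j] (V : Y.Opens)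
    (hV : V = j.opensRange) (hV' : ⊤ ≤ j ⁻¹ᵁ V) : IsIso (evalSection j V hV') := by
  have h1 : IsIso (j.app V) := Scheme.Hom.isIso_app j V hV.le
  have h2 : IsIso (j.appLE V ⊤ hV') := by
    have : j ⁻¹ᵁ V = ⊤ := top_le_iff.1 hV'
    rw [Scheme.Hom.appLE, show (homOfLE hV') = eqToHom this.symm from rfl]
    infer_instance
  rw [evalSection]
  infer_instance

lemma top_le_preimage_opensRange (j : Spec B ⟶ Y) [IsOpenImmersion j] :
    ⊤ ≤ j ⁻¹ᵁ j.opensRange := fun x _ => ⟨x, rfl⟩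

end Eval

/-! ### A local criterion for quotients -/

section Charts

variable {X Y : Scheme.{u}} {G : Type*} [Group G]

/-- The condition on sections in the definition of a quotient may be checked on a basis of the
target. -/
lemma isQuotient_of_basis (ρ : G →* Aut Y) (q : Y ⟶ X) (hinv : ∀ g, (ρ g).hom ≫ q = q)
    (hq : Topology.IsQuotientMap q) (horb : ∀ y y' : Y, q y = q y' → ∃ g, (ρ g).hom y = y')
    {I : Type*} (W : I → X.Opens) (hW : TopologicalSpace.Opens.IsBasis (Set.range W))
    (hinj : ∀ i, Function.Injective (q.app (W i)))
    (hsec : ∀ i (s : Γ(Y, q ⁻¹ᵁ W i)), (∀ g, (ρ g).hom.appLE (q ⁻¹ᵁ W i) (q ⁻¹ᵁ W i)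
      (preimage_le_of_comp_eq _ q (hinv g) (W i)) s = s) → ∃ r, q.app (W i) r = s) :
    IsQuotient ρ q := by
  have hcov : ∀ U : X.Opens, U ≤ ⨆ i : {i // W i ≤ U}, W i.1 := by
    intro U x hx
    obtain ⟨_, ⟨i, rfl⟩, hxi, hi⟩ := TopologicalSpace.Opens.isBasis_iff_nbhd.1 hW hx
    exact TopologicalSpace.Opens.mem_iSup.2 ⟨⟨i, hi⟩, hxi⟩
  have hnat : ∀ (U U' : X.Opens) (h : U' ≤ U) (r : Γ(X, U)),
      Y.presheaf.map (homOfLE (q.preimage_mono h)).op (q.app U r)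
        = q.app U' (X.presheaf.map (homOfLE h).op r) := by
    intro U U' h r
    have := q.naturality (homOfLE h).op
    exact (ConcreteCategory.congr_hom this r).symm
  have hinj' : ∀ U : X.Opens, Function.Injective (q.app U) := by
    intro U r r' hr
    refine X.sheaf.eq_of_locally_eq' (fun i : {i // W i ≤ U} => W i.1) U (fun i => homOfLE i.2)
      (hcov U) r r' fun i => hinj i.1 ?_
    have h1 := hnat U (W i.1) i.2 r
    have h2 := hnat U (W i.1) i.2 r'
    rw [hr] at h1
    exact h1.symm.trans h2
  refine ⟨hinv, hq, horb, hinj', fun U s => ⟨?_, fun hs => ?_⟩⟩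
  · rintro ⟨r, rfl⟩ g
    have h1 : q.app U ≫ (ρ g).hom.appLE (q ⁻¹ᵁ U) (q ⁻¹ᵁ U)
        (preimage_le_of_comp_eq _ q (hinv g) U) = q.app U := by
      rw [Scheme.Hom.app_eq_appLE, Scheme.Hom.appLE_comp_appLE]
      simp only [hinv g]
    exact ConcreteCategory.congr_hom h1 r
  · have hloc : ∀ i : {i // W i ≤ U}, ∃ r : Γ(X, W i.1), q.app (W i.1) r =
        Y.presheaf.map (homOfLE (q.preimage_mono i.2)).op s := by
      intro i
      refine hsec i.1 _ fun g => ?_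
      conv_rhs => rw [← hs g]
      have h1 : Y.presheaf.map (homOfLE (q.preimage_mono i.2)).op ≫
          (ρ g).hom.appLE (q ⁻¹ᵁ W i.1) (q ⁻¹ᵁ W i.1)
            (preimage_le_of_comp_eq _ q (hinv g) (W i.1)) =
          (ρ g).hom.appLE (q ⁻¹ᵁ U) (q ⁻¹ᵁ U) (preimage_le_of_comp_eq _ q (hinv g) U) ≫
            Y.presheaf.map (homOfLE (q.preimage_mono i.2)).op := by
        rw [Scheme.Hom.map_appLE, Scheme.Hom.appLE_map]
      exact ConcreteCategory.congr_hom h1 s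
    choose r hr using hloc
    obtain ⟨t, ht, -⟩ := X.sheaf.existsUnique_gluing' (fun i : {i // W i ≤ U} => W i.1) U
      (fun i => homOfLE i.2) (hcov U) r (by
        intro i j
        apply hinj'
        have h1 := hnat (W i.1) (W i.1 ⊓ W j.1) inf_le_left (r i)
        have h2 := hnat (W j.1) (W i.1 ⊓ W j.1) inf_le_right (r j)
        rw [hr, ← ConcreteCategory.comp_apply, ← Functor.map_comp] at h1 h2
        exact h1.symm.trans h2)
    refine ⟨t, ?_⟩
    refine Y.sheaf.eq_of_locally_eq' (fun i : {i // W i ≤ U} => q ⁻¹ᵁ W i.1) (q ⁻¹ᵁ U)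
      (fun i => homOfLE (q.preimage_mono i.2)) ?_ _ _ fun i => ?_
    · intro y hy
      obtain ⟨i, hi⟩ := TopologicalSpace.Opens.mem_iSup.1 (hcov U hy)
      exact TopologicalSpace.Opens.mem_iSup.2 ⟨i, hi⟩
    · exact (hnat U (W i.1) i.2 t).trans ((congrArg (q.app (W i.1)) (ht i)).trans (hr i))

variable [Finite G]

/-- A morphism is a quotient by a finite group if it is so on affine charts whose ranges form a
basis of the target: there the coordinate ring downstairs is the ring of invariants. -/
theorem isQuotient_of_charts (ρ : G →* Aut Y) (q : Y ⟶ X) (hinv : ∀ g, (ρ g).hom ≫ q = q)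
    {I : Type*} (B C : I → CommRingCat.{u}) (j : ∀ i, Spec (B i) ⟶ Y) (k : ∀ i, Spec (C i) ⟶ X)
    [∀ i, IsOpenImmersion (j i)] [∀ i, IsOpenImmersion (k i)] (φ : ∀ i, C i ⟶ B i)
    (hcomm : ∀ i, j i ≫ q = Spec.map (φ i) ≫ k i)
    (hrange : ∀ i, q ⁻¹ᵁ (k i).opensRange = (j i).opensRange)
    [∀ i, MulSemiringAction G (B i)]
    (hact : ∀ i (g : G), j i ≫ (ρ g).hom =
      Spec.map (CommRingCat.ofHom (MulSemiringAction.toRingHom G (B i) g⁻¹)) ≫ j i)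
    (hbasis : TopologicalSpace.Opens.IsBasis (Set.range fun i => (k i).opensRange))
    (hφ : ∀ i, Function.Injective (φ i)) (hfix : ∀ i (g : G) c, g • (φ i c) = φ i c)
    (hfix' : ∀ i (b : B i), (∀ g : G, g • b = b) → ∃ c, φ i c = b) :
    IsQuotient ρ q := by
  have hex : ∀ x : X, ∃ i, x ∈ (k i).opensRange := by
    intro x
    obtain ⟨_, ⟨i, rfl⟩, hi, -⟩ := TopologicalSpace.Opens.isBasis_iff_nbhd.1 hbasis
      (TopologicalSpace.Opens.mem_top x)
    exact ⟨i, hi⟩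
  have hinvt : ∀ i, letI := (φ i).hom.toAlgebra; Algebra.IsInvariant (C i) (B i) G := fun i => by
    let := (φ i).hom.toAlgebra
    exact ⟨fun b hb => hfix' i b hb⟩
  have hintegral : ∀ i, (φ i).hom.IsIntegral := by
    intro i
    let := (φ i).hom.toAlgebra
    have := hinvt i
    exact (Algebra.IsInvariant.isIntegral (C i) (B i) G).isIntegral
  have hsurj : ∀ i, Function.Surjective (Spec.map (φ i)) := fun i =>
    (hintegral i).comap_surjective (hφ i)
  have hcl : ∀ i, IsClosedMap (Spec.map (φ i)) := fun i =>
    PrimeSpectrum.isClosedMap_comap_of_isIntegral _ (hintegral i)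
  have hcommpt : ∀ i z, q (j i z) = k i (Spec.map (φ i) z) := fun i z => by
    rw [← Scheme.Hom.comp_apply, hcomm, Scheme.Hom.comp_apply]
  have hqm : Topology.IsQuotientMap q := by
    refine ⟨.of_isOpen_preimage_iff_isOpen fun V =>
      ⟨fun hV => ?_, fun hV => hV.preimage q.continuous⟩, fun x => ?_⟩
    rotate_left
    · obtain ⟨i, z, rfl⟩ := hex x
      obtain ⟨z', rfl⟩ := hsurj i z
      exact ⟨j i z', hcommpt i z'⟩
    · have hopen : ∀ i, IsOpen (k i ⁻¹' V) := by
        intro i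
        have hquot : Topology.IsQuotientMap (Spec.map (φ i)) :=
          (hcl i).isQuotientMap (Spec.map (φ i)).continuous (hsurj i)
        rw [← hquot.isOpen_preimage]
        have : Spec.map (φ i) ⁻¹' (k i ⁻¹' V) = j i ⁻¹' (q ⁻¹' V) := by
          ext z
          change k i (Spec.map (φ i) z) ∈ V ↔ q (j i z) ∈ V
          rw [hcommpt]
        rw [this]
        exact hV.preimage (j i).continuous
      have : V = ⋃ i, k i '' (k i ⁻¹' V) := by
        ext x
        simp only [Set.mem_iUnion, Set.mem_image, Set.mem_preimage]
        constructor
        · intro hx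
          obtain ⟨i, z, rfl⟩ := hex x
          exact ⟨i, z, hx, rfl⟩
        · rintro ⟨i, z, hz, rfl⟩
          exact hz
      rw [this]
      exact isOpen_iUnion fun i => (k i).isOpenEmbedding.isOpenMap _ (hopen i)
  have htopk := fun i => top_le_preimage_opensRange (k i)
  have htopj : ∀ i, ⊤ ≤ j i ⁻¹ᵁ (q ⁻¹ᵁ (k i).opensRange) := fun i =>
    (top_le_preimage_opensRange (j i)).trans ((j i).preimage_mono (hrange i).ge)
  have hsq : ∀ i, q.app (k i).opensRange ≫ evalSection (j i) _ (htopj i) =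
      evalSection (k i) _ (htopk i) ≫ φ i := by
    intro i
    have htop : ⊤ ≤ (j i ≫ q) ⁻¹ᵁ (k i).opensRange := htopj i
    rw [evalSection_app _ _ _ _ htop, evalSection_congr (hcomm i), evalSection_specMap]
  refine isQuotient_of_basis ρ q hinv hqm ?_ (fun i => (k i).opensRange) hbasis ?_ ?_
  · intro y y' hyy
    obtain ⟨i, hi⟩ := hex (q y)
    obtain ⟨z, rfl⟩ : y ∈ (j i).opensRange := hrange i ▸ hi
    obtain ⟨z', rfl⟩ : y' ∈ (j i).opensRange := by
      rw [← hrange i]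
      change q y' ∈ (k i).opensRange
      rwa [← hyy]
    rw [hcommpt, hcommpt] at hyy
    have hzz := (k i).isOpenEmbedding.injective hyy
    let := (φ i).hom.toAlgebra
    have := hinvt i
    have hsmul : SMulCommClass G (C i) (B i) := ⟨fun g c b => by
      rw [Algebra.smul_def, Algebra.smul_def, smul_mul']
      congr 1
      exact hfix i g c⟩
    let P : Ideal (B i) := z.asIdeal
    let P' : Ideal (B i) := z'.asIdeal
    have hP : P.IsPrime := z.isPrime
    have hP' : P'.IsPrime := z'.isPrime
    obtain ⟨g, hg⟩ := Algebra.IsInvariant.exists_smul_of_under_eq (C i) (B i) G P P'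
      (congrArg PrimeSpectrum.asIdeal hzz)
    refine ⟨g, ?_⟩
    rw [← Scheme.Hom.comp_apply, hact, Scheme.Hom.comp_apply]
    congr 1
    refine PrimeSpectrum.ext ?_
    change _ = P'
    rw [hg]
    ext b
    rw [Ideal.mem_pointwise_smul_iff_inv_smul_mem]
    rfl
  · intro i
    have hκ := isIso_evalSection_of_isOpenImmersion (k i) _ rfl (htopk i)
    intro r r' hr
    have h1 := ConcreteCategory.congr_hom (hsq i) r
    have h2 := ConcreteCategory.congr_hom (hsq i) r'
    rw [ConcreteCategory.comp_apply, ConcreteCategory.comp_apply] at h1 h2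
    rw [hr] at h1
    exact (ConcreteCategory.bijective_of_isIso _).1 (hφ i (h1.symm.trans h2))
  · intro i s hs
    have hκ := isIso_evalSection_of_isOpenImmersion (k i) _ rfl (htopk i)
    have hβ := isIso_evalSection_of_isOpenImmersion (j i) _ (hrange i) (htopj i)
    obtain ⟨c, hc⟩ := hfix' i (evalSection (j i) _ (htopj i) s) (fun g => by
      have htop : ⊤ ≤ (j i ≫ (ρ g⁻¹).hom) ⁻¹ᵁ (q ⁻¹ᵁ (k i).opensRange) :=
        (htopj i).trans ((j i).preimage_mono (preimage_le_of_comp_eq _ q (hinv g⁻¹) _))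
      have h1 := evalSection_appLE (j i) (ρ g⁻¹).hom _ _
        (preimage_le_of_comp_eq _ q (hinv g⁻¹) (k i).opensRange) (htopj i) htop
      rw [evalSection_congr (hact i g⁻¹), evalSection_specMap _ _ _ (htopj i), inv_inv] at h1
      have h2 := ConcreteCategory.congr_hom h1 s
      rw [ConcreteCategory.comp_apply, hs g⁻¹] at h2
      exact h2.symm)
    obtain ⟨r, hr⟩ := (ConcreteCategory.bijective_of_isIso
      (evalSection (k i) _ (htopk i))).2 c
    refine ⟨r, (ConcreteCategory.bijective_of_isIso (evalSection (j i) _ (htopj i))).1 ?_⟩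
    rw [← hc, ← hr]
    exact ConcreteCategory.congr_hom (hsq i) r

end Charts

/-! ### Morphisms between homogeneous spectra -/

section ProjMap

open HomogeneousLocalization Graded

variable {S S' σ τ : Type u} [CommRing S] [SetLike σ S] [AddSubgroupClass σ S]
  [CommRing S'] [SetLike τ S'] [AddSubgroupClass τ S']
  {𝒜 : ℕ → σ} {ℬ : ℕ → τ} [GradedRing 𝒜] [GradedRing ℬ]

lemma isBasis_basicOpen_homogeneous (𝒜 : ℕ → σ) [GradedRing 𝒜] :
    TopologicalSpace.Opens.IsBasis
      (Set.range fun s : Σ i : ℕ+, 𝒜 i => Proj.basicOpen 𝒜 (s.2 : S)) := by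
  rw [TopologicalSpace.Opens.isBasis_iff_nbhd]
  intro U x hx
  obtain ⟨_, ⟨a, rfl⟩, hxa, ha⟩ :=
    TopologicalSpace.Opens.isBasis_iff_nbhd.1 (Proj.isBasis_basicOpen 𝒜) hx
  rw [Proj.basicOpen_eq_iSup_proj] at hxa
  obtain ⟨i, hi⟩ := TopologicalSpace.Opens.mem_iSup.1 hxa
  -- multiply by an element of positive degree to make the degree positive
  let t := (Proj.affineOpenCover 𝒜).idx x
  have ht : x ∈ (Proj.awayι 𝒜 (t.2 : S) t.2.2 t.1.pos).opensRange :=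
    (Proj.affineOpenCover 𝒜).covers x
  rw [Proj.opensRange_awayι] at ht
  refine ⟨_, ⟨⟨⟨i + t.1, by have := t.1.pos; omega⟩, ⟨GradedRing.proj 𝒜 i a * t.2,
    SetLike.mul_mem_graded (SetLike.coe_mem _) t.2.2⟩⟩, rfl⟩, ?_, ?_⟩
  · dsimp only
    rw [Proj.basicOpen_mul]
    exact ⟨hi, ht⟩
  · dsimp only
    rw [Proj.basicOpen_mul]
    refine inf_le_left.trans (le_trans ?_ ha)
    rw [Proj.basicOpen_eq_iSup_proj 𝒜 a]
    exact le_iSup (fun i => Proj.basicOpen 𝒜 (GradedRing.proj 𝒜 i a)) i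

variable (f : ℬ →+*ᵍ 𝒜)

/-- The elements of `ℬ` of positive degree have no common zero on `Proj 𝒜`: this makes
`Proj 𝒜 ⟶ Proj ℬ` defined everywhere. -/
def CoversProj : Prop :=
  ∀ y : Proj 𝒜, ∃ n : ℕ, 0 < n ∧ ∃ s ∈ ℬ n, y ∈ Proj.basicOpen 𝒜 (f s)

variable {f} (hf : CoversProj f)

/-- The affine charts of `Proj 𝒜` given by homogeneous elements of `ℬ`. -/
def projCover : (Proj 𝒜).AffineOpenCover where
  I₀ := Σ i : ℕ+, ℬ i
  X i := .of (Away 𝒜 (f (i.2 : S')))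
  f i := Proj.awayι 𝒜 (f (i.2 : S')) (map_mem f i.2.2) i.1.pos
  idx y := ⟨⟨(hf y).choose, (hf y).choose_spec.1⟩, ⟨(hf y).choose_spec.2.choose,
    (hf y).choose_spec.2.choose_spec.1⟩⟩
  covers y := by
    change y ∈ (Proj.awayι 𝒜 _ _ _).opensRange
    rw [Proj.opensRange_awayι]
    exact (hf y).choose_spec.2.choose_spec.2

lemma awayMap_comp_map {d e : ℕ} {s t r : S'} (hs : s ∈ ℬ d) (ht : t ∈ ℬ e) (hr : r = s * t)
    (hr' : f r = f s * f t) :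
    (awayMap 𝒜 (map_mem f ht) hr').comp (Away.map f s) =
      (Away.map f r).comp (awayMap ℬ ht hr) := by
  ext x : 1
  obtain ⟨n, a, ha, rfl⟩ := Away.mk_surjective ℬ hs x
  rw [RingHom.comp_apply, RingHom.comp_apply, Away.map_mk, awayMap_mk, awayMap_mk, Away.map_mk]
  ext
  simp [Away.val_mk]

lemma projCharts_compatible {d e : ℕ} (hd : 0 < d) (he : 0 < e) {s t : S'} (hs : s ∈ ℬ d)
    (ht : t ∈ ℬ e) :
    Limits.pullback.fst (Proj.awayι 𝒜 (f s) (map_mem f hs) hd)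
        (Proj.awayι 𝒜 (f t) (map_mem f ht) he) ≫
      Spec.map (CommRingCat.ofHom (Away.map f s)) ≫ Proj.awayι ℬ s hs hd =
    Limits.pullback.snd (Proj.awayι 𝒜 (f s) (map_mem f hs) hd)
        (Proj.awayι 𝒜 (f t) (map_mem f ht) he) ≫
      Spec.map (CommRingCat.ofHom (Away.map f t)) ≫ Proj.awayι ℬ t ht he := by
  have hmul : f (s * t) = f s * f t := map_mul f _ _
  have hmul' : f (s * t) = f t * f s := by rw [hmul, mul_comm]
  rw [← cancel_epi (Proj.pullbackAwayιIso 𝒜 (map_mem f hs) hd (map_mem f ht) he hmul).inv,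
    Proj.pullbackAwayιIso_inv_fst_assoc, Proj.pullbackAwayιIso_inv_snd_assoc,
    ← Spec.map_comp_assoc, ← Spec.map_comp_assoc,
    ← CommRingCat.ofHom_comp, ← CommRingCat.ofHom_comp,
    awayMap_comp_map hs ht rfl hmul, awayMap_comp_map ht hs (mul_comm _ _) hmul',
    CommRingCat.ofHom_comp, CommRingCat.ofHom_comp, Spec.map_comp_assoc, Spec.map_comp_assoc,
    Proj.SpecMap_awayMap_awayι, Proj.SpecMap_awayMap_awayι]
  rfl

/-- The morphism `Proj 𝒜 ⟶ Proj ℬ` induced by a graded homomorphism `ℬ → 𝒜`. -/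
def projMap : Proj 𝒜 ⟶ Proj ℬ :=
  (projCover hf).openCover.glueMorphisms
    (fun i => Spec.map (CommRingCat.ofHom (Away.map f (i.2 : S'))) ≫
      Proj.awayι ℬ (i.2 : S') i.2.2 i.1.pos)
    fun i j => projCharts_compatible i.1.pos j.1.pos i.2.2 j.2.2

/-- On the chart of `s`, the morphism `projMap` is given by the homomorphism `Away.map f s`. -/
lemma awayι_projMap {n : ℕ} (hn : 0 < n) (s : S') (hs : s ∈ ℬ n) :
    Proj.awayι 𝒜 (f s) (map_mem f hs) hn ≫ projMap hf =
      Spec.map (CommRingCat.ofHom (Away.map f s)) ≫ Proj.awayι ℬ s hs hn :=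
  (projCover hf).openCover.ι_glueMorphisms _ _ ⟨⟨n, hn⟩, ⟨s, hs⟩⟩

include hf in
omit [AddSubgroupClass τ S'] [GradedRing ℬ] in
lemma projMap_hom_ext {Z : Scheme.{u}} {a b : Proj 𝒜 ⟶ Z}
    (h : ∀ (n : ℕ) (hn : 0 < n) (s : S') (hs : s ∈ ℬ n),
      Proj.awayι 𝒜 (f s) (map_mem f hs) hn ≫ a = Proj.awayι 𝒜 (f s) (map_mem f hs) hn ≫ b) :
    a = b :=
  (projCover hf).openCover.hom_ext _ _ fun i => h i.1 i.1.pos i.2 i.2.2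

lemma projMap_preimage_basicOpen {n : ℕ} (hn : 0 < n) (s : S') (hs : s ∈ ℬ n) :
    projMap hf ⁻¹ᵁ Proj.basicOpen ℬ s = Proj.basicOpen 𝒜 (f s) := by
  ext y
  obtain ⟨k, hk, t, ht, hy⟩ := hf y
  rw [← Proj.opensRange_awayι 𝒜 (f t) (map_mem f ht) hk] at hy
  obtain ⟨z, rfl⟩ := hy
  have h1 : projMap hf (Proj.awayι 𝒜 (f t) (map_mem f ht) hk z) = Proj.awayι ℬ t ht hk
      (Spec.map (CommRingCat.ofHom (Away.map f t)) z) := by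
    rw [← Scheme.Hom.comp_apply, awayι_projMap hf hk t ht, Scheme.Hom.comp_apply]
  have h2 : ∀ z, Proj.awayι ℬ t ht hk z ∈ Proj.basicOpen ℬ s ↔
      z ∈ PrimeSpectrum.basicOpen (Away.isLocalizationElem ht hs) := fun z => by
    rw [← Proj.awayι_preimage_basicOpen ℬ ht hk hs hn]
    rfl
  have h3 : Proj.awayι 𝒜 (f t) (map_mem f ht) hk z ∈ Proj.basicOpen 𝒜 (f s) ↔
      z ∈ PrimeSpectrum.basicOpen (Away.isLocalizationElem (map_mem f ht) (map_mem f hs)) := by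
    rw [← Proj.awayι_preimage_basicOpen 𝒜 (map_mem f ht) hk (map_mem f hs) hn]
    rfl
  change projMap hf _ ∈ Proj.basicOpen ℬ s ↔ _ ∈ Proj.basicOpen 𝒜 (f s)
  rw [h1, h2, h3]
  rw [show Spec.map (CommRingCat.ofHom (Away.map f t)) z ∈
      PrimeSpectrum.basicOpen (Away.isLocalizationElem ht hs) ↔
      z ∈ PrimeSpectrum.basicOpen (Away.map f t (Away.isLocalizationElem ht hs)) from Iff.rfl,
    Away.map_mk]
  simp only [map_pow]

lemma map_injective_of_injective (hinj : Function.Injective f) {n : ℕ} (s : S') (hs : s ∈ ℬ n) :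
    Function.Injective (Away.map f s) := by
  rw [injective_iff_map_eq_zero]
  intro x hx
  obtain ⟨k, a, ha, rfl⟩ := Away.mk_surjective ℬ hs x
  rw [Away.map_mk] at hx
  ext
  have h1 := congrArg HomogeneousLocalization.val hx
  rw [Away.val_mk, val_zero, Localization.mk_eq_mk', IsLocalization.mk'_eq_zero_iff] at h1
  obtain ⟨⟨_, j, rfl⟩, hj⟩ := h1
  rw [Away.val_mk, val_zero, Localization.mk_eq_mk', IsLocalization.mk'_eq_zero_iff]
  refine ⟨⟨_, j, rfl⟩, hinj ?_⟩
  simpa using hj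

end ProjMap

/-! ### The quotient of a homogeneous spectrum by a finite group -/

section Invariants

open HomogeneousLocalization Graded

variable {S σ : Type u} [CommRing S] [SetLike σ S] [AddSubgroupClass σ S]
  {𝒜 : ℕ → σ} [GradedRing 𝒜] {G : Type*} [Group G] (Φ : G →* (𝒜 →+*ᵍ 𝒜))

/-- The ring of invariants of an action by graded automorphisms. -/
def invariantSubring : Subring S := ⨅ g, (Φ g : S →+* S).eqLocus (RingHom.id S)

omit [AddSubgroupClass σ S] [GradedRing 𝒜] in
lemma mem_invariantSubring {a : S} : a ∈ invariantSubring Φ ↔ ∀ g, Φ g a = a := by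
  simp [invariantSubring, Subring.mem_iInf]

/-- The grading of the ring of invariants. -/
def invariantGrading (i : ℕ) : AddSubgroup (invariantSubring Φ) where
  carrier := {a | (a : S) ∈ 𝒜 i}
  add_mem' := fun ha hb => add_mem (S := σ) ha hb
  zero_mem' := zero_mem (𝒜 i)
  neg_mem' := fun ha => neg_mem (S := σ) ha

instance : SetLike.GradedMonoid (invariantGrading Φ) where
  one_mem := SetLike.one_mem_graded 𝒜
  mul_mem := fun _ _ _ _ ha hb => SetLike.mul_mem_graded (A := 𝒜) ha hb

lemma proj_mem_invariantSubring {a : S} (ha : a ∈ invariantSubring Φ) (i : ℕ) :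
    GradedRing.proj 𝒜 i a ∈ invariantSubring Φ := by
  rw [mem_invariantSubring] at ha ⊢
  intro g
  conv_rhs => rw [← ha g]
  simp only [GradedRing.proj_apply]
  have h := DirectSum.decompose_map 𝒜 𝒜 (Φ g) (x := a)
  rw [h]
  rfl

open Classical in
lemma isInternal_invariantGrading : DirectSum.IsInternal (invariantGrading Φ) := by
  constructor
  · have h : ∀ (x : DirectSum ℕ fun i => invariantGrading Φ i) (j : ℕ),
        ((DirectSum.decompose 𝒜
          (DirectSum.coeAddMonoidHom (invariantGrading Φ) x : S) j : 𝒜 j) : S) =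
        ((x j : invariantGrading Φ j) : S) := by
      intro x j
      induction x using DirectSum.induction_on with
      | zero => simp
      | of i a =>
        rw [DirectSum.coeAddMonoidHom_of]
        by_cases hij : i = j
        · subst hij
          rw [DirectSum.decompose_of_mem_same 𝒜 a.2, DirectSum.of_eq_same]
        · rw [DirectSum.decompose_of_mem_ne 𝒜 a.2 hij, DirectSum.of_eq_of_ne _ _ _ (Ne.symm hij)]
          rfl
      | add x y hx hy =>
        rw [map_add, Subring.coe_add, DirectSum.decompose_add, DirectSum.add_apply,
          DirectSum.add_apply, AddMemClass.coe_add, hx, hy]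
        rfl
    intro x y hxy
    ext j
    have := h x j
    rw [hxy, h y j] at this
    exact this.symm
  · intro a
    refine ⟨∑ i ∈ (DirectSum.decompose 𝒜 (a : S)).support,
      DirectSum.of (fun i => invariantGrading Φ i) i
        ⟨⟨_, proj_mem_invariantSubring Φ a.2 i⟩, SetLike.coe_mem _⟩, ?_⟩
    ext
    rw [map_sum, AddSubmonoidClass.coe_finsetSum]
    simp only [DirectSum.coeAddMonoidHom_of]
    exact DirectSum.sum_support_decompose 𝒜 (a : S)

instance : GradedRing (invariantGrading Φ) where
  __ := (isInternal_invariantGrading Φ).chooseDecomposition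

/-- The inclusion of the ring of invariants. -/
def invariantIncl : invariantGrading Φ →+*ᵍ 𝒜 where
  __ := (invariantSubring Φ).subtype
  map_mem := fun h => h

omit [GradedRing 𝒜] in
lemma invariantIncl_apply (a : invariantSubring Φ) : invariantIncl Φ a = a := rfl

omit [AddSubgroupClass σ S] [GradedRing 𝒜] in
lemma comp_apply_of_mul (g h : G) (a : S) : Φ (g * h) a = Φ g (Φ h a) := by
  rw [map_mul]
  rfl

lemma irrelevant_le_map (g : G) :
    HomogeneousIdeal.irrelevant 𝒜 ≤ (HomogeneousIdeal.irrelevant 𝒜).map (Φ g) := by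
  refine (HomogeneousIdeal.irrelevant_le 𝒜).2 fun i hi x hx => ?_
  have h1 : Φ g (Φ g⁻¹ x) = x := by
    rw [← comp_apply_of_mul, mul_inv_cancel, map_one]
    rfl
  rw [← h1]
  exact Ideal.mem_map_of_mem _
    (HomogeneousIdeal.mem_irrelevant_of_mem 𝒜 hi (map_mem (Φ g⁻¹) hx))

lemma projMap_mul (g h : G) : Proj.map (Φ (g * h)) (irrelevant_le_map Φ (g * h)) =
    Proj.map (Φ g) (irrelevant_le_map Φ g) ≫ Proj.map (Φ h) (irrelevant_le_map Φ h) := by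
  rw [← Proj.map_comp]
  congr 1
  exact map_mul Φ g h

lemma projMap_one : Proj.map (Φ 1) (irrelevant_le_map Φ 1) = 𝟙 (Proj 𝒜) := by
  rw [← Proj.map_id]
  congr 1
  exact map_one Φ

/-- The action on `Proj 𝒜`: the element `g` acts by substitution with `g⁻¹`. -/
def projAction : G →* Aut (Proj 𝒜) where
  toFun g :=
    { hom := Proj.map (Φ g⁻¹) (irrelevant_le_map Φ g⁻¹)
      inv := Proj.map (Φ g) (irrelevant_le_map Φ g)
      hom_inv_id := by
        rw [← projMap_mul, ← projMap_one Φ]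
        congr 2
        exact inv_mul_cancel g
      inv_hom_id := by
        rw [← projMap_mul, ← projMap_one Φ]
        congr 2
        exact mul_inv_cancel g }
  map_one' := by
    ext1
    change Proj.map (Φ 1⁻¹) _ = 𝟙 _
    rw [← projMap_one Φ]
    congr 2
    exact inv_one
  map_mul' g h := by
    ext1
    change Proj.map (Φ (g * h)⁻¹) _ = Proj.map (Φ h⁻¹) _ ≫ Proj.map (Φ g⁻¹) _
    rw [← projMap_mul]
    congr 2
    exact mul_inv_rev g h

omit [AddSubgroupClass σ S] [GradedRing 𝒜] in
lemma powers_le_comap {s : S} (hs : s ∈ invariantSubring Φ) (g : G) :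
    Submonoid.powers s ≤ (Submonoid.powers s).comap (Φ g) := by
  rintro _ ⟨n, rfl⟩
  exact ⟨n, by rw [map_pow, (mem_invariantSubring Φ).1 hs g]⟩

/-- The action on the coordinate ring of the chart of an invariant element. -/
def awayAction {s : S} (hs : s ∈ invariantSubring Φ) : G →* (Away 𝒜 s →+* Away 𝒜 s) where
  toFun g := HomogeneousLocalization.map (Φ g) (powers_le_comap Φ hs g)
  map_one' := by
    refine Eq.trans ?_ (HomogeneousLocalization.map_id 𝒜 _)
    congr 1
    exact map_one Φ
  map_mul' g h := by
    refine Eq.trans ?_ (HomogeneousLocalization.map_comp (powers_le_comap Φ hs h)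
      (powers_le_comap Φ hs g))
    congr 1
    exact map_mul Φ g h

lemma awayAction_mk {s : S} (hs : s ∈ invariantSubring Φ) (g : G) {d : ℕ} (hd : s ∈ 𝒜 d) (n : ℕ)
    (a : S) (ha : a ∈ 𝒜 (n • d)) : awayAction Φ hs g (Away.mk 𝒜 hd n a ha) =
      Away.mk 𝒜 hd n (Φ g a) (map_mem (Φ g) ha) := by
  ext
  simp only [awayAction, MonoidHom.coe_mk, OneHom.coe_mk, Away.mk, HomogeneousLocalization.map_mk,
    HomogeneousLocalization.val_mk, map_pow, (mem_invariantSubring Φ).1 hs g]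

lemma awayι_comp_map_of_eq (f : 𝒜 →+*ᵍ 𝒜) (hf : HomogeneousIdeal.irrelevant 𝒜 ≤
      (HomogeneousIdeal.irrelevant 𝒜).map f) {d : ℕ} (hd : 0 < d) {s t : S} (hs : s ∈ 𝒜 d)
    (ht : t ∈ 𝒜 d) (hst : f s = t) (hle : Submonoid.powers s ≤ (Submonoid.powers t).comap f) :
    Proj.awayι 𝒜 t ht hd ≫ Proj.map f hf =
      Spec.map (CommRingCat.ofHom (HomogeneousLocalization.map f hle)) ≫
        Proj.awayι 𝒜 s hs hd := by
  subst hst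
  exact Proj.awayι_comp_map f hf hd s hs

lemma awayι_comp_projAction {d : ℕ} (hd : 0 < d) {s : S} (hs : s ∈ invariantSubring Φ)
    (hsd : s ∈ 𝒜 d) (g : G) : Proj.awayι 𝒜 s hsd hd ≫ (projAction Φ g).hom =
      Spec.map (CommRingCat.ofHom (awayAction Φ hs g⁻¹)) ≫ Proj.awayι 𝒜 s hsd hd :=
  awayι_comp_map_of_eq _ _ hd hsd hsd ((mem_invariantSubring Φ).1 hs _)
    (powers_le_comap Φ hs g⁻¹)

lemma awayAction_map {d : ℕ} (s : invariantSubring Φ) (hs : s ∈ invariantGrading Φ d) (g : G)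
    (c : Away (invariantGrading Φ) s) :
    awayAction Φ s.2 g (Away.map (invariantIncl Φ) s c) = Away.map (invariantIncl Φ) s c := by
  have hsd : (s : S) ∈ 𝒜 d := hs
  obtain ⟨n, a, ha, rfl⟩ := Away.mk_surjective _ hs c
  rw [Away.map_mk]
  refine (awayAction_mk Φ s.2 g hsd n _ _).trans ?_
  congr 1
  exact (mem_invariantSubring Φ).1 a.2 g

lemma projAction_comp_projMap (hcov : CoversProj (invariantIncl Φ)) (g : G) :
    (projAction Φ g).hom ≫ projMap hcov = projMap hcov := by
  refine projMap_hom_ext hcov fun n hn s hs => ?_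
  have h1 := awayι_comp_projAction Φ hn s.2 hs g
  have h2 := awayι_projMap hcov hn s hs
  have h3 : (awayAction Φ s.2 g⁻¹).comp (Away.map (invariantIncl Φ) s) =
      Away.map (invariantIncl Φ) s := RingHom.ext fun c => awayAction_map Φ s hs g⁻¹ c
  rw [h2]
  calc _ = (Spec.map (CommRingCat.ofHom (awayAction Φ s.2 g⁻¹)) ≫
        Proj.awayι 𝒜 (s : S) hs hn) ≫ projMap hcov := by rw [← h1, Category.assoc]; rfl
    _ = Spec.map (CommRingCat.ofHom (awayAction Φ s.2 g⁻¹)) ≫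
        Spec.map (CommRingCat.ofHom (Away.map (invariantIncl Φ) s)) ≫ _ := by
      rw [Category.assoc]
      exact congrArg _ h2
    _ = _ := by
      rw [← Spec.map_comp_assoc]
      exact congrArg (fun t => Spec.map (CommRingCat.ofHom t) ≫ _) h3

variable [IsDomain S]

/-- Invariants commute with homogeneous localization at an invariant element `s`: a fraction over a
power of `s` is invariant only if its numerator is. -/
lemma exists_map_eq_of_invariant {d : ℕ} (s : invariantSubring Φ) (hs : s ∈ invariantGrading Φ d)
    (b : Away 𝒜 (s : S)) (hb : ∀ g, awayAction Φ s.2 g b = b) :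
    ∃ c, Away.map (invariantIncl Φ) s c = b := by
  by_cases hs0 : s = 0
  · have : Subsingleton (Away 𝒜 (invariantIncl Φ s)) :=
      HomogeneousLocalization.subsingleton 𝒜 ⟨1, by simp [hs0, invariantIncl_apply]⟩
    exact ⟨0, Subsingleton.elim _ _⟩
  have hsd : (s : S) ∈ 𝒜 d := hs
  obtain ⟨n, a, ha, rfl⟩ := Away.mk_surjective 𝒜 hsd b
  have ham : a ∈ invariantSubring Φ := (mem_invariantSubring Φ).2 fun g => by
    have h1 := congrArg HomogeneousLocalization.val (hb g)
    rw [awayAction_mk Φ s.2 g hsd n a ha, Away.val_mk, Away.val_mk, Localization.mk_eq_mk_iff,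
      Localization.r_iff_exists] at h1
    obtain ⟨⟨_, j, rfl⟩, hj⟩ := h1
    have hs0' : (s : S) ≠ 0 := fun h => hs0 (Subtype.ext h)
    exact mul_left_cancel₀ (pow_ne_zero n hs0') (mul_left_cancel₀ (pow_ne_zero j hs0') hj)
  exact ⟨Away.mk _ hs n ⟨a, ham⟩ ha, Away.map_mk (invariantIncl Φ) s hs n ⟨a, ham⟩ ha⟩

variable [Finite G]

/-- If every point of `Proj 𝒜` lies in the chart of an invariant element, then the homogeneous
spectrum of the ring of invariants is the quotient. -/
theorem isQuotient_projMap (hcov : CoversProj (invariantIncl Φ)) :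
    IsQuotient (projAction Φ) (projMap hcov) := by
  let I := Σ i : ℕ+, invariantGrading Φ i
  let (i : I) : MulSemiringAction G (Away 𝒜 ((i.2 : invariantSubring Φ) : S)) :=
    MulSemiringAction.compHom _ (awayAction Φ (i.2 : invariantSubring Φ).2)
  have hmem (i : I) : ((i.2 : invariantSubring Φ) : S) ∈ 𝒜 i.1 := i.2.2
  have himm (i : I) : IsOpenImmersion (Proj.awayι 𝒜 _ (hmem i) i.1.pos) := inferInstance
  refine isQuotient_of_charts (projAction Φ) (projMap hcov)
    (projAction_comp_projMap Φ hcov)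
    (I := I)
    (fun i => .of (Away 𝒜 ((i.2 : invariantSubring Φ) : S)))
    (fun i => .of (Away (invariantGrading Φ) (i.2 : invariantSubring Φ)))
    (fun i => Proj.awayι 𝒜 ((i.2 : invariantSubring Φ) : S) (hmem i) i.1.pos)
    (fun i => Proj.awayι (invariantGrading Φ) (i.2 : invariantSubring Φ) i.2.2 i.1.pos)
    (fun i => CommRingCat.ofHom (Away.map (invariantIncl Φ) (i.2 : invariantSubring Φ)))
    (fun i => awayι_projMap hcov i.1.pos _ i.2.2) (fun i => ?_) (fun i g => ?_) ?_
    (fun i => ?_) (fun i g c => ?_) (fun i b hb => ?_)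
  · rw [Proj.opensRange_awayι, Proj.opensRange_awayι]
    exact projMap_preimage_basicOpen hcov i.1.pos _ i.2.2
  · exact awayι_comp_projAction Φ i.1.pos (i.2 : invariantSubring Φ).2 i.2.2 g
  · simp only [Proj.opensRange_awayι]
    exact isBasis_basicOpen_homogeneous (invariantGrading Φ)
  · exact map_injective_of_injective Subtype.val_injective _ i.2.2
  · exact awayAction_map Φ _ i.2.2 g c
  · exact exists_map_eq_of_invariant Φ _ i.2.2 b hb

end Invariants

/-! ### Integrality of homogeneous spectra and points of the projective line -/

section ProjIntegral

open HomogeneousLocalization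

variable {S σ : Type u} [CommRing S] [IsDomain S] [SetLike σ S] [AddSubgroupClass σ S]
  (𝒜 : ℕ → σ) [GradedRing 𝒜]

lemma isDomain_away {s : S} (hs : s ≠ 0) : IsDomain (Away 𝒜 s) := by
  have : IsDomain (Localization.Away s) := IsLocalization.isDomain_localization
    (powers_le_nonZeroDivisors_of_noZeroDivisors hs)
  exact Function.Injective.isDomain (algebraMap (Away 𝒜 s) (Localization.Away s))
    (val_injective _)

lemma basicOpen_nonempty {d : ℕ} (hd : 0 < d) {s : S} (hs : s ∈ 𝒜 d) (h0 : s ≠ 0) :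
    (Proj.basicOpen 𝒜 s : Set (Proj 𝒜)).Nonempty := by
  have := isDomain_away 𝒜 h0
  rw [← Proj.opensRange_awayι 𝒜 s hs hd]
  exact ⟨_, (⊥ : PrimeSpectrum (Away 𝒜 s)), rfl⟩

/-- The basic open sets of nonzero homogeneous elements have coordinate rings which are domains, and
any two of them meet. -/
theorem isIntegral_proj [Nonempty (Proj 𝒜)] : IsIntegral (Proj 𝒜) := by
  have hne : ∀ U : (Proj 𝒜).Opens, (U : Set (Proj 𝒜)).Nonempty → ∃ i : Σ i : ℕ+, 𝒜 i,
      (i.2 : S) ≠ 0 ∧ Proj.basicOpen 𝒜 (i.2 : S) ≤ U := by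
    rintro U ⟨x, hx⟩
    obtain ⟨_, ⟨i, rfl⟩, hxi, hi⟩ := TopologicalSpace.Opens.isBasis_iff_nbhd.1
      (isBasis_basicOpen_homogeneous 𝒜) hx
    refine ⟨i, fun h0 => ?_, hi⟩
    dsimp only at hxi
    rw [h0, Proj.basicOpen_zero] at hxi
    exact hxi
  have hirr : IrreducibleSpace (Proj 𝒜) := by
    refine @IrreducibleSpace.mk _ _ ⟨?_⟩ inferInstance
    rintro U V hU hV ⟨x, -, hx⟩ ⟨x', -, hx'⟩
    obtain ⟨i, hi0, hi⟩ := hne ⟨U, hU⟩ ⟨x, hx⟩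
    obtain ⟨j, hj0, hj⟩ := hne ⟨V, hV⟩ ⟨x', hx'⟩
    obtain ⟨z, hz⟩ := basicOpen_nonempty 𝒜 (Nat.add_pos_left i.1.pos _)
      (SetLike.mul_mem_graded i.2.2 j.2.2) (mul_ne_zero hi0 hj0)
    rw [Proj.basicOpen_mul] at hz
    exact ⟨z, trivial, hi hz.1, hj hz.2⟩
  have hred : IsReduced (Proj 𝒜) := by
    have : ∀ i, IsReduced ((Proj.affineOpenCover 𝒜).openCover.X i) := by
      intro i
      have hi : _root_.IsReduced (Away 𝒜 (i.2 : S)) := by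
        by_cases h0 : (i.2 : S) = 0
        · have := HomogeneousLocalization.subsingleton 𝒜 (x := Submonoid.powers (i.2 : S))
            ⟨1, by simp [h0]⟩
          infer_instance
        · have := isDomain_away 𝒜 h0
          infer_instance
      have : IsReduced (Spec (.of (Away 𝒜 (i.2 : S)))) := (affine_isReduced_iff _).2 hi
      exact this
    exact IsReduced.of_openCover _ (Proj.affineOpenCover 𝒜).openCover
  exact isIntegral_of_irreducibleSpace_of_isReduced _

end ProjIntegral

section ProjectiveLine

open HomogeneousLocalization

attribute [local instance] MvPolynomial.gradedAlgebra

variable {A F : Type u} [CommRing A] [Field F] [Algebra A F]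

lemma P1.X_mem (i : Fin 2) :
    (MvPolynomial.X i : MvPolynomial (Fin 2) A) ∈ MvPolynomial.homogeneousSubmodule (Fin 2) A 1 :=
  (MvPolynomial.mem_homogeneousSubmodule _ _).2 (MvPolynomial.isHomogeneous_X A i)

lemma P1.evalAt_mk (t : F) (n : ℕ) (s : MvPolynomial (Fin 2) A)
    (hs : s ∈ MvPolynomial.homogeneousSubmodule (Fin 2) A (n • 1)) :
    P1.evalAt t (Away.mk _ (P1.X_mem 1) n s hs) = MvPolynomial.aeval ![t, 1] s := by
  rw [P1.evalAt, RingHom.comp_apply, HomogeneousLocalization.algebraMap_apply, Away.val_mk,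
    Localization.mk_eq_mk', IsLocalization.Away.lift, IsLocalization.lift_mk',
    Units.mul_inv_eq_iff_eq_mul]
  simp [IsUnit.coe_liftRight]

lemma P1.aeval_eq_aeval (t : F) (s : MvPolynomial (Fin 2) A) :
    MvPolynomial.aeval ![t, 1] s = Polynomial.aeval t (MvPolynomial.aeval ![X, 1] s : A[X]) := by
  have : (MvPolynomial.aeval ![t, 1] : MvPolynomial (Fin 2) A →ₐ[A] F) =
      (Polynomial.aeval t).comp (MvPolynomial.aeval ![X, 1]) := by
    ext i
    fin_cases i <;> simp
  rw [this]
  rfl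

lemma P1.dehomogenize_eq_zero {n : ℕ} {s : MvPolynomial (Fin 2) A} (hs : s.IsHomogeneous n)
    (h : (MvPolynomial.aeval ![X, 1] s : A[X]) = 0) : s = 0 := by
  rw [← homogenize_eq_of_isHomogeneous hs h, homogenize_zero]

/-- A function on the chart vanishing at a transcendental parameter is zero. -/
lemma P1.evalAt_injective {t : F} (ht : Function.Injective (Polynomial.aeval t : A[X] →ₐ[A] F)) :
    Function.Injective (P1.evalAt (A := A) t) := by
  rw [injective_iff_map_eq_zero]
  intro x hx
  obtain ⟨n, s, hs, rfl⟩ := Away.mk_surjective _ (P1.X_mem 1) x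
  rw [P1.evalAt_mk, P1.aeval_eq_aeval, map_eq_zero_iff _ ht] at hx
  have := P1.dehomogenize_eq_zero ((MvPolynomial.mem_homogeneousSubmodule _ _).1 hs) hx
  subst this
  ext
  rw [Away.val_mk, Localization.mk_zero, val_zero]

/-- The chart `X 1 ≠ 0` of the projective line. -/
def P1.chart (A : Type u) [CommRing A] :
    Spec (.of (Away (MvPolynomial.homogeneousSubmodule (Fin 2) A) (MvPolynomial.X 1))) ⟶ P1 A :=
  Proj.awayι (MvPolynomial.homogeneousSubmodule (Fin 2) A) (MvPolynomial.X 1) (P1.X_mem 1) one_pos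

instance : IsOpenImmersion (P1.chart A) :=
  inferInstanceAs (IsOpenImmersion (Proj.awayι _ _ _ _))

lemma P1.point_eq (t : F) :
    P1.point (A := A) t = Spec.map (CommRingCat.ofHom (P1.evalAt t)) ≫ P1.chart A := rfl

variable [IsDomain A]

instance : IsIntegral (P1 A) := by
  have : Nonempty (P1 A) := by
    obtain ⟨x, -⟩ := basicOpen_nonempty (MvPolynomial.homogeneousSubmodule (Fin 2) A) one_pos
      (P1.X_mem 1) (MvPolynomial.X_ne_zero 1)
    exact ⟨x⟩
  exact isIntegral_proj _

/-- A transcendental parameter gives the generic point of the projective line. -/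
lemma P1.point_eq_genericPoint {t : F}
    (ht : Function.Injective (Polynomial.aeval t : A[X] →ₐ[A] F)) (x : Spec (.of F)) :
    P1.point (A := A) t x = genericPoint (P1 A) := by
  have hdom : IsDomain (Away (MvPolynomial.homogeneousSubmodule (Fin 2) A) (MvPolynomial.X 1)) :=
    isDomain_away _ (MvPolynomial.X_ne_zero 1)
  have hdom' : IsDomain ↑(CommRingCat.of
    (Away (MvPolynomial.homogeneousSubmodule (Fin 2) A) (MvPolynomial.X 1))) := hdom
  rw [← genericPoint_eq_of_isOpenImmersion (P1.chart A), genericPoint_eq_bot_of_affine, P1.point_eq,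
    Scheme.Hom.comp_apply]
  congr 1
  refine PrimeSpectrum.ext ?_
  have hx : x.asIdeal = ⊥ := by
    have := x.isPrime
    exact (Ideal.eq_bot_or_top x.asIdeal).resolve_right this.ne_top
  change Ideal.comap (P1.evalAt t) x.asIdeal = ⊥
  rw [hx, ← RingHom.ker_eq_comap_bot]
  exact (RingHom.injective_iff_ker_eq_bot _).1 (P1.evalAt_injective ht)

end ProjectiveLine

/-! ### Actions on the projective line by affine substitutions -/

section AffineAction

open HomogeneousLocalization Graded

attribute [local instance] MvPolynomial.gradedAlgebra

variable {A : Type u} [CommRing A] {G : Type*} [Group G] [MulSemiringAction G A]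

/-- The functions `u`, `b` on `G` for which the substitutions `t ↦ u g * t + b g`, together with
the action of `G` on the coefficients, form an action of `G`. -/
structure IsAffineCocycle (u b : G → A) : Prop where
  one : u 1 = 1
  mul : ∀ g h, u (g * h) = g • u h * u g
  add : ∀ g h, b (g * h) = g • u h * b g + g • b h

variable {u b : G → A} (h : IsAffineCocycle u b)

namespace IsAffineCocycle

include h in
lemma zero : b 1 = 0 := by
  have := h.add 1 1
  simpa [h.one] using this

include h in
lemma isUnit (g : G) : IsUnit (u g) := by
  have := h.mul g g⁻¹
  rw [mul_inv_cancel, h.one] at this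
  exact IsUnit.of_mul_eq_one_right _ this.symm

/-- The substitution `[X₀ : X₁] ↦ [u g X₀ + b g X₁ : X₁]`, combined with the action of `g` on the
coefficients. -/
def subst (_ : IsAffineCocycle u b) (g : G) : MvPolynomial (Fin 2) A →+* MvPolynomial (Fin 2) A :=
  MvPolynomial.eval₂Hom (MvPolynomial.C.comp (MulSemiringAction.toRingHom G A g))
    ![MvPolynomial.C (u g) * MvPolynomial.X 0 + MvPolynomial.C (b g) * MvPolynomial.X 1,
      MvPolynomial.X 1]

lemma subst_C (g : G) (a : A) : h.subst g (MvPolynomial.C a) = MvPolynomial.C (g • a) := by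
  simp [subst]

lemma subst_X_zero (g : G) : h.subst g (MvPolynomial.X 0) =
    MvPolynomial.C (u g) * MvPolynomial.X 0 + MvPolynomial.C (b g) * MvPolynomial.X 1 := by
  simp [subst]

lemma subst_X_one (g : G) : h.subst g (MvPolynomial.X 1) = MvPolynomial.X 1 := by
  simp [subst]

lemma subst_one : h.subst 1 = RingHom.id _ := by
  refine MvPolynomial.ringHom_ext (fun a => ?_) fun i => ?_
  · simp [subst_C]
  · fin_cases i
    · simp [subst_X_zero, h.one, h.zero]
    · simp [subst_X_one]

lemma subst_mul (g g' : G) : h.subst (g * g') = (h.subst g).comp (h.subst g') := by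
  refine MvPolynomial.ringHom_ext (fun a => ?_) fun i => ?_
  · simp [subst_C, mul_smul]
  · fin_cases i
    · simp [subst_X_zero, subst_C, subst_X_one, h.mul, h.add]
      ring
    · simp [subst_X_one]

lemma subst_mem (g : G) {n : ℕ} {s : MvPolynomial (Fin 2) A}
    (hs : s ∈ MvPolynomial.homogeneousSubmodule (Fin 2) A n) :
    h.subst g s ∈ MvPolynomial.homogeneousSubmodule (Fin 2) A n := by
  rw [MvPolynomial.mem_homogeneousSubmodule] at hs ⊢
  have key : ∀ (f : A →+* MvPolynomial (Fin 2) A) (v : Fin 2 → MvPolynomial (Fin 2) A),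
      (∀ r, (f r).IsHomogeneous 0) → (∀ i, (v i).IsHomogeneous 1) →
      (MvPolynomial.eval₂Hom f v s).IsHomogeneous n := fun f v hf hv => by
    have := hs.eval₂ f v hf hv
    rwa [one_mul] at this
  refine key _ _ (fun r => MvPolynomial.isHomogeneous_C _ _) fun i => ?_
  fin_cases i
  · exact ((MvPolynomial.isHomogeneous_X A 0).C_mul _).add
      ((MvPolynomial.isHomogeneous_X A 1).C_mul _)
  · exact MvPolynomial.isHomogeneous_X A 1

/-- The action on the homogeneous coordinate ring of the projective line. -/
def gradedAction : G →* (MvPolynomial.homogeneousSubmodule (Fin 2) A →+*ᵍ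
    MvPolynomial.homogeneousSubmodule (Fin 2) A) where
  toFun g := { h.subst g with map_mem := h.subst_mem g }
  map_one' := GradedRingHom.ext fun s => DFunLike.congr_fun h.subst_one s
  map_mul' g g' := GradedRingHom.ext fun s => DFunLike.congr_fun (h.subst_mul g g') s

lemma gradedAction_apply (g : G) (s : MvPolynomial (Fin 2) A) :
    h.gradedAction g s = h.subst g s := rfl

lemma X_one_mem : (MvPolynomial.X 1 : MvPolynomial (Fin 2) A) ∈ invariantSubring h.gradedAction :=
  (mem_invariantSubring _).2 h.subst_X_one

lemma C_mem {a : A} (ha : ∀ g : G, g • a = a) :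
    (MvPolynomial.C a : MvPolynomial (Fin 2) A) ∈ invariantSubring h.gradedAction :=
  (mem_invariantSubring _).2 fun g => by rw [gradedAction_apply, subst_C, ha]

/-- The action on the projective line. -/
def action : G →* Aut (P1 A) := projAction h.gradedAction

lemma exists_X_mem_basicOpen (y : P1 A) : ∃ i : Fin 2, y ∈ Proj.basicOpen
    (MvPolynomial.homogeneousSubmodule (Fin 2) A) (MvPolynomial.X i) := by
  have hadj : Algebra.adjoin (MvPolynomial.homogeneousSubmodule (Fin 2) A 0)
      (Set.range (MvPolynomial.X : Fin 2 → MvPolynomial (Fin 2) A)) = ⊤ := by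
    rw [eq_top_iff]
    intro s _
    induction s using MvPolynomial.induction_on with
    | C a =>
      exact Subalgebra.algebraMap_mem _
        (⟨MvPolynomial.C a, MvPolynomial.isHomogeneous_C _ a⟩ :
          MvPolynomial.homogeneousSubmodule (Fin 2) A 0)
    | add p q hp hq => exact add_mem (hp trivial) (hq trivial)
    | mul_X p i hp => exact mul_mem (hp trivial) (Algebra.subset_adjoin ⟨i, rfl⟩)
  have := Proj.iSup_basicOpen_eq_top' (MvPolynomial.homogeneousSubmodule (Fin 2) A)
    (MvPolynomial.X : Fin 2 → MvPolynomial (Fin 2) A) (fun i => ⟨1, P1.X_mem i⟩) hadj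
  exact TopologicalSpace.Opens.mem_iSup.1 (this.ge (TopologicalSpace.Opens.mem_top y))

/-- The invariant forms `X 1` and the norm of `X 0` have no common zero. -/
lemma coversProj [Finite G] : CoversProj (invariantIncl h.gradedAction) := by
  intro y
  by_cases h1 : y ∈ Proj.basicOpen (MvPolynomial.homogeneousSubmodule (Fin 2) A) (MvPolynomial.X 1)
  · exact ⟨1, one_pos, ⟨_, h.X_one_mem⟩, P1.X_mem 1, h1⟩
  -- at infinity, the norm of `X 0` does not vanish
  have : Fintype G := Fintype.ofFinite G
  let N : MvPolynomial (Fin 2) A := ∏ g, h.subst g (MvPolynomial.X 0)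
  have hN : N ∈ invariantSubring h.gradedAction := (mem_invariantSubring _).2 fun g => by
    rw [gradedAction_apply, map_prod]
    refine Fintype.prod_equiv (Equiv.mulLeft g) _ _ fun g' => ?_
    rw [Equiv.coe_mulLeft, subst_mul]
    rfl
  have hNd : N ∈ MvPolynomial.homogeneousSubmodule (Fin 2) A (∑ _g : G, 1) :=
    SetLike.prod_mem_graded _ _ _ fun g _ => h.subst_mem g (P1.X_mem 0)
  refine ⟨_, ?_, ⟨N, hN⟩, hNd, ?_⟩
  · simp [Fintype.card_pos]
  have hp := y.isPrime
  rw [Proj.mem_basicOpen, not_not] at h1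
  obtain ⟨i, hi⟩ := exists_X_mem_basicOpen y
  rw [Proj.mem_basicOpen]
  intro hNy
  obtain ⟨g, -, hg⟩ := (hp.prod_mem_iff).1 hNy
  rw [subst_X_zero] at hg
  have h2 : MvPolynomial.C (u g) * MvPolynomial.X 0 ∈ y.asHomogeneousIdeal.toIdeal :=
    (Ideal.add_mem_iff_left _ (Ideal.mul_mem_left _ _ h1)).1 hg
  have h3 := (Ideal.unit_mul_mem_iff_mem _ ((h.isUnit g).map MvPolynomial.C)).1 h2
  fin_cases i
  · exact hi h3
  · exact hi h1

/-- On `F`-valued points the action is by substitution in the affine coordinate. -/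
lemma point_comp_action {F : Type u} [Field F] [Algebra A F] (t : F) (g : G) (θ : F →+* F)
    (hθ : ∀ a : A, θ (algebraMap A F a) = algebraMap A F (g⁻¹ • a))
    (ht : θ t = algebraMap A F (u g⁻¹) * t + algebraMap A F (b g⁻¹)) :
    P1.point t ≫ (h.action g).hom = Spec.map (CommRingCat.ofHom θ) ≫ P1.point (A := A) t := by
  have h1 : P1.chart A ≫ (h.action g).hom =
      Spec.map (CommRingCat.ofHom (awayAction h.gradedAction h.X_one_mem g⁻¹)) ≫ P1.chart A :=
    awayι_comp_projAction h.gradedAction one_pos h.X_one_mem (P1.X_mem 1) g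
  rw [P1.point_eq, Category.assoc, h1, ← Spec.map_comp_assoc, ← Spec.map_comp_assoc,
    ← CommRingCat.ofHom_comp, ← CommRingCat.ofHom_comp]
  congr 3
  ext x
  obtain ⟨n, s, hs, rfl⟩ := Away.mk_surjective _ (P1.X_mem 1) x
  rw [RingHom.comp_apply, RingHom.comp_apply, awayAction_mk, P1.evalAt_mk, P1.evalAt_mk]
  have h2 : ((MvPolynomial.aeval ![t, 1] : MvPolynomial (Fin 2) A →ₐ[A] F) :
      MvPolynomial (Fin 2) A →+* F).comp (h.subst g⁻¹) =
      θ.comp (MvPolynomial.aeval ![t, 1] : MvPolynomial (Fin 2) A →ₐ[A] F) := by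
    refine MvPolynomial.ringHom_ext (fun a => ?_) fun i => ?_
    · simp [subst_C, hθ]
    · fin_cases i
      · simp [subst_X_zero, ht]
      · simp [subst_X_one]
  exact DFunLike.congr_fun h2 s

variable {R : Type u} [CommRing R] [Algebra R A] (hR : ∀ (g : G) (r : R),
  g • algebraMap R A r = algebraMap R A r)

/-- Constants from a ring fixed by the action. -/
def constHom : R →+* invariantGrading h.gradedAction 0 where
  toFun r := ⟨⟨MvPolynomial.C (algebraMap R A r), h.C_mem fun g => hR g r⟩,
    MvPolynomial.isHomogeneous_C _ _⟩
  map_one' := by ext1; ext1; simp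
  map_zero' := by ext1; ext1; simp
  map_add' r s := by ext1; ext1; simp
  map_mul' r s := by ext1; ext1; simp

/-- The structure morphism of the quotient of the projective line. -/
def quotientToSpec : Proj (invariantGrading h.gradedAction) ⟶ Spec (.of R) :=
  Proj.toSpecZero (invariantGrading h.gradedAction) ≫
    Spec.map (CommRingCat.ofHom (h.constHom hR))

variable [Finite G]

lemma projMap_comp_quotientToSpec : projMap h.coversProj ≫ h.quotientToSpec hR =
    P1.toSpec A ≫ Spec.map (CommRingCat.ofHom (algebraMap R A)) := by
  refine projMap_hom_ext h.coversProj fun n hn s hs => ?_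
  rw [← Category.assoc, awayι_projMap h.coversProj hn s hs, Category.assoc,
    quotientToSpec, P1.toSpec, Category.assoc,
    Proj.awayι_toSpecZero_assoc, Proj.awayι_toSpecZero_assoc, ← Spec.map_comp, ← Spec.map_comp,
    ← Spec.map_comp, ← Spec.map_comp]
  congr 1

lemma isQuotient [IsDomain A] : IsQuotient h.action (projMap h.coversProj) :=
  isQuotient_projMap h.gradedAction h.coversProj

end IsAffineCocycle

end AffineAction

/-! ### Valuation rings and integral closures -/

section ValuationRing

variable {F : Type u} [Field F] (v : AddValuation F (WithTop ℚ))

/-- The valuation ring of a valuation with values in `ℚ ∪ {∞}`. -/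
def valuationRing : ValuationSubring F where
  carrier := {a | 0 ≤ v a}
  mul_mem' := fun ha hb => by
    simp only [Set.mem_ofPred_eq, v.map_mul] at *
    exact add_nonneg ha hb
  one_mem' := by simp
  add_mem' := fun ha hb => v.map_le_add ha hb
  zero_mem' := by simp
  neg_mem' := fun ha => by
    simp only [Set.mem_ofPred_eq, v.map_neg] at *
    exact ha
  mem_or_inv_mem' := fun a => by
    by_cases ha : a = 0
    · left
      simp [ha]
    rcases le_total 0 (v a) with h | h
    · exact Or.inl h
    · right
      have h1 : v a + v a⁻¹ = 0 := by rw [← v.map_mul, mul_inv_cancel₀ ha, v.map_one]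
      change 0 ≤ v a⁻¹
      calc 0 = v a + v a⁻¹ := h1.symm
        _ ≤ 0 + v a⁻¹ := by gcongr
        _ = v a⁻¹ := zero_add _

lemma mem_valuationRing {a : F} : a ∈ valuationRing v ↔ 0 ≤ v a := Iff.rfl

lemma isUnit_valuationRing {a : valuationRing v} : IsUnit a ↔ v (a : F) = 0 := by
  constructor
  · rintro ⟨e, rfl⟩
    have h1 : v ((e : valuationRing v) : F) +
        v ((e⁻¹ : (valuationRing v)ˣ) : valuationRing v) = 0 := by
      rw [← v.map_mul, ← MulMemClass.coe_mul, Units.mul_inv, OneMemClass.coe_one, v.map_one]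
    exact ((add_eq_zero_iff_of_nonneg (e : valuationRing v).2
      ((e⁻¹ : (valuationRing v)ˣ) : valuationRing v).2).1 h1).1
  · intro ha
    have h0 : (a : F) ≠ 0 := by
      intro h0
      rw [h0, v.map_zero] at ha
      exact WithTop.top_ne_zero ha
    have h1 : v (a : F) + v (a : F)⁻¹ = 0 := by rw [← v.map_mul, mul_inv_cancel₀ h0, v.map_one]
    refine IsUnit.of_mul_eq_one (⟨(a : F)⁻¹, ?_⟩ : valuationRing v)
      (Subtype.ext (mul_inv_cancel₀ h0))
    rw [mem_valuationRing]
    rw [ha, zero_add] at h1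
    exact h1.ge

lemma mem_maximalIdeal_valuationRing {a : valuationRing v} :
    a ∈ IsLocalRing.maximalIdeal (valuationRing v) ↔ 0 < v (a : F) := by
  rw [IsLocalRing.mem_maximalIdeal, mem_nonunits_iff, isUnit_valuationRing]
  exact ⟨fun h => lt_of_le_of_ne a.2 (Ne.symm h), fun h => h.ne'⟩

end ValuationRing

namespace IsWildExtension

section IntegralClosure

variable {K L : Type u} [Field K] [Field L] [Algebra K L] {p m : ℕ}
  {vK : AddValuation K (WithTop ℚ)} {vL : AddValuation L (WithTop ℚ)} {σ : Gal(L/K)} {π : L}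
  (h : IsWildExtension p m vK vL σ π) [IsGalois K L] {R : Type u} [CommRing R]
  [Algebra R K] [Algebra R L] [IsScalarTower R K L] [SMulCommClass Gal(L/K) R L]
  (hR : ∀ c, c ∈ (algebraMap R K).range ↔ 0 ≤ vK c)

include h hR

omit [IsGalois K L] [SMulCommClass Gal(L/K) R L] in
/-- Valuation rings are integrally closed. -/
lemma nonneg_of_isIntegral {a : L} (ha : a ∈ integralClosure R L) : 0 ≤ vL a := by
  obtain ⟨f, hf, hfa⟩ := ha
  let φ : R →+* valuationRing vL :=
    { toFun := fun r => ⟨algebraMap R L r, by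
        rw [mem_valuationRing, IsScalarTower.algebraMap_apply R K L, h.map_algebraMap]
        exact (hR _).1 ⟨r, rfl⟩⟩
      map_one' := by ext; simp
      map_mul' := fun _ _ => by ext; simp
      map_zero' := by ext; simp
      map_add' := fun _ _ => by ext; simp }
  have hint : _root_.IsIntegral (valuationRing vL) a := by
    refine ⟨f.map φ, hf.map φ, ?_⟩
    rw [eval₂_map]
    exact hfa
  obtain ⟨b, rfl⟩ := IsIntegrallyClosed.algebraMap_eq_of_integral hint
  exact b.2

omit [SMulCommClass Gal(L/K) R L] in
/-- The product of the `X - g a` over the Galois group has coefficients in `R`, since all conjugates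
of `a` have the same value. -/
lemma mem_integralClosure_of_nonneg {a : L} (ha : 0 ≤ vL a) : a ∈ integralClosure R L := by
  have := h.finiteDimensional
  have := Fintype.ofFinite Gal(L/K)
  let P : L[X] := ∏ g : Gal(L/K), (X - C (g a))
  have hPO : P = (∏ g : Gal(L/K), (X - C (⟨g a, by
      rw [mem_valuationRing, h.map_gal]; exact ha⟩ : valuationRing vL))).map
        (algebraMap (valuationRing vL) L) := by
    rw [Polynomial.map_prod]
    refine Finset.prod_congr rfl fun g _ => ?_
    rw [Polynomial.map_sub, map_X, map_C]
    rfl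
  have hcp : P = MulSemiringAction.charpoly Gal(L/K) a := rfl
  have hlift : P ∈ Polynomial.lifts (algebraMap R L) := by
    rw [lifts_iff_coeff_lifts]
    intro n
    obtain ⟨c, hc⟩ := IntermediateField.mem_bot.1 ((IsGalois.mem_bot_iff_fixed (F := K) (E := L)
      (P.coeff n)).2 fun g => by rw [hcp]; exact MulSemiringAction.smul_coeff_charpoly a n g)
    obtain ⟨r, rfl⟩ := (hR c).2 (by
      rw [← h.map_algebraMap, hc, hPO, coeff_map]
      exact (mem_valuationRing vL).1 (Subtype.prop _))
    exact ⟨r, (IsScalarTower.algebraMap_apply R K L r).trans hc⟩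
  obtain ⟨q, hq, -, hqm⟩ := lifts_and_natDegree_eq_and_monic hlift
    (MulSemiringAction.monic_charpoly Gal(L/K) a)
  refine ⟨q, hqm, ?_⟩
  rw [← Polynomial.eval_map, hq]
  exact MulSemiringAction.eval_charpoly Gal(L/K) a

omit hR [IsGalois K L] in
lemma map_cocycle_mul (g : Gal(L/K)) : 0 ≤ vL ((π / g π) ^ m) := by
  have h0 : g π ≠ 0 := by simpa using h.uniformizer_ne_zero
  have hπt : vL π ≠ ⊤ := by rw [h.uniformizer]; exact WithTop.coe_ne_top
  have h1 : vL (π / g π) + vL π = 0 + vL π := by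
    conv_lhs => rw [← h.map_gal g π]
    rw [← vL.map_mul, div_mul_cancel₀ _ h0, zero_add]
  rw [vL.map_pow, (WithTop.add_right_inj hπt).1 h1, smul_zero]

omit hR [IsGalois K L] in
lemma map_cocycle_add (g : Gal(L/K)) : 0 ≤ vL ((π - g π) / (g π) ^ m) := by
  have h0 : (g π) ^ m ≠ 0 := pow_ne_zero _ (by simpa using h.uniformizer_ne_zero)
  have hmt : vL ((g π) ^ m) = ((m / p : ℚ) : WithTop ℚ) := by
    rw [vL.map_pow, h.map_gal, ← vL.map_pow, h.map_uniformizer_pow]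
  have h1 : vL ((π - g π) / (g π) ^ m) + vL ((g π) ^ m) = vL (g π - π) := by
    rw [← vL.map_mul, div_mul_cancel₀ _ h0, vL.map_sub_swap]
  have h2 := h.shift_le g
  rw [← h1, hmt] at h2
  by_contra hneg
  rw [not_le] at hneg
  exact absurd h2 (not_le.2 (by
    calc _ < 0 + ((m / p : ℚ) : WithTop ℚ) := by
          exact (WithTop.add_lt_add_iff_right WithTop.coe_ne_top).2 hneg
      _ = _ := zero_add _))

/-- The Galois group acts on the parameter `y = (x - π) / π ^ m` by affine substitutions with
integral coefficients: this is the choice of `m`. -/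
lemma isAffineCocycle : IsAffineCocycle (A := integralClosure R L) (G := Gal(L/K))
    (fun g => ⟨(π / g π) ^ m, h.mem_integralClosure_of_nonneg hR (h.map_cocycle_mul g)⟩)
    (fun g => ⟨(π - g π) / (g π) ^ m,
      h.mem_integralClosure_of_nonneg hR (h.map_cocycle_add g)⟩) where
  one := by
    ext
    simp [h.uniformizer_ne_zero]
  mul g g' := by
    ext
    have h1 : g π ≠ 0 := by simpa using h.uniformizer_ne_zero
    have h2 : g (g' π) ≠ 0 := by simpa using h.uniformizer_ne_zero
    change (π / g (g' π)) ^ m = g ((π / g' π) ^ m) * (π / g π) ^ m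
    rw [map_pow, map_div₀, ← mul_pow]
    congr 1
    field_simp
  add g g' := by
    ext
    have h1 : g π ≠ 0 := by simpa using h.uniformizer_ne_zero
    have h2 : g (g' π) ≠ 0 := by simpa using h.uniformizer_ne_zero
    change (π - g (g' π)) / g (g' π) ^ m = g ((π / g' π) ^ m) * ((π - g π) / g π ^ m) +
      g ((π - g' π) / g' π ^ m)
    rw [map_pow, map_div₀, map_div₀, map_sub, map_pow, div_pow]
    field_simp
    ring

end IntegralClosure

end IsWildExtension

/-! ### Fields of rational functions and Galois descent -/

section RatFuncDescent

variable {K L : Type u} [Field K] [Field L] [Algebra K L]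

/-- A rational function fixed by the Galois group has coefficients in the base field. -/
lemma exists_coeffMap_eq_of_fixed [FiniteDimensional K L] [IsGalois K L] (f : RatFunc L)
    (hf : ∀ g : Gal(L/K), coeffMap (g.toRingEquiv.toRingHom) f = f) :
    ∃ f', coeffMap (algebraMap K L) f' = f := by
  have := Fintype.ofFinite Gal(L/K)
  have hpoly : ∀ P : L[X], (∀ g : Gal(L/K), coeffMap (g.toRingEquiv.toRingHom)
      (algebraMap L[X] (RatFunc L) P) = algebraMap L[X] (RatFunc L) P) →
      ∃ Q : K[X], Q.map (algebraMap K L) = P := by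
    intro P hP
    rw [← Polynomial.mem_lifts, lifts_iff_coeff_lifts]
    intro n
    refine IntermediateField.mem_bot.1 ((IsGalois.mem_bot_iff_fixed (F := K) (E := L) _).2
      fun g => ?_)
    have h1 := hP g
    rw [coeffMap_algebraMap] at h1
    have h2 := congrArg (fun Q : L[X] => Q.coeff n)
      (IsFractionRing.injective L[X] (RatFunc L) h1)
    simpa using h2
  obtain ⟨a, b, hb, rfl⟩ := IsFractionRing.div_surjective (A := L[X]) f
  have hb0 : b ≠ 0 := nonZeroDivisors.ne_zero hb
  let N : L[X] := ∏ g : Gal(L/K), b.map g.toRingEquiv.toRingHom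
  have hN0 : N ≠ 0 := Finset.prod_ne_zero_iff.2 fun g _ =>
    (Polynomial.map_ne_zero_iff g.toRingEquiv.injective).2 hb0
  have hNfix : ∀ g : Gal(L/K), coeffMap (g.toRingEquiv.toRingHom)
      (algebraMap L[X] (RatFunc L) N) = algebraMap L[X] (RatFunc L) N := by
    intro g
    rw [coeffMap_algebraMap, Polynomial.map_prod]
    congr 1
    refine Fintype.prod_equiv (Equiv.mulLeft g) _ _ fun g' => ?_
    rw [Polynomial.map_map]
    rfl
  -- the norm of the denominator is a multiple of it
  obtain ⟨c, hc⟩ : b ∣ N := by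
    have : b = b.map (1 : Gal(L/K)).toRingEquiv.toRingHom := by
      conv_lhs => rw [← Polynomial.map_id (p := b)]
      rfl
    conv_lhs => rw [this]
    exact Finset.dvd_prod_of_mem (fun g : Gal(L/K) => b.map g.toRingEquiv.toRingHom)
      (Finset.mem_univ 1)
  have hN0' : algebraMap L[X] (RatFunc L) N ≠ 0 := by
    simpa using hN0
  have hb0' : algebraMap L[X] (RatFunc L) b ≠ 0 := by
    simpa using hb0
  have hac : algebraMap L[X] (RatFunc L) (a * c) =
      algebraMap L[X] (RatFunc L) a / algebraMap L[X] (RatFunc L) b *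
        algebraMap L[X] (RatFunc L) N := by
    rw [hc, map_mul, map_mul]
    field_simp
  obtain ⟨Q, hQ⟩ := hpoly N hNfix
  obtain ⟨P, hP⟩ := hpoly (a * c) fun g => by rw [hac, map_mul, hf, hNfix]
  refine ⟨algebraMap K[X] (RatFunc K) P / algebraMap K[X] (RatFunc K) Q, ?_⟩
  rw [map_div₀, coeffMap_algebraMap, coeffMap_algebraMap, hP, hQ, hac, mul_div_cancel_right₀ _ hN0']

lemma coeffMap_mem_of_mem (S : Subfield (RatFunc L)) (hX : RatFunc.X ∈ S)
    (hC : ∀ c : K, RatFunc.C (algebraMap K L c) ∈ S) (f : RatFunc K) :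
    coeffMap (algebraMap K L) f ∈ S := by
  have hpoly : ∀ P : K[X], algebraMap L[X] (RatFunc L) (P.map (algebraMap K L)) ∈ S := by
    intro P
    induction P using Polynomial.induction_on' with
    | add P Q hP hQ =>
      rw [Polynomial.map_add, map_add]
      exact add_mem hP hQ
    | monomial n c =>
      rw [← C_mul_X_pow_eq_monomial, Polynomial.map_mul, map_C, Polynomial.map_pow, map_X, map_mul,
        map_pow, RatFunc.algebraMap_C, RatFunc.algebraMap_X]
      exact mul_mem (hC c) (pow_mem hX n)
  obtain ⟨a, b, -, rfl⟩ := IsFractionRing.div_surjective (A := K[X]) f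
  rw [map_div₀, coeffMap_algebraMap, coeffMap_algebraMap]
  exact div_mem (hpoly a) (hpoly b)

end RatFuncDescent

/-! ### Generic points and function fields -/

section FunctionField

variable {X : Scheme.{u}} [IsIntegral X] {F : Type u} [Field F]

/-- A field-valued point at the generic point is an embedding of the function field. -/
lemma exists_functionField_hom (P : Spec (.of F) ⟶ X) (hP : ∀ x, P x = genericPoint X) :
    ∃ J : X.functionField →+* F,
      Spec.map (CommRingCat.ofHom J) ≫ X.fromSpecStalk (genericPoint X) = P := by
  have key : ∀ x : X, P (IsLocalRing.closedPoint (CommRingCat.of F)) = x →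
      ∃ J : X.presheaf.stalk x ⟶ .of F, Spec.map J ≫ X.fromSpecStalk x = P := by
    rintro _ rfl
    exact ⟨_, Scheme.Spec_stalkClosedPointTo_fromSpecStalk P⟩
  obtain ⟨J, hJ⟩ := key _ (hP _)
  exact ⟨J.hom, hJ⟩

lemma genericPoint_mem {U : X.Opens} (hU : (U : Set X).Nonempty) : genericPoint X ∈ U :=
  ((genericPoint_spec X).mem_open_set_iff U.isOpen).2 (by simpa using hU)

/-- Every nonempty affine chart contains the generic point. -/
lemma exists_fromSpecStalk_eq {C : CommRingCat.{u}} (k : Spec C ⟶ X) [IsOpenImmersion k]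
    [Nonempty (Spec C)] : ∃ χ : C ⟶ X.presheaf.stalk (genericPoint X),
      Spec.map χ ≫ k = X.fromSpecStalk (genericPoint X) := by
  have hr : Set.range (X.fromSpecStalk (genericPoint X)) ⊆ Set.range k := by
    rintro y hy
    rw [Scheme.range_fromSpecStalk] at hy
    obtain ⟨z⟩ := ‹Nonempty (Spec C)›
    have h1 : genericPoint X ∈ k.opensRange := genericPoint_mem ⟨k z, z, rfl⟩
    exact Specializes.mem_open hy k.opensRange.isOpen h1
  exact ⟨Spec.preimage (IsOpenImmersion.lift k _ hr), by
    rw [Spec.map_preimage, IsOpenImmersion.lift_fac]⟩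

lemma apply_mem_range_of_comp_eq {C : CommRingCat.{u}} (k : Spec C ⟶ X) [IsOpenImmersion k]
    [Nonempty (Spec C)] {ψ : C ⟶ .of F} {J : X.functionField →+* F}
    (h : Spec.map (CommRingCat.ofHom J) ≫ X.fromSpecStalk (genericPoint X) = Spec.map ψ ≫ k)
    (c : C) : ψ c ∈ J.fieldRange := by
  obtain ⟨χ, hχ⟩ := exists_fromSpecStalk_eq k
  rw [← hχ, ← Spec.map_comp_assoc, cancel_mono] at h
  have h1 := Spec.map_injective h
  exact ⟨χ c, ConcreteCategory.congr_hom h1 c⟩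

end FunctionField

/-! ### Construction of the quotient model -/

section QuotientIntegral

variable {X Y : Scheme.{u}} {G : Type*} [Group G] {ρ : G →* Aut Y} {q : Y ⟶ X}

lemma IsQuotient.isIntegral [IsIntegral Y] (hq : IsQuotient ρ q) : IsIntegral X := by
  refine ⟨⟨q (genericPoint Y)⟩, fun U hU => ?_⟩
  obtain ⟨⟨x, hx⟩⟩ := hU
  obtain ⟨y, rfl⟩ := hq.isQuotientMap.surjective x
  have : Nonempty (q ⁻¹ᵁ U : Y.Opens) := ⟨⟨y, hx⟩⟩
  exact (hq.injective U).isDomain (q.app U).hom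

lemma IsQuotient.apply_genericPoint [IsIntegral Y] [IsIntegral X] (hq : IsQuotient ρ q) :
    q (genericPoint Y) = genericPoint X := by
  have h1 := (genericPoint_spec Y).image q.continuous
  rw [Set.image_univ, hq.isQuotientMap.surjective.range_eq, closure_univ] at h1
  exact h1.eq (genericPoint_spec X)

/-- At a field-valued generic point on which the group acts through automorphisms of the field,
the functions on the quotient are invariant. -/
lemma IsQuotient.map_functionField_eq [IsIntegral X] (hq : IsQuotient ρ q) {E : Type u} [Field E]
    {P : Spec (.of E) ⟶ Y} {g : G} {θ : E →+* E}
    (hθ : P ≫ (ρ g).hom = Spec.map (CommRingCat.ofHom θ) ≫ P) {J : X.functionField →+* E}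
    (hJ : Spec.map (CommRingCat.ofHom J) ≫ X.fromSpecStalk (genericPoint X) = P ≫ q)
    (f : X.functionField) : θ (J f) = J f := by
  have h2 : Spec.map (CommRingCat.ofHom θ) ≫
      Spec.map (CommRingCat.ofHom J) = Spec.map (CommRingCat.ofHom J) := by
    rw [← cancel_mono (X.fromSpecStalk (genericPoint X)), Category.assoc, hJ,
      ← Category.assoc, ← hθ,
      Category.assoc, hq.invariant]
  rw [← Spec.map_comp] at h2
  exact ConcreteCategory.congr_hom (Spec.map_injective h2) f

lemma specMap_comp_of_eq {E E' : Type u} [CommRing E] [CommRing E'] {C : CommRingCat.{u}}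
    {Z : Scheme.{u}} {J : C →+* E} {i : E' →+* E} {ι : C →+* E'} (h : i.comp ι = J)
    (z : Spec C ⟶ Z) : Spec.map (CommRingCat.ofHom J) ≫ z =
      Spec.map (CommRingCat.ofHom i) ≫ Spec.map (CommRingCat.ofHom ι) ≫ z := by
  subst h
  rw [← Spec.map_comp_assoc]
  rfl

/-- Two embeddings into a field with the same image differ by an isomorphism of their sources. -/
lemma exists_ringEquiv_of_fieldRange_eq {E E' E'' : Type*} [Field E] [Field E'] [Field E'']
    (J : E'' →+* E) (i : E' →+* E) (h : J.fieldRange = i.fieldRange) :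
    ∃ ι : E'' ≃+* E', i.comp ι.toRingHom = J := by
  have h1 : ∀ f, ∃ f', i f' = J f := fun f => by
    have : J f ∈ i.fieldRange := h ▸ ⟨f, rfl⟩
    exact this
  choose ι hι using h1
  have hi := i.injective
  let ι' : E'' →+* E' :=
    { toFun := ι
      map_one' := hi (by rw [hι, map_one, map_one])
      map_mul' := fun a b => hi (by rw [hι, map_mul, map_mul, hι, hι])
      map_zero' := hi (by rw [hι, map_zero, map_zero])
      map_add' := fun a b => hi (by rw [hι, map_add, map_add, hι, hι]) }
  refine ⟨RingEquiv.ofBijective ι' ⟨ι'.injective, fun f' => ?_⟩, RingHom.ext fun f => hι f⟩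
  obtain ⟨f, hf⟩ : i f' ∈ J.fieldRange := h ▸ ⟨f', rfl⟩
  exact ⟨f, hi ((hι f).trans hf)⟩

end QuotientIntegral

namespace IsAffineCocycle

open HomogeneousLocalization Graded

attribute [local instance] MvPolynomial.gradedAlgebra

variable {A : Type u} [CommRing A] {G : Type*} [Group G] [Finite G] [MulSemiringAction G A]
  {u b : G → A} (h : IsAffineCocycle u b) {F : Type u} [Field F] [Algebra A F]

/-- Invariant forms give functions on the quotient of the projective line. -/
lemma aeval_mem_fieldRange [IsIntegral (Proj (invariantGrading h.gradedAction))]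
    (t : F)
    {J : (Proj (invariantGrading h.gradedAction)).functionField →+* F}
    (hJ : Spec.map (CommRingCat.ofHom J) ≫ Scheme.fromSpecStalk _ (genericPoint _) =
      P1.point t ≫ projMap h.coversProj)
    {s : MvPolynomial (Fin 2) A} {n : ℕ} (hs : s.IsHomogeneous n)
    (hs' : s ∈ invariantSubring h.gradedAction) :
    MvPolynomial.aeval ![t, 1] s ∈ J.fieldRange := by
  let X₁ : invariantSubring h.gradedAction := ⟨MvPolynomial.X 1, h.X_one_mem⟩
  have hX₁ : X₁ ∈ invariantGrading h.gradedAction 1 := P1.X_mem 1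
  let k := Proj.awayι (invariantGrading h.gradedAction) X₁ hX₁ one_pos
  have hs1 : (⟨s, hs'⟩ : invariantSubring h.gradedAction) ∈
      invariantGrading h.gradedAction (n • 1) := by
    rw [smul_eq_mul, mul_one]
    exact hs
  let φ : Away (invariantGrading h.gradedAction) X₁ →+*
    Away (MvPolynomial.homogeneousSubmodule (Fin 2) A) (MvPolynomial.X 1) :=
      Away.map (invariantIncl h.gradedAction) X₁
  let c : Away (invariantGrading h.gradedAction) X₁ := Away.mk _ hX₁ n ⟨s, hs'⟩ hs1
  have hc : P1.evalAt t (φ c) =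
      MvPolynomial.aeval ![t, 1] s :=
    (congrArg _ (Away.map_mk (invariantIncl h.gradedAction) X₁ hX₁ n ⟨s, hs'⟩ hs1)).trans
      (P1.evalAt_mk t n s _)
  have hne : Nonempty (Spec (.of (Away (invariantGrading h.gradedAction) X₁))) :=
    ⟨Spec.map (CommRingCat.ofHom ((P1.evalAt t).comp φ))
      (⊥ : PrimeSpectrum F)⟩
  have hk : Spec.map (CommRingCat.ofHom J) ≫ Scheme.fromSpecStalk _ (genericPoint _) =
      Spec.map (CommRingCat.ofHom ((P1.evalAt t).comp φ)) ≫ k := by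
    rw [hJ, P1.point_eq, CommRingCat.ofHom_comp, Spec.map_comp, Category.assoc, Category.assoc]
    congr 1
    exact awayι_projMap h.coversProj one_pos X₁ hX₁
  have := apply_mem_range_of_comp_eq k hk c
  rw [← hc]
  exact this

end IsAffineCocycle

lemma IsGaussValuation.aeval_injective {F E : Type u} [Field F] [Field E] [Algebra F E]
    {v : AddValuation F (WithTop ℚ)} {t : E} {w : AddValuation E (WithTop ℚ)}
    (hw : IsGaussValuation v t w) : Function.Injective (aeval t : F[X] →ₐ[F] E) := by
  rw [injective_iff_map_eq_zero]
  intro g hg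
  have h1 := hw g
  rw [hg, w.map_zero] at h1
  ext i
  by_contra hi
  have h2 : v (g.coeff i) = ⊤ := top_le_iff.1 (h1.le.trans (Finset.inf_le (mem_support_iff.2 hi)))
  exact hi (v.top_iff.1 h2)

section Model

attribute [local instance] MvPolynomial.gradedAlgebra

variable {K L : Type u} [Field K] [NumberField K] [Field L] [Algebra K L]
  {𝔭 : IsDedekindDomain.HeightOneSpectrum (𝓞 K)}

lemma algebraMap_extRing (a : extRing L 𝔭) :
    algebraMap (extRing L 𝔭) (RatFunc L) a = RatFunc.C (a : L) := by
  rw [← RatFunc.algebraMap_eq_C]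
  exact IsScalarTower.algebraMap_apply (extRing L 𝔭) L (RatFunc L) a

lemma aeval_extRing_injective {t : RatFunc L}
    (ht : Function.Injective (aeval t : L[X] →ₐ[L] RatFunc L)) :
    Function.Injective (aeval t : (extRing L 𝔭)[X] →ₐ[extRing L 𝔭] RatFunc L) := by
  intro f g hfg
  rw [← aeval_map_algebraMap L t f, ← aeval_map_algebraMap L t g] at hfg
  exact Polynomial.map_injective _ (FaithfulSMul.algebraMap_injective _ _) (ht hfg)

variable {p m : ℕ} {vK : AddValuation K (WithTop ℚ)} {vL : AddValuation L (WithTop ℚ)}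
  {σ : Gal(L/K)} {π : L}

namespace IsWildExtension

variable (h : IsWildExtension p m vK vL σ π)

include h

omit [NumberField K] in
lemma aeval_yCoord_injective :
    Function.Injective (aeval (yCoord π m) : L[X] →ₐ[L] RatFunc L) := by
  rw [yCoord_eq]
  exact (isGaussValuation_discVal vL π (π ^ m) h.pow_ne_zero_of_uniformizer).aeval_injective

lemma genericPointY_apply (x) : genericPointY 𝔭 π m x = genericPoint (P1 (extRing L 𝔭)) := by
  rw [genericPointY]
  have ht := aeval_extRing_injective (𝔭 := 𝔭) h.aeval_yCoord_injective
  exact P1.point_eq_genericPoint ht x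

omit [NumberField K] in
/-- The action of the Galois group on the coordinate `y = (x - π) / π ^ m`. -/
lemma coeffMap_yCoord (g : Gal(L/K)) : coeffMap g.toRingEquiv.toRingHom (yCoord π m) =
    RatFunc.C ((π / g π) ^ m) * yCoord π m + RatFunc.C ((π - g π) / (g π) ^ m) := by
  have h0 : RatFunc.C π ≠ 0 := by simpa using h.uniformizer_ne_zero
  have h1 : RatFunc.C (g π) ≠ 0 := by simpa using h.uniformizer_ne_zero
  rw [yCoord, map_div₀, map_sub, map_pow, coeffMap_X, coeffMap_C]
  change (RatFunc.X - RatFunc.C (g π)) / RatFunc.C (g π) ^ m = _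
  rw [map_pow, map_div₀, map_div₀, map_sub, map_pow, div_pow]
  field_simp
  ring

variable [IsGalois K L] (hR : ∀ c, c ∈ (algebraMap (baseRing 𝔭) K).range ↔ 0 ≤ vK c)

include hR

lemma exists_cocycle : ∃ (u b : Gal(L/K) → extRing L 𝔭) (_ : IsAffineCocycle u b),
    (∀ g, (u g : L) = (π / g π) ^ m) ∧ ∀ g, (b g : L) = (π - g π) / (g π) ^ m :=
  ⟨_, _, h.isAffineCocycle hR, fun _ => rfl, fun _ => rfl⟩

omit hR [IsGalois K L] in
/-- The action on the model extends the action on the coefficients of `L(x)`. -/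
lemma genericPointY_comp_action {u b : Gal(L/K) → extRing L 𝔭} (hc : IsAffineCocycle u b)
    (hu : ∀ g, (u g : L) = (π / g π) ^ m) (hb : ∀ g, (b g : L) = (π - g π) / (g π) ^ m)
    (g : Gal(L/K)) :
    genericPointY 𝔭 π m ≫ (hc.action g).hom =
      Spec.map (CommRingCat.ofHom (coeffMap (g⁻¹ : Gal(L/K)).toRingEquiv.toRingHom)) ≫
        genericPointY 𝔭 π m := by
  refine hc.point_comp_action _ g _ (fun a => ?_) ?_
  · rw [algebraMap_extRing, algebraMap_extRing, coeffMap_C]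
    rfl
  · rw [algebraMap_extRing, algebraMap_extRing, h.coeffMap_yCoord, hu, hb]

omit [IsGalois K L] hR in
/-- The coordinate `x`, written as a form in the homogeneous coordinates of the model, is
invariant. -/
lemma form_mem_invariantSubring {u b : Gal(L/K) → extRing L 𝔭} (hc : IsAffineCocycle u b)
    (hu : ∀ g, (u g : L) = (π / g π) ^ m) (hb : ∀ g, (b g : L) = (π - g π) / (g π) ^ m)
    {ϖ : extRing L 𝔭} (hϖ : (ϖ : L) = π) :
    (MvPolynomial.C (ϖ ^ m) * MvPolynomial.X 0 + MvPolynomial.C ϖ * MvPolynomial.X 1 :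
      MvPolynomial (Fin 2) (extRing L 𝔭)) ∈ invariantSubring hc.gradedAction := by
  rw [mem_invariantSubring]
  intro g
  have h0 : g π ≠ 0 := by simpa using h.uniformizer_ne_zero
  have hg : ((g • ϖ : extRing L 𝔭) : L) = g π := by rw [← hϖ]; rfl
  have h1 : (g • ϖ) ^ m * u g = ϖ ^ m := by
    ext
    rw [MulMemClass.coe_mul, SubmonoidClass.coe_pow, SubmonoidClass.coe_pow, hg, hu, hϖ, div_pow,
      mul_div_cancel₀ _ (pow_ne_zero _ h0)]
  have h2 : (g • ϖ) ^ m * b g + g • ϖ = ϖ := by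
    ext
    rw [AddMemClass.coe_add, MulMemClass.coe_mul, SubmonoidClass.coe_pow, hg, hb, hϖ,
      mul_div_cancel₀ _ (pow_ne_zero _ h0), sub_add_cancel]
  rw [hc.gradedAction_apply, map_add, map_mul, map_mul, hc.subst_C, hc.subst_C, hc.subst_X_zero,
    hc.subst_X_one, smul_pow', mul_add, ← mul_assoc, ← mul_assoc, ← map_mul, ← map_mul,
    h1, add_assoc,
    ← add_mul, ← map_add, h2]

omit hR in
/-- The function field of the quotient is `K(x)`: its elements are fixed by the Galois group, so
they lie in `K(x)` by descent; conversely, the constants and `x` are quotients of invariant forms.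
-/
lemma fieldRange_eq_of_cocycle {u b : Gal(L/K) → extRing L 𝔭} (hc : IsAffineCocycle u b)
    [Finite Gal(L/K)] [FiniteDimensional K L]
    (hu : ∀ g, (u g : L) = (π / g π) ^ m) (hb : ∀ g, (b g : L) = (π - g π) / (g π) ^ m)
    {ϖ : extRing L 𝔭} (hϖ : (ϖ : L) = π) [IsIntegral (Proj (invariantGrading hc.gradedAction))]
    {J : (Proj (invariantGrading hc.gradedAction)).functionField →+* RatFunc L}
    (hJ : Spec.map (CommRingCat.ofHom J) ≫ Scheme.fromSpecStalk _ (genericPoint _) =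
      genericPointY 𝔭 π m ≫ projMap hc.coversProj) :
    J.fieldRange = (coeffMap (algebraMap K L)).fieldRange := by
  refine le_antisymm ?_ ?_
  · rintro _ ⟨f, rfl⟩
    refine exists_coeffMap_eq_of_fixed _ fun g => ?_
    have h1 := h.genericPointY_comp_action hc hu hb g⁻¹
    rw [inv_inv] at h1
    exact hc.isQuotient.map_functionField_eq h1 hJ f
  · have hr : ∀ r : baseRing 𝔭, RatFunc.C (algebraMap K L r) ∈ J.fieldRange := by
      intro r
      have h1 := hc.aeval_mem_fieldRange (yCoord π m) hJ
        (MvPolynomial.isHomogeneous_C (Fin 2) (algebraMap (baseRing 𝔭) (extRing L 𝔭) r))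
        (hc.C_mem fun g => Subtype.ext (g.commutes r))
      rw [MvPolynomial.aeval_C, algebraMap_extRing] at h1
      exact h1
    rintro _ ⟨f, rfl⟩
    refine coeffMap_mem_of_mem _ ?_ (fun c => ?_) f
    · have h1 := hc.aeval_mem_fieldRange (yCoord π m) hJ
        (((MvPolynomial.isHomogeneous_X (extRing L 𝔭) (0 : Fin 2)).C_mul (ϖ ^ m)).add
          ((MvPolynomial.isHomogeneous_X (extRing L 𝔭) (1 : Fin 2)).C_mul ϖ))
        (h.form_mem_invariantSubring hc hu hb hϖ)
      have h2 : RatFunc.C π ^ m ≠ 0 := pow_ne_zero _ (by simpa using h.uniformizer_ne_zero)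
      have h3 : MvPolynomial.aeval ![yCoord π m, 1] (MvPolynomial.C (ϖ ^ m) * MvPolynomial.X 0 +
          MvPolynomial.C ϖ * MvPolynomial.X 1 : MvPolynomial (Fin 2) (extRing L 𝔭)) =
          RatFunc.X := by
        rw [map_add, map_mul, map_mul, MvPolynomial.aeval_C, MvPolynomial.aeval_C,
          MvPolynomial.aeval_X, MvPolynomial.aeval_X, map_pow, algebraMap_extRing, hϖ]
        change RatFunc.C π ^ m * yCoord π m + RatFunc.C π * 1 = _
        rw [yCoord, mul_div_cancel₀ _ h2, mul_one, sub_add_cancel]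
      rwa [h3] at h1
    · obtain ⟨a, b, -, rfl⟩ := IsFractionRing.div_surjective (A := baseRing 𝔭) c
      rw [map_div₀, map_div₀]
      exact div_mem (hr a) (hr b)

/-- The quotient model is the homogeneous spectrum of the ring of invariants of `R_L[X₀, X₁]`. -/
theorem nonempty_quotientModel : Nonempty (QuotientModel (L := L) 𝔭 π m) := by
  have := h.finiteDimensional
  obtain ⟨u, b, hc, hu, hb⟩ := h.exists_cocycle hR
  have hϖ : π ∈ integralClosure (baseRing 𝔭) L := h.mem_integralClosure_of_nonneg hR (by
    rw [h.uniformizer]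
    have := h.p_pos
    exact_mod_cast (by positivity : (0 : ℚ) ≤ 1 / p))
  have hq := hc.isQuotient
  have hX := hq.isIntegral
  have hRG : ∀ (g : Gal(L/K)) (r : baseRing 𝔭),
      g • algebraMap (baseRing 𝔭) (extRing L 𝔭) r = algebraMap (baseRing 𝔭) (extRing L 𝔭) r :=
    fun g r => Subtype.ext (g.commutes r)
  obtain ⟨J, hJ⟩ := exists_functionField_hom (genericPointY 𝔭 π m ≫ projMap hc.coversProj)
    (fun x => by rw [Scheme.Hom.comp_apply, h.genericPointY_apply, hq.apply_genericPoint])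
  obtain ⟨ι, hι⟩ := exists_ringEquiv_of_fieldRange_eq J _
    (h.fieldRange_eq_of_cocycle hc hu hb (ϖ := ⟨π, hϖ⟩) rfl hJ)
  exact ⟨{
    ρ := hc.action
    ρ_compat := h.genericPointY_comp_action hc hu hb
    X := Proj (invariantGrading hc.gradedAction)
    q := projMap hc.coversProj
    isQuotient := hq
    isIntegral := hX
    f := hc.quotientToSpec hRG
    f_compat := hc.projMap_comp_quotientToSpec hRG
    ι := ι
    ι_compat := hJ.symm.trans (specMap_comp_of_eq hι _) }⟩

end IsWildExtension

end Model

/-! ### Local rings of quotients -/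

section Stalk

variable {X Y : Scheme.{u}}

lemma evalSection_specMap_fromSpecStalk {B : CommRingCat.{u}} {x : X}
    (φ : X.presheaf.stalk x ⟶ B) (U : X.Opens) (hx : x ∈ U)
    (hU : ⊤ ≤ (Spec.map φ ≫ X.fromSpecStalk x) ⁻¹ᵁ U) :
    evalSection (Spec.map φ ≫ X.fromSpecStalk x) U hU = X.presheaf.germ U x hx ≫ φ := by
  have h1 : ⊤ ≤ X.fromSpecStalk x ⁻¹ᵁ U := fun y _ => by
    have h2 : X.fromSpecStalk x y ⤳ x := by
      have : X.fromSpecStalk x y ∈ Set.range (X.fromSpecStalk x) := ⟨y, rfl⟩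
      rwa [Scheme.range_fromSpecStalk] at this
    exact h2.mem_open U.isOpen hx
  rw [evalSection_specMap φ _ U h1]
  congr 1
  rw [evalSection, Scheme.Hom.appLE, Scheme.fromSpecStalk_app hx, Category.assoc, Category.assoc,
    Category.assoc, ← Functor.map_comp_assoc]
  have h3 : ((homOfLE le_top).op ≫ (homOfLE h1).op : Opposite.op (⊤ : (Spec _).Opens) ⟶ _) = 𝟙 _ :=
    rfl
  rw [h3, CategoryTheory.Functor.map_id, Category.id_comp, Iso.inv_hom_id, Category.comp_id]

lemma top_le_preimage_of_closedPoint_mem {B : CommRingCat.{u}} [IsLocalRing B] (Z : Spec B ⟶ X)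
    {U : X.Opens} (hU : Z (IsLocalRing.closedPoint B) ∈ U) : ⊤ ≤ Z ⁻¹ᵁ U :=
  (Scheme.preimage_eq_top_of_closedPoint_mem Z hU).ge

lemma evalSection_functionFieldHom [IsIntegral X] {E : Type u} [Field E] (J : X.functionField →+* E)
    (U : X.Opens) (hx : genericPoint X ∈ U)
    (hU : ⊤ ≤ (Spec.map (CommRingCat.ofHom J) ≫ X.fromSpecStalk (genericPoint X)) ⁻¹ᵁ U)
    (r : Γ(X, U)) : evalSection (Spec.map (CommRingCat.ofHom J) ≫
      X.fromSpecStalk (genericPoint X)) U hU r = J (X.presheaf.germ U _ hx r) :=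
  ConcreteCategory.congr_hom
    (evalSection_specMap_fromSpecStalk (CommRingCat.ofHom J) U hx hU) r

/-- Sections of an integral scheme are determined by their value at a field-valued generic point. -/
lemma evalSection_injective [IsIntegral X] {E : Type u} [Field E] (P : Spec (.of E) ⟶ X)
    (hP : ∀ x, P x = genericPoint X) (U : X.Opens) (hU : ⊤ ≤ P ⁻¹ᵁ U) :
    Function.Injective (evalSection P U hU) := by
  obtain ⟨J, rfl⟩ := exists_functionField_hom P hP
  have hmem : genericPoint X ∈ U := by
    have x : Spec (.of E) := (⊥ : PrimeSpectrum E)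
    rw [← hP x]
    exact hU trivial
  intro s t hst
  refine germ_injective_of_isIntegral X _ hmem (J.injective ?_)
  exact (evalSection_functionFieldHom J U hmem hU s).symm.trans
    (hst.trans (evalSection_functionFieldHom J U hmem hU t))

variable {G : Type*} [Group G] [Finite G] [IsIntegral Y] [IsIntegral X]
  {ρ : G →* Aut Y} {q : Y ⟶ X} {E : Type u} [Field E]

/-- Let `O` be a valuation ring (or any local subring) of an extension `E` of the function field
of `Y`. If `O` is the local ring of `Y` at a point `z` fixed by the group, then the local ring of
the quotient at the image of `z` is the part of `O` lying in the function field of the quotient. -/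
theorem IsQuotient.mem_range_stalk_iff (hq : IsQuotient ρ q) (O : Subring E) [IsLocalRing O]
    {P : Spec (.of E) ⟶ Y} (hP : ∀ x, P x = genericPoint Y) {θ : G → E →+* E}
    (hθ : ∀ g, P ≫ (ρ g).hom = Spec.map (CommRingCat.ofHom (θ g)) ≫ P)
    {Z : Spec (.of O) ⟶ Y} (hZ : Spec.map (CommRingCat.ofHom O.subtype) ≫ Z = P)
    {z : Y} (hz : Z (IsLocalRing.closedPoint O) = z) (hzG : ∀ g, (ρ g).hom z = z)
    {φ : Y.presheaf.stalk z ⟶ .of O} (hφ : Spec.map φ ≫ Y.fromSpecStalk z = Z)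
    (hsurj : Function.Surjective φ) {J : X.functionField →+* E}
    (hJ : Spec.map (CommRingCat.ofHom J) ≫ X.fromSpecStalk (genericPoint X) = P ≫ q)
    (f : X.functionField) :
    f ∈ (algebraMap (X.presheaf.stalk (q z)) X.functionField).range ↔ J f ∈ O := by
  have hloc : IsLocalRing (CommRingCat.of O) := ‹IsLocalRing O›
  have hval : ∀ (U : X.Opens) (hU : q z ∈ U) (r : Γ(X, U)), ∃ hU' : ⊤ ≤ (P ≫ q) ⁻¹ᵁ U,
      J (algebraMap (X.presheaf.stalk (q z)) X.functionField (X.presheaf.germ U (q z) hU r)) =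
        evalSection (P ≫ q) U hU' r := by
    intro U hU r
    have hgen : genericPoint X ∈ U := genericPoint_mem ⟨_, hU⟩
    have hU' : ⊤ ≤ (P ≫ q) ⁻¹ᵁ U := fun x _ => by
      change (P ≫ q) x ∈ U
      rw [Scheme.Hom.comp_apply, hP, hq.apply_genericPoint]
      exact hgen
    refine ⟨hU', ?_⟩
    have : Nonempty U := ⟨⟨_, hU⟩⟩
    rw [Scheme.algebraMap_germ_eq_germToFunctionField, evalSection_congr hJ.symm]
    exact (evalSection_functionFieldHom J U hgen _ r).symm
  constructor
  · rintro ⟨c, rfl⟩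
    obtain ⟨U, hU, r, rfl⟩ := X.presheaf.exists_germ_eq c
    obtain ⟨hU', h1⟩ := hval U hU r
    have h2 : ⊤ ≤ (Z ≫ q) ⁻¹ᵁ U := top_le_preimage_of_closedPoint_mem _ (by
      have h3 : q (Z (IsLocalRing.closedPoint O)) ∈ U := by rw [hz]; exact hU
      exact h3)
    have h3 : P ≫ q = Spec.map (CommRingCat.ofHom O.subtype) ≫ Z ≫ q := by
      rw [← hZ, Category.assoc]
    rw [h1, evalSection_congr h3, evalSection_specMap _ _ U h2]
    exact (evalSection (Z ≫ q) U h2 r).2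
  · intro hf
    -- a section near `z` with the given value at the generic point
    obtain ⟨τ, hτ⟩ := hsurj ⟨J f, hf⟩
    obtain ⟨V, hV, t, rfl⟩ := Y.presheaf.exists_germ_eq τ
    have hcomp : ∀ g g' (y : Y), (ρ g).hom ((ρ g').hom y) = (ρ (g * g')).hom y := fun g g' y => by
      rw [map_mul]
      rfl
    -- shrink the neighbourhood to an invariant one
    let V' : Y.Opens := ⟨⋂ g : G, (ρ g).hom ⁻¹' V,
      isOpen_iInter_of_finite fun g => V.isOpen.preimage (ρ g).hom.continuous⟩
    have hV'mem : ∀ y, y ∈ V' ↔ ∀ g, (ρ g).hom y ∈ V := fun y => Set.mem_iInter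
    have hzV' : z ∈ V' := (hV'mem z).2 fun g => by rw [hzG]; exact hV
    have hV'V : V' ≤ V := fun y hy => by
      have := (hV'mem y).1 hy 1
      rw [map_one] at this
      exact this
    have hpre : q ⁻¹' (q '' V') = V' := by
      refine Set.Subset.antisymm ?_ (Set.subset_preimage_image _ _)
      rintro y ⟨y', hy', hyy'⟩
      obtain ⟨g, rfl⟩ := hq.orbits _ _ hyy'
      refine (hV'mem _).2 fun g' => ?_
      rw [hcomp]
      exact (hV'mem _).1 hy' _
    let U : X.Opens := ⟨q '' V', by
      rw [← hq.isQuotientMap.isOpen_preimage, hpre]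
      exact V'.isOpen⟩
    have hUV : q ⁻¹ᵁ U ≤ V := fun y hy => by
      have : y ∈ q ⁻¹' (q '' V') := hy
      rw [hpre] at this
      exact hV'V this
    have hzU : q z ∈ U := ⟨z, hzV', rfl⟩
    have hPU : ⊤ ≤ P ⁻¹ᵁ (q ⁻¹ᵁ U) := fun x _ => by
      change P x ∈ q ⁻¹ᵁ U
      rw [hP]
      exact genericPoint_mem ⟨z, hzU⟩
    have hPV : ⊤ ≤ P ⁻¹ᵁ V := fun x hx => hUV (hPU hx)
    let s : Γ(Y, q ⁻¹ᵁ U) := Y.presheaf.map (homOfLE hUV).op t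
    have hsval : evalSection P (q ⁻¹ᵁ U) hPU s = J f := by
      have hPφ : P = Spec.map (φ ≫ CommRingCat.ofHom O.subtype) ≫ Y.fromSpecStalk z := by
        rw [Spec.map_comp, Category.assoc, hφ, hZ]
      have h1 := ConcreteCategory.congr_hom (evalSection_map P V (q ⁻¹ᵁ U) hUV hPU hPV) t
      refine h1.trans ?_
      rw [evalSection_congr hPφ, evalSection_specMap_fromSpecStalk _ V hV]
      exact congrArg Subtype.val hτ
    have hinv : ∀ g, (ρ g).hom.appLE (q ⁻¹ᵁ U) (q ⁻¹ᵁ U)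
        (preimage_le_of_comp_eq _ q (hq.invariant g) U) s = s := by
      intro g
      apply evalSection_injective P hP (q ⁻¹ᵁ U) hPU
      have hPg : ⊤ ≤ (P ≫ (ρ g).hom) ⁻¹ᵁ (q ⁻¹ᵁ U) := fun x hx =>
        preimage_le_of_comp_eq _ q (hq.invariant g) U (hPU hx)
      have h1 := ConcreteCategory.congr_hom (evalSection_appLE P (ρ g).hom (q ⁻¹ᵁ U) (q ⁻¹ᵁ U)
        (preimage_le_of_comp_eq _ q (hq.invariant g) U) hPU hPg) s
      refine h1.trans ?_
      rw [evalSection_congr (hθ g), evalSection_specMap _ _ _ hPU]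
      change θ g (evalSection P (q ⁻¹ᵁ U) hPU s) = _
      rw [hsval]
      exact hq.map_functionField_eq (hθ g) hJ f
    obtain ⟨r, hr⟩ := (hq.sections U s).2 hinv
    obtain ⟨hU', h1⟩ := hval U hzU r
    refine ⟨X.presheaf.germ U (q z) hzU r, J.injective ?_⟩
    rw [h1, ← hsval, ← hr]
    exact (ConcreteCategory.congr_hom (evalSection_app P q U hPU hU') r).symm

end Stalk

/-! ### Points of the projective line with values in a local ring -/

section Stalk

/-- If every element of the local ring `B` is a fraction of elements of the chart with the
denominator invertible in `B`, then the local ring of `Y` at the image of the closed point maps onto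
`B`. -/
lemma stalkClosedPointTo_surjective_of_chart {Y : Scheme.{u}} {B C : CommRingCat.{u}}
    [IsLocalRing B]
    (ψ : C ⟶ B) (j : Spec C ⟶ Y) [IsOpenImmersion j]
    (h : ∀ e : B, ∃ c d : C, IsUnit (ψ d) ∧ e * ψ d = ψ c) :
    Function.Surjective (Scheme.stalkClosedPointTo (Spec.map ψ ≫ j)) := by
  set Z := Spec.map ψ ≫ j with hZ
  have hr : Set.range (Y.fromSpecStalk (Z (IsLocalRing.closedPoint B))) ⊆ Set.range j := by
    rintro y hy
    rw [Scheme.range_fromSpecStalk] at hy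
    refine Specializes.mem_open hy j.opensRange.isOpen ?_
    exact ⟨Spec.map ψ (IsLocalRing.closedPoint B), rfl⟩
  obtain ⟨χ, hχ⟩ : ∃ χ, Spec.map χ ≫ j = Y.fromSpecStalk (Z (IsLocalRing.closedPoint B)) :=
    ⟨Spec.preimage (IsOpenImmersion.lift j _ hr), by
      rw [Spec.map_preimage, IsOpenImmersion.lift_fac]⟩
  have hχψ : χ ≫ Scheme.stalkClosedPointTo Z = ψ := by
    apply Spec.map_injective
    rw [← cancel_mono j, Spec.map_comp, Category.assoc, hχ,
      Scheme.Spec_stalkClosedPointTo_fromSpecStalk]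
  have hev : ∀ c, Scheme.stalkClosedPointTo Z (χ c) = ψ c := ConcreteCategory.congr_hom hχψ
  intro e
  obtain ⟨c, d, hd, he⟩ := h e
  have hu : IsUnit (χ d) :=
    (Scheme.isLocalHom_stalkClosedPointTo Z).map_nonunit _ (by rw [← hev] at hd; exact hd)
  obtain ⟨b, hb⟩ := hu.exists_right_inv
  refine ⟨χ c * b, ?_⟩
  have h1 := congrArg (Scheme.stalkClosedPointTo Z) hb
  rw [map_mul, map_one, hev] at h1
  rw [map_mul, hev, ← he, mul_assoc, h1, mul_one]

end Stalk

section LocalPoint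

open HomogeneousLocalization

attribute [local instance] MvPolynomial.gradedAlgebra

variable {A F : Type u} [CommRing A] [Field F] [Algebra A F]

/-- A polynomial in the affine coordinate, as a function on the chart `X 1 ≠ 0`. -/
def P1.chartFunction (a : A[X]) :
    Away (MvPolynomial.homogeneousSubmodule (Fin 2) A) (MvPolynomial.X 1) :=
  Away.mk _ (P1.X_mem 1) a.natDegree (a.homogenize a.natDegree)
    ((MvPolynomial.mem_homogeneousSubmodule _ _).2
      (by rw [smul_eq_mul, mul_one]; exact isHomogeneous_homogenize a))

lemma P1.evalAt_chartFunction (t : F) (a : A[X]) :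
    P1.evalAt t (P1.chartFunction a) = Polynomial.aeval t a := by
  rw [P1.chartFunction, P1.evalAt_mk, P1.aeval_eq_aeval, aeval_homogenize_X_one _ le_rfl]

lemma P1.evalAt_fromZeroRingHom (t : F) (a : A) :
    P1.evalAt t (fromZeroRingHom (MvPolynomial.homogeneousSubmodule (Fin 2) A)
      (Submonoid.powers (MvPolynomial.X 1)) (algebraMap A _ a)) = algebraMap A F a := by
  have h : fromZeroRingHom (MvPolynomial.homogeneousSubmodule (Fin 2) A)
      (Submonoid.powers (MvPolynomial.X 1)) (algebraMap A _ a) =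
      Away.mk _ (P1.X_mem 1) 0 (MvPolynomial.C a)
        ((MvPolynomial.mem_homogeneousSubmodule _ _).2 (by
          rw [zero_smul]; exact MvPolynomial.isHomogeneous_C _ _)) := by
    ext
    rw [Away.val_mk, fromZeroRingHom]
    change Localization.mk (MvPolynomial.C a) _ = _
    congr 1
  rw [h, P1.evalAt_mk, MvPolynomial.aeval_C]

/-- A constant dividing an equation of the complement of `y` is invertible at `y`. -/
lemma P1.not_mem_of_mem_basicOpen {a : A} {n : ℕ} (hn : 0 < n) {s s' : MvPolynomial (Fin 2) A}
    (hs : s.IsHomogeneous n) (hs' : s'.IsHomogeneous n) (h : s = MvPolynomial.C a * s') {y : P1 A}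
    (hy : y ∈ Proj.basicOpen (MvPolynomial.homogeneousSubmodule (Fin 2) A) s) :
    a ∉ (P1.toSpec A y).asIdeal := by
  have hs1 : s ∈ MvPolynomial.homogeneousSubmodule (Fin 2) A n :=
    (MvPolynomial.mem_homogeneousSubmodule _ _).2 hs
  rw [← Proj.opensRange_awayι _ s hs1 hn] at hy
  obtain ⟨x, rfl⟩ := hy
  have hcomp : Proj.awayι (MvPolynomial.homogeneousSubmodule (Fin 2) A) s hs1 hn ≫ P1.toSpec A =
      Spec.map (CommRingCat.ofHom ((fromZeroRingHom (MvPolynomial.homogeneousSubmodule (Fin 2) A)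
        (Submonoid.powers s)).comp (algebraMap A _))) := by
    rw [P1.toSpec, Proj.awayι_toSpecZero_assoc, ← Spec.map_comp]
    rfl
  have h2 : P1.toSpec A (Proj.awayι (MvPolynomial.homogeneousSubmodule (Fin 2) A) s hs1 hn x) =
      Spec.map (CommRingCat.ofHom ((fromZeroRingHom (MvPolynomial.homogeneousSubmodule (Fin 2) A)
        (Submonoid.powers s)).comp (algebraMap A _))) x := by
    rw [← hcomp, Scheme.Hom.comp_apply]
  rw [h2]
  intro ha
  have ha' : (fromZeroRingHom (MvPolynomial.homogeneousSubmodule (Fin 2) A)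
    (Submonoid.powers s)) (algebraMap A _ a) ∈ x.asIdeal := ha
  refine x.isPrime.ne_top ((Ideal.eq_top_iff_one _).2 ?_)
  have h3 : (fromZeroRingHom (MvPolynomial.homogeneousSubmodule (Fin 2) A)
      (Submonoid.powers s)) (algebraMap A _ a) * Away.mk _ hs1 1 s'
        ((MvPolynomial.mem_homogeneousSubmodule _ _).2 (by rw [one_smul]; exact hs')) = 1 := by
    ext
    rw [val_mul, Away.val_mk, fromZeroRingHom]
    change Localization.mk (MvPolynomial.C a) _ * _ = _
    rw [Localization.mk_mul, val_one, ← h, ← Localization.mk_one, Localization.mk_eq_mk_iff,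
      Localization.r_iff_exists]
    exact ⟨1, by simp⟩
  rw [← h3]
  exact x.asIdeal.mul_mem_right _ ha'

lemma P1.eq_C_mul_homogenize {a : A} {n : ℕ} {s : MvPolynomial (Fin 2) A} (hs : s.IsHomogeneous n)
    {f : A[X]} (h : MvPolynomial.aeval ![X, 1] s = Polynomial.C a * f) :
    s = MvPolynomial.C a * f.homogenize n := by
  rw [← homogenize_C_mul, homogenize_eq_of_isHomogeneous hs h]

variable (O : Subring F) (hO : ∀ a, algebraMap A F a ∈ O) {t : F} (ht : t ∈ O)

include hO ht in
lemma aeval_mem_subring (a : A[X]) : Polynomial.aeval t a ∈ O := by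
  rw [Polynomial.aeval_eq_sum_range]
  refine sum_mem fun i _ => ?_
  rw [Algebra.smul_def]
  exact mul_mem (hO _) (pow_mem ht i)

include hO ht in
lemma P1.evalAt_mem (x) : P1.evalAt (A := A) t x ∈ O := by
  obtain ⟨n, s, hs, rfl⟩ := Away.mk_surjective _ (P1.X_mem 1) x
  rw [P1.evalAt_mk, P1.aeval_eq_aeval]
  exact aeval_mem_subring O hO ht _

/-- The point `[t : 1]` with coordinates in a subring of a field. -/
def P1.localPoint : Spec (.of O) ⟶ P1 A :=
  Spec.map (CommRingCat.ofHom ((P1.evalAt (A := A) t).codRestrict O (P1.evalAt_mem O hO ht))) ≫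
    P1.chart A

lemma P1.specMap_subtype_comp_localPoint :
    Spec.map (CommRingCat.ofHom O.subtype) ≫ P1.localPoint O hO ht = P1.point t := by
  rw [P1.localPoint, ← Spec.map_comp_assoc, P1.point_eq]
  rfl

lemma P1.localPoint_toSpec : P1.localPoint O hO ht ≫ P1.toSpec A =
    Spec.map (CommRingCat.ofHom ((algebraMap A F).codRestrict O hO)) := by
  rw [P1.localPoint, P1.chart, P1.toSpec, Category.assoc, Proj.awayι_toSpecZero_assoc,
    ← Spec.map_comp, ← Spec.map_comp]
  congr 1
  ext a
  exact P1.evalAt_fromZeroRingHom t a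

lemma P1.localPoint_mem_basicOpen {n : ℕ} (hn : 0 < n) {s : MvPolynomial (Fin 2) A}
    (hs : s.IsHomogeneous n) (x : Spec (.of O)) :
    P1.localPoint O hO ht x ∈ Proj.basicOpen (MvPolynomial.homogeneousSubmodule (Fin 2) A) s ↔
      (⟨Polynomial.aeval t (MvPolynomial.aeval ![X, 1] s : A[X]),
        aeval_mem_subring O hO ht _⟩ : O) ∉ x.asIdeal := by
  have hs1 : s ∈ MvPolynomial.homogeneousSubmodule (Fin 2) A n :=
    (MvPolynomial.mem_homogeneousSubmodule _ _).2 hs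
  have h1 : ∀ z, P1.chart A z ∈ Proj.basicOpen (MvPolynomial.homogeneousSubmodule (Fin 2) A) s ↔
      z ∈ PrimeSpectrum.basicOpen (Away.isLocalizationElem (P1.X_mem 1) hs1) := fun z => by
    rw [← Proj.awayι_preimage_basicOpen _ (P1.X_mem 1) one_pos hs1 hn]
    rfl
  rw [P1.localPoint, Scheme.Hom.comp_apply, h1]
  have h2 : (P1.evalAt (A := A) t).codRestrict O (P1.evalAt_mem O hO ht)
      (Away.isLocalizationElem (P1.X_mem 1) hs1) =
      (⟨Polynomial.aeval t (MvPolynomial.aeval ![X, 1] s : A[X]),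
        aeval_mem_subring O hO ht _⟩ : O) := by
    refine Subtype.ext ?_
    refine (P1.evalAt_mk t n (s ^ 1) _).trans ?_
    rw [pow_one, P1.aeval_eq_aeval]
  rw [← h2]
  rfl

/-- If every element of `O` is a quotient of polynomials in `t`, with the denominator invertible in
`O`, then `O` is the local ring of the projective line at the closed point of `[t : 1]`. -/
lemma P1.stalkClosedPointTo_surjective [IsLocalRing O]
    (hfrac : ∀ e ∈ O, ∃ a b : A[X], Polynomial.aeval t b ≠ 0 ∧ (Polynomial.aeval t b)⁻¹ ∈ O ∧
      e = Polynomial.aeval t a / Polynomial.aeval t b) :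
    Function.Surjective (Scheme.stalkClosedPointTo (R := .of O) (P1.localPoint O hO ht)) := by
  have hloc : IsLocalRing (CommRingCat.of O) := ‹IsLocalRing O›
  refine stalkClosedPointTo_surjective_of_chart _ (P1.chart A) fun e => ?_
  obtain ⟨a, b, hb, hb', he⟩ := hfrac e.1 e.2
  refine ⟨P1.chartFunction a, P1.chartFunction b, ?_, ?_⟩
  · exact IsUnit.of_mul_eq_one (⟨_, hb'⟩ : O) (Subtype.ext
      ((congrArg (· * _) (P1.evalAt_chartFunction t b)).trans (mul_inv_cancel₀ hb)))
  · refine Subtype.ext ?_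
    change e.1 * P1.evalAt t (P1.chartFunction b) = P1.evalAt t (P1.chartFunction a)
    rw [P1.evalAt_chartFunction, P1.evalAt_chartFunction, he, div_mul_cancel₀ _ hb]

end LocalPoint

/-! ### The special fiber of the projective line -/

section ComponentPoint

/-- A special fiber with a generic point has no other component. -/
lemma isComponentPoint_iff {R : Type u} [CommRing R] [IsLocalRing R] {X : Scheme.{u}}
    {f : X ⟶ Spec (CommRingCat.of R)} {ξ₀ : X} (h : IsGenericPoint ξ₀ (specialFiber f)) (ξ : X) :
    IsComponentPoint f ξ ↔ ξ = ξ₀ := by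
  have hirr : IsIrreducible (specialFiber f) := by
    rw [← h.def]
    exact isIrreducible_singleton.closure
  constructor
  · rintro ⟨Z, hZ, hξ⟩
    have h1 : Z = specialFiber f := hZ.eq_of_le ⟨hirr, subset_rfl⟩ hZ.prop.2
    subst h1
    exact hξ.eq h
  · rintro rfl
    exact ⟨_, ⟨⟨hirr, subset_rfl⟩, fun S hS _ => hS.2⟩, h⟩

end ComponentPoint

section ClosedFiber

attribute [local instance] MvPolynomial.gradedAlgebra

variable {R A F : Type u} [CommRing R] [IsLocalRing R] [CommRing A] [Algebra R A] [Field F]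
  [Algebra A F] (O : Subring F) [IsLocalRing O] (hO : ∀ a, algebraMap A F a ∈ O) {t : F}
  (ht : t ∈ O)

/-- If the polynomials in `t` which are not invertible in `O` are the multiples of a constant `a`
which vanishes on the closed fiber, then the point `[t : 1]` over the closed point of `O`
specializes to every point of the closed fiber. -/
lemma P1.localPoint_specializes {a : A}
    (ha : ∀ f : A[X], (⟨Polynomial.aeval t f, aeval_mem_subring O hO ht f⟩ : O) ∈
      IsLocalRing.maximalIdeal O → Polynomial.C a ∣ f)
    {r : R} (hr : r ∈ IsLocalRing.maximalIdeal R) {k : ℕ} (hra : algebraMap R A r ∣ a ^ k)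
    {y : P1 A} (hy : Spec.map (CommRingCat.ofHom (algebraMap R A)) (P1.toSpec A y) =
      IsLocalRing.closedPoint R) :
    P1.localPoint O hO ht (IsLocalRing.closedPoint O) ⤳ y := by
  rw [specializes_iff_forall_open]
  intro U hU hyU
  obtain ⟨_, ⟨i, rfl⟩, hyi, hi⟩ := TopologicalSpace.Opens.isBasis_iff_nbhd.1
    (isBasis_basicOpen_homogeneous (MvPolynomial.homogeneousSubmodule (Fin 2) A))
    (show y ∈ (⟨U, hU⟩ : (P1 A).Opens) from hyU)
  obtain ⟨⟨n, hn⟩, s, hs⟩ := i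
  have hs' : s.IsHomogeneous n := (MvPolynomial.mem_homogeneousSubmodule _ _).1 hs
  refine hi ((P1.localPoint_mem_basicOpen O hO ht hn hs' _).2 fun hmem => ?_)
  obtain ⟨f, hf⟩ := ha _ hmem
  refine P1.not_mem_of_mem_basicOpen hn hs' (isHomogeneous_homogenize f)
    (P1.eq_C_mul_homogenize hs' hf) hyi ?_
  refine (P1.toSpec A y).isPrime.mem_of_pow_mem k (Ideal.mem_of_dvd _ hra ?_)
  have h1 : r ∈ (Spec.map (CommRingCat.ofHom (algebraMap R A)) (P1.toSpec A y)).asIdeal := by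
    rw [hy]
    exact hr
  exact h1

lemma P1.localPoint_mem_closedFiber
    (hRO : ∀ r ∈ IsLocalRing.maximalIdeal R,
      (⟨algebraMap A F (algebraMap R A r), hO _⟩ : O) ∈ IsLocalRing.maximalIdeal O) :
    Spec.map (CommRingCat.ofHom (algebraMap R A))
      (P1.toSpec A (P1.localPoint O hO ht (IsLocalRing.closedPoint O))) =
        IsLocalRing.closedPoint R := by
  have h1 : P1.toSpec A (P1.localPoint O hO ht (IsLocalRing.closedPoint O)) =
      Spec.map (CommRingCat.ofHom ((algebraMap A F).codRestrict O hO))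
        (IsLocalRing.closedPoint O) := by
    rw [← P1.localPoint_toSpec O hO ht]
    rfl
  rw [h1]
  refine PrimeSpectrum.ext ?_
  refine ((IsLocalRing.maximalIdeal.isMaximal R).eq_of_le ?_ hRO).symm
  exact (Ideal.IsPrime.comap _ (hK := Ideal.IsPrime.comap _
    (hK := (IsLocalRing.maximalIdeal.isMaximal O).isPrime))).ne_top

end ClosedFiber

/-! ### The Gauss valuation on the function field of the model -/

section GaussPoint

variable {F : Type u} [Field F]

lemma IsGaussValuation.exists_eq_coeff {v : AddValuation F (WithTop ℚ)} {E : Type u} [Field E]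
    [Algebra F E] {t : E} {w : AddValuation E (WithTop ℚ)} (hw : IsGaussValuation v t w)
    {f : F[X]} (hf : f ≠ 0) : ∃ c : F, c ≠ 0 ∧ w (aeval t f) = v c := by
  obtain ⟨i, hi, hi'⟩ := Finset.exists_mem_eq_inf f.support (support_nonempty.2 hf)
    fun i => v (f.coeff i)
  exact ⟨f.coeff i, mem_support_iff.1 hi, (hw f).trans hi'⟩

lemma exists_aeval_param_eq_div (a b : F) (hb : b ≠ 0) (e : RatFunc F) :
    ∃ f g : F[X], aeval ((RatFunc.X - RatFunc.C a) / RatFunc.C b) g ≠ (0 : RatFunc F) ∧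
      e = aeval ((RatFunc.X - RatFunc.C a) / RatFunc.C b) f /
        aeval ((RatFunc.X - RatFunc.C a) / RatFunc.C b) g := by
  obtain ⟨f, g, hg, rfl⟩ := IsFractionRing.div_surjective (A := F[X]) e
  refine ⟨f.comp (C b * X + C a), g.comp (C b * X + C a), ?_, ?_⟩
  · rw [← IsWildExtension.algebraMap_eq_aeval_param a b hb]
    simpa using nonZeroDivisors.ne_zero hg
  · rw [← IsWildExtension.algebraMap_eq_aeval_param a b hb,
      ← IsWildExtension.algebraMap_eq_aeval_param a b hb]

lemma map_zpow_addValuation (v : AddValuation F (WithTop ℚ)) {c : F} (hc : v c = 1) (n : ℤ) :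
    v (c ^ n) = ((n : ℚ) : WithTop ℚ) := by
  have hc0 : c ≠ 0 := by
    rintro rfl
    rw [v.map_zero] at hc
    exact WithTop.top_ne_one hc
  have hpow : ∀ k : ℕ, v (c ^ k) = ((k : ℚ) : WithTop ℚ) := fun k => by
    rw [v.map_pow, hc, ← WithTop.coe_one, ← WithTop.coe_nsmul, nsmul_eq_mul, mul_one]
  obtain ⟨k, rfl | rfl⟩ := n.eq_nat_or_neg
  · rw [zpow_natCast, hpow, Int.cast_natCast]
  · refine WithTop.add_right_cancel (WithTop.coe_ne_top (a := (k : ℚ))) ?_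
    rw [← WithTop.coe_add, ← hpow, ← v.map_mul, zpow_neg, zpow_natCast,
      inv_mul_cancel₀ (pow_ne_zero _ hc0), v.map_one]
    simp

lemma map_eq_zero_iff_of_nonneg_iff {v w : AddValuation F (WithTop ℚ)}
    (h : ∀ f, 0 ≤ v f ↔ 0 ≤ w f) {f : F} (hf : f ≠ 0) (hw : w f = 0) : v f = 0 := by
  have hinv : ∀ v : AddValuation F (WithTop ℚ), v f + v f⁻¹ = 0 := fun v => by
    rw [← v.map_mul, mul_inv_cancel₀ hf, v.map_one]
  have h1 := hinv w
  rw [hw, zero_add] at h1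
  exact ((add_eq_zero_iff_of_nonneg ((h f).2 hw.ge) ((h f⁻¹).2 h1.ge)).1 (hinv v)).1

end GaussPoint

namespace IsWildExtension

section Values

variable {K L : Type u} [Field K] [Field L] [Algebra K L] {p m : ℕ}
  {vK : AddValuation K (WithTop ℚ)} {vL : AddValuation L (WithTop ℚ)} {σ : Gal(L/K)} {π : L}
  (h : IsWildExtension p m vK vL σ π)

include h

lemma exists_int_div (a : L) (ha : a ≠ 0) : ∃ n : ℤ, vL a = (((n : ℚ) / p : ℚ) : WithTop ℚ) := by
  have hp := h.p_pos
  obtain ⟨f, hf, rfl⟩ := h.exists_aeval_eq a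
  have hf0 : f ≠ 0 := by
    rintro rfl
    simp at ha
  obtain ⟨i, hi, hi'⟩ := Finset.exists_mem_eq_inf f.support (support_nonempty.2 hf0)
    fun i => vK (f.coeff i) + (((i : ℚ) / p : ℚ) : WithTop ℚ)
  obtain ⟨n, hn⟩ := h.int (f.coeff i) (mem_support_iff.1 hi)
  refine ⟨n * p + i, ?_⟩
  rw [h.map_aeval_uniformizer f hf, weightedInf, hi', hn, ← WithTop.coe_add]
  congr 1
  push_cast
  field_simp

/-- Elements of positive value are divisible by the uniformizer. -/
lemma nonneg_div_uniformizer {a : L} (ha : 0 < vL a) : 0 ≤ vL (a / π) := by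
  have hp := h.p_pos
  by_cases ha0 : a = 0
  · simp [ha0]
  obtain ⟨n, hn⟩ := h.exists_int_div _ (div_ne_zero ha0 h.uniformizer_ne_zero)
  rw [hn]
  have h1 : vL a = (((n : ℚ) / p + 1 / p : ℚ) : WithTop ℚ) := by
    rw [WithTop.coe_add, ← hn, ← h.uniformizer, ← vL.map_mul,
      div_mul_cancel₀ _ h.uniformizer_ne_zero]
  rw [h1] at ha
  have h2 : (0 : ℚ) < n / p + 1 / p := by exact_mod_cast ha
  rw [← add_div, div_pos_iff_of_pos_right hp] at h2
  have h3 : 0 ≤ n := by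
    have : (0 : ℤ) < n + 1 := by exact_mod_cast h2
    omega
  exact_mod_cast (div_nonneg (by exact_mod_cast h3) hp.le : (0 : ℚ) ≤ n / p)

/-- The values of the Gauss valuation are values of coefficients, so they lie in `(1 / p) ℤ`. -/
lemma exists_int_div_stageTwo (f : RatFunc K) (hf : f ≠ 0) :
    ∃ n : ℤ, h.stageTwo f = (((n : ℚ) / p : ℚ) : WithTop ℚ) := by
  have key : ∀ g : L[X], algebraMap L[X] (RatFunc L) g ≠ 0 → ∃ n : ℤ,
      discVal vL π (π ^ m) h.pow_ne_zero_of_uniformizer (algebraMap L[X] (RatFunc L) g) =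
        (((n : ℚ) / p : ℚ) : WithTop ℚ) := by
    intro g hg
    rw [algebraMap_eq_aeval_param π (π ^ m) h.pow_ne_zero_of_uniformizer] at hg ⊢
    obtain ⟨c, hc, hc'⟩ := (isGaussValuation_discVal vL π (π ^ m)
      h.pow_ne_zero_of_uniformizer).exists_eq_coeff (f := g.comp (C (π ^ m) * X + C π))
        (fun h0 => hg (by rw [h0, map_zero]))
    rw [hc']
    exact h.exists_int_div c hc
  obtain ⟨a, b, hb, hab⟩ := IsFractionRing.div_surjective (A := L[X]) (coeffMap (algebraMap K L) f)
  have hb0 : algebraMap L[X] (RatFunc L) b ≠ 0 := by simpa using nonZeroDivisors.ne_zero hb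
  have hf' : coeffMap (algebraMap K L) f ≠ 0 := by simpa using hf
  have ha0 : algebraMap L[X] (RatFunc L) a ≠ 0 := fun h0 => hf' (by rw [← hab, h0, zero_div])
  obtain ⟨n, hn⟩ := key a ha0
  obtain ⟨k, hk⟩ := key b hb0
  have h1 : h.stageTwo f + (((k : ℚ) / p : ℚ) : WithTop ℚ) = (((n : ℚ) / p : ℚ) : WithTop ℚ) := by
    rw [← hn, ← hk]
    change discVal vL π (π ^ m) _ (coeffMap (algebraMap K L) f) + _ = _
    rw [← AddValuation.map_mul, ← hab, div_mul_cancel₀ _ hb0]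
  refine ⟨n - k, ?_⟩
  refine WithTop.add_right_cancel (WithTop.coe_ne_top (a := ((k : ℚ) / p : ℚ))) ?_
  rw [h1, ← WithTop.coe_add]
  congr 1
  push_cast
  ring

/-- The valuation is determined by its valuation ring and its restriction to `K`, since its values
are rational multiples of the value of a uniformizer of `K`. -/
lemma eq_stageTwo {v : AddValuation (RatFunc K) (WithTop ℚ)}
    (hv : ∀ c, v (algebraMap K (RatFunc K) c) = vK c)
    (hv' : ∀ f, 0 ≤ v f ↔ 0 ≤ h.stageTwo f) : v = h.stageTwo := by
  have hp := h.p_pos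
  ext f
  by_cases hf : f = 0
  · simp [hf]
  obtain ⟨ϖ, hϖ⟩ := h.exists_uniformizer
  have hϖ0 : algebraMap K (RatFunc K) ϖ ≠ 0 := by
    intro h0
    have : ϖ = 0 := by simpa using h0
    rw [this, vK.map_zero] at hϖ
    exact WithTop.top_ne_one hϖ
  obtain ⟨n, hn⟩ := h.exists_int_div_stageTwo f hf
  -- the unit `f ^ p / ϖ ^ n` of one valuation ring is a unit of the other
  have hst : ∀ c, h.stageTwo (algebraMap K (RatFunc K) c) = vK c :=
    h.discRestrict_algebraMap _ _ _
  have hϖn : algebraMap K (RatFunc K) ϖ ^ n ≠ 0 := zpow_ne_zero _ hϖ0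
  have hmul : f ^ p / algebraMap K (RatFunc K) ϖ ^ n * algebraMap K (RatFunc K) ϖ ^ n = f ^ p :=
    div_mul_cancel₀ _ hϖn
  have h1 : h.stageTwo (f ^ p / algebraMap K (RatFunc K) ϖ ^ n) = 0 := by
    refine WithTop.add_right_cancel (WithTop.coe_ne_top (a := (n : ℚ))) ?_
    rw [← map_zpow_addValuation h.stageTwo ((hst ϖ).trans hϖ) n, ← AddValuation.map_mul, hmul,
      AddValuation.map_pow, hn, map_zpow_addValuation h.stageTwo ((hst ϖ).trans hϖ) n, zero_add,
      ← WithTop.coe_nsmul, nsmul_eq_mul, mul_div_cancel₀ _ hp.ne']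
  have h2 := map_eq_zero_iff_of_nonneg_iff hv' (div_ne_zero (pow_ne_zero _ hf) hϖn) h1
  have h3 : p • v f = ((n : ℚ) : WithTop ℚ) := by
    rw [← v.map_pow, ← hmul, v.map_mul, h2, map_zpow_addValuation v ((hv ϖ).trans hϖ) n, zero_add]
  have hvf : v f ≠ ⊤ := v.ne_top_iff.2 hf
  rw [hn]
  lift v f to ℚ using hvf with r
  rw [← WithTop.coe_nsmul, WithTop.coe_inj, nsmul_eq_mul] at h3
  rw [WithTop.coe_inj, eq_div_iff hp.ne', mul_comm]
  exact h3

end Values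

section Model

variable {K L : Type u} [Field K] [NumberField K] [Field L] [Algebra K L] {p m : ℕ}
  {vK : AddValuation K (WithTop ℚ)} {vL : AddValuation L (WithTop ℚ)} {σ : Gal(L/K)} {π : L}
  {𝔭 : IsDedekindDomain.HeightOneSpectrum (𝓞 K)}
  (h : IsWildExtension p m vK vL σ π) [IsGalois K L]
  (hR : ∀ c, c ∈ (algebraMap (baseRing 𝔭) K).range ↔ 0 ≤ vK c)

/-- The valuation ring of the Gauss valuation with respect to the coordinate `y`. -/
def gaussRing : Subring (RatFunc L) :=
  (valuationRing (discVal vL π (π ^ m) h.pow_ne_zero_of_uniformizer)).toSubring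

instance : IsLocalRing h.gaussRing :=
  inferInstanceAs (IsLocalRing (valuationRing (discVal vL π (π ^ m) h.pow_ne_zero_of_uniformizer)))

omit [NumberField K] [IsGalois K L] in
lemma mem_gaussRing {e : RatFunc L} : e ∈ h.gaussRing ↔
    0 ≤ discVal vL π (π ^ m) h.pow_ne_zero_of_uniformizer e := Iff.rfl

omit [NumberField K] [IsGalois K L] in
lemma mem_maximalIdeal_gaussRing {e : h.gaussRing} : e ∈ IsLocalRing.maximalIdeal h.gaussRing ↔
    0 < discVal vL π (π ^ m) h.pow_ne_zero_of_uniformizer (e : RatFunc L) :=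
  mem_maximalIdeal_valuationRing _ (a := e)

omit [NumberField K] [IsGalois K L] in
lemma isGaussValuation_yCoord : IsGaussValuation vL (yCoord π m)
    (discVal vL π (π ^ m) h.pow_ne_zero_of_uniformizer) := by
  rw [yCoord_eq]
  exact isGaussValuation_discVal _ _ _ _

omit [IsGalois K L] in
include hR in
lemma algebraMap_mem_gaussRing (a : extRing L 𝔭) :
    algebraMap (extRing L 𝔭) (RatFunc L) a ∈ h.gaussRing := by
  rw [mem_gaussRing, algebraMap_extRing, ← RatFunc.algebraMap_eq_C,
    h.isGaussValuation_yCoord.map_algebraMap]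
  exact h.nonneg_of_isIntegral hR a.2

omit [NumberField K] [IsGalois K L] in
lemma yCoord_mem_gaussRing : yCoord π m ∈ h.gaussRing := by
  rw [mem_gaussRing, ← aeval_X (R := L) (yCoord π m), h.isGaussValuation_yCoord.apply]
  exact le_gaussInf fun i => by rw [coeff_X]; split_ifs <;> simp

include h hR in
/-- Polynomials over `L` with nonnegative Gauss valuation have coefficients in `R_L`. -/
lemma exists_map_eq_of_nonneg {f : L[X]} (hf : 0 ≤ gaussInf vL f) :
    ∃ g : (extRing L 𝔭)[X], g.map (algebraMap (extRing L 𝔭) L) = f := by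
  rw [← Polynomial.mem_lifts, lifts_iff_coeff_lifts]
  exact fun i => ⟨⟨_, h.mem_integralClosure_of_nonneg hR (hf.trans (gaussInf_le vL f i))⟩, rfl⟩

include hR in
/-- Elements of the valuation ring are fractions of integral polynomials in `y` whose denominators
are units of the valuation ring. -/
lemma exists_eq_div_of_mem_gaussRing (e : RatFunc L) (he : e ∈ h.gaussRing) :
    ∃ a b : (extRing L 𝔭)[X], aeval (yCoord π m) b ≠ 0 ∧
      (aeval (yCoord π m) b)⁻¹ ∈ h.gaussRing ∧ e = aeval (yCoord π m) a / aeval (yCoord π m) b := by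
  obtain ⟨f, g, hg, hfg⟩ := exists_aeval_param_eq_div π (π ^ m) h.pow_ne_zero_of_uniformizer e
  rw [← yCoord_eq] at hg hfg
  have hw := h.isGaussValuation_yCoord
  set w := discVal vL π (π ^ m) h.pow_ne_zero_of_uniformizer with hwdef
  obtain ⟨c, hc, hgc⟩ := hw.exists_eq_coeff (f := g) (fun h0 => hg (by rw [h0, map_zero]))
  -- normalize the denominator to have Gauss valuation zero
  have hC : RatFunc.C c ≠ 0 := by simpa using hc
  have hgc' : ∀ f : L[X], aeval (yCoord π m) (C c⁻¹ * f) = (RatFunc.C c)⁻¹ * aeval (yCoord π m) f :=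
    fun f => by rw [map_mul, aeval_C, RatFunc.algebraMap_eq_C, map_inv₀]
  have hwC : w (RatFunc.C c) = vL c := by rw [← RatFunc.algebraMap_eq_C, hw.map_algebraMap]
  have hb : w (aeval (yCoord π m) (C c⁻¹ * g)) = 0 := by
    have hct : vL c ≠ ⊤ := vL.ne_top_iff.2 hc
    refine WithTop.add_right_cancel hct ?_
    rw [← hwC, ← w.map_mul, hgc', mul_comm, mul_inv_cancel_left₀ hC, hgc, hwC, zero_add]
  have hb0 : aeval (yCoord π m) (C c⁻¹ * g) ≠ 0 := by
    rw [hgc']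
    exact mul_ne_zero (inv_ne_zero hC) hg
  have heq : e = aeval (yCoord π m) (C c⁻¹ * f) / aeval (yCoord π m) (C c⁻¹ * g) := by
    rw [hgc', hgc', mul_div_mul_left _ _ (inv_ne_zero hC), hfg]
  have ha : 0 ≤ w (aeval (yCoord π m) (C c⁻¹ * f)) := by
    rw [eq_div_iff hb0] at heq
    rw [← heq, w.map_mul, hb, add_zero]
    exact he
  obtain ⟨a', ha'⟩ := h.exists_map_eq_of_nonneg hR (ha.trans_eq (hw.apply _))
  obtain ⟨b', hb'⟩ := h.exists_map_eq_of_nonneg hR (hb.symm.trans (hw.apply _)).le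
  have hmap : ∀ g : (extRing L 𝔭)[X], aeval (yCoord π m) g =
      aeval (yCoord π m) (g.map (algebraMap (extRing L 𝔭) L)) :=
    fun g => (aeval_map_algebraMap L _ g).symm
  refine ⟨a', b', ?_, ?_, ?_⟩
  · rw [hmap, hb']
    exact hb0
  · rw [hmap, hb', mem_gaussRing]
    have h1 : w (aeval (yCoord π m) (C c⁻¹ * g))⁻¹ + w (aeval (yCoord π m) (C c⁻¹ * g)) = 0 := by
      rw [← w.map_mul, inv_mul_cancel₀ hb0, w.map_one]
    rw [hb, add_zero] at h1
    exact h1.ge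
  · rw [hmap, hmap, ha', hb']
    exact heq

end Model

end IsWildExtension

/-! ### The special fiber of the quotient -/

lemma mem_maximalIdeal_baseRing {K : Type u} [Field K] [NumberField K]
    {𝔭 : IsDedekindDomain.HeightOneSpectrum (𝓞 K)} {vK : AddValuation K (WithTop ℚ)}
    (hR : ∀ c, c ∈ (algebraMap (baseRing 𝔭) K).range ↔ 0 ≤ vK c) {r : baseRing 𝔭} :
    r ∈ IsLocalRing.maximalIdeal (baseRing 𝔭) ↔ 0 < vK r := by
  rw [IsLocalRing.mem_maximalIdeal, mem_nonunits_iff]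
  have h0 : 0 ≤ vK r := (hR r).1 ⟨r, rfl⟩
  constructor
  · intro hr
    refine lt_of_le_of_ne h0 fun h1 => hr ?_
    have hr0 : (r : K) ≠ 0 := by
      intro hr0
      rw [hr0, vK.map_zero] at h1
      exact WithTop.zero_ne_top h1
    have h2 : vK (r : K) + vK (r : K)⁻¹ = 0 := by
      rw [← vK.map_mul, mul_inv_cancel₀ hr0, vK.map_one]
    rw [← h1, zero_add] at h2
    obtain ⟨s, hs⟩ := (hR (r : K)⁻¹).2 h2.ge
    exact IsUnit.of_mul_eq_one s (Subtype.ext ((congrArg (r.1 * ·) hs).trans (mul_inv_cancel₀ hr0)))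
  · rintro hr ⟨e, rfl⟩
    have h2 : vK ((e : baseRing 𝔭) : K) + vK ((e⁻¹ : (baseRing 𝔭)ˣ) : baseRing 𝔭) = 0 := by
      rw [← vK.map_mul, ← MulMemClass.coe_mul, Units.mul_inv, OneMemClass.coe_one, vK.map_one]
    exact hr.ne' ((add_eq_zero_iff_of_nonneg h0 ((hR _).1 ⟨_, rfl⟩)).1 h2).1

namespace IsWildExtension

section Model

variable {K L : Type u} [Field K] [NumberField K] [Field L] [Algebra K L] {p m : ℕ}
  {vK : AddValuation K (WithTop ℚ)} {vL : AddValuation L (WithTop ℚ)} {σ : Gal(L/K)} {π : L}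
  {𝔭 : IsDedekindDomain.HeightOneSpectrum (𝓞 K)}
  (h : IsWildExtension p m vK vL σ π) [IsGalois K L]
  (hR : ∀ c, c ∈ (algebraMap (baseRing 𝔭) K).range ↔ 0 ≤ vK c)

/-- The generic point of the special fiber of the model `ℙ¹` with coordinate `y`. -/
def gaussPoint : P1 (extRing L 𝔭) :=
  P1.localPoint h.gaussRing (h.algebraMap_mem_gaussRing hR) h.yCoord_mem_gaussRing
    (IsLocalRing.closedPoint h.gaussRing)

include h hR

lemma uniformizer_mem_extRing : π ∈ integralClosure (baseRing 𝔭) L :=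
  h.mem_integralClosure_of_nonneg hR (by
    rw [h.uniformizer]
    have := h.p_pos
    exact_mod_cast (by positivity : (0 : ℚ) ≤ 1 / p))

/-- A polynomial in `y` of positive Gauss valuation is divisible by the uniformizer. -/
lemma C_uniformizer_dvd (f : (extRing L 𝔭)[X])
    (hf : (⟨aeval (yCoord π m) f, aeval_mem_subring h.gaussRing (h.algebraMap_mem_gaussRing hR)
      h.yCoord_mem_gaussRing f⟩ : h.gaussRing) ∈ IsLocalRing.maximalIdeal h.gaussRing) :
    C (⟨π, h.uniformizer_mem_extRing hR⟩ : extRing L 𝔭) ∣ f := by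
  rw [mem_maximalIdeal_gaussRing] at hf
  change 0 < discVal vL π (π ^ m) _ (aeval (yCoord π m) f) at hf
  rw [← aeval_map_algebraMap L, h.isGaussValuation_yCoord.apply] at hf
  rw [C_dvd_iff_dvd_coeff]
  intro i
  have hi : 0 < vL (f.coeff i : L) := by
    have := hf.trans_le (gaussInf_le vL _ i)
    rwa [coeff_map] at this
  exact ⟨⟨_, h.mem_integralClosure_of_nonneg hR (h.nonneg_div_uniformizer hi)⟩,
    Subtype.ext (mul_div_cancel₀ _ h.uniformizer_ne_zero).symm⟩

/-- A uniformizer of `K` divides the `p`-th power of the uniformizer `π` of `L`. -/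
lemma exists_dvd_uniformizer_pow : ∃ r ∈ IsLocalRing.maximalIdeal (baseRing 𝔭),
    algebraMap (baseRing 𝔭) (extRing L 𝔭) r ∣ ⟨π, h.uniformizer_mem_extRing hR⟩ ^ p := by
  have hp := h.p_pos
  obtain ⟨ϖ, hϖ⟩ := h.exists_uniformizer
  obtain ⟨r, rfl⟩ := (hR ϖ).2 (by rw [hϖ]; exact zero_le_one)
  have hr0 : algebraMap K L r ≠ 0 := by
    intro h0
    have h1 : (r : K) = 0 := by simpa using h0
    have h2 : vK r = 1 := hϖ
    rw [h1, vK.map_zero] at h2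
    exact WithTop.top_ne_one h2
  refine ⟨r, (mem_maximalIdeal_baseRing hR).2 (zero_lt_one.trans_eq hϖ.symm), ?_⟩
  refine ⟨⟨π ^ p / algebraMap K L r, h.mem_integralClosure_of_nonneg hR ?_⟩,
    Subtype.ext (mul_div_cancel₀ _ hr0).symm⟩
  have h1 : vL (π ^ p / algebraMap K L r) + vL (algebraMap K L r) = 0 + 1 := by
    rw [← vL.map_mul, div_mul_cancel₀ _ hr0, vL.map_pow, h.uniformizer, ← WithTop.coe_nsmul,
      nsmul_eq_mul, mul_one_div_cancel hp.ne', zero_add, WithTop.coe_one]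
  have h2 : vL (algebraMap K L r) = 1 := (h.map_algebraMap _).trans hϖ
  rw [h2] at h1
  exact (WithTop.add_right_cancel (WithTop.one_ne_top) h1).ge

/-- The special fiber of the model is the closure of `gaussPoint`. -/
lemma gaussPoint_specializes {y : P1 (extRing L 𝔭)}
    (hy : Spec.map (CommRingCat.ofHom (algebraMap (baseRing 𝔭) (extRing L 𝔭)))
      (P1.toSpec (extRing L 𝔭) y) = IsLocalRing.closedPoint (baseRing 𝔭)) :
    h.gaussPoint hR ⤳ y := by
  obtain ⟨r, hr, hra⟩ := h.exists_dvd_uniformizer_pow hR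
  exact P1.localPoint_specializes h.gaussRing (h.algebraMap_mem_gaussRing hR)
    h.yCoord_mem_gaussRing (h.C_uniformizer_dvd hR) hr hra hy

omit [IsGalois K L] in
lemma gaussPoint_mem_closedFiber :
    Spec.map (CommRingCat.ofHom (algebraMap (baseRing 𝔭) (extRing L 𝔭)))
      (P1.toSpec (extRing L 𝔭) (h.gaussPoint hR)) = IsLocalRing.closedPoint (baseRing 𝔭) := by
  refine P1.localPoint_mem_closedFiber h.gaussRing (h.algebraMap_mem_gaussRing hR)
    h.yCoord_mem_gaussRing fun r hr => ?_
  rw [mem_maximalIdeal_gaussRing]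
  change 0 < discVal vL π (π ^ m) _ (algebraMap (extRing L 𝔭) (RatFunc L)
    (algebraMap (baseRing 𝔭) (extRing L 𝔭) r))
  rw [algebraMap_extRing, ← RatFunc.algebraMap_eq_C, h.isGaussValuation_yCoord.map_algebraMap]
  change 0 < vL (algebraMap K L r)
  rw [h.map_algebraMap]
  exact (mem_maximalIdeal_baseRing hR).1 hr

variable (M : QuotientModel (L := L) 𝔭 π m)

omit h hR [IsGalois K L] in
lemma mem_specialFiber_iff (y : P1 (extRing L 𝔭)) : M.q y ∈ specialFiber M.f ↔
    Spec.map (CommRingCat.ofHom (algebraMap (baseRing 𝔭) (extRing L 𝔭)))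
      (P1.toSpec (extRing L 𝔭) y) = IsLocalRing.closedPoint (baseRing 𝔭) := by
  have h1 : M.f (M.q y) = Spec.map (CommRingCat.ofHom (algebraMap (baseRing 𝔭) (extRing L 𝔭)))
      (P1.toSpec (extRing L 𝔭) y) := by
    rw [← Scheme.Hom.comp_apply, M.f_compat, Scheme.Hom.comp_apply]
  rw [← h1]
  rfl

/-- The special fiber of the quotient is the closure of the image of the generic point of the
special fiber of the model. -/
lemma isGenericPoint_specialFiber :
    IsGenericPoint (M.q (h.gaussPoint hR)) (specialFiber M.f) := by
  have hclosed : IsClosed (specialFiber M.f) :=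
    (IsLocalRing.isClosed_singleton_closedPoint (baseRing 𝔭)).preimage M.f.continuous
  refine Set.Subset.antisymm (hclosed.closure_subset_iff.2 (Set.singleton_subset_iff.2
    ((mem_specialFiber_iff M _).2 (h.gaussPoint_mem_closedFiber hR)))) fun x hx => ?_
  obtain ⟨y, rfl⟩ := M.isQuotient.isQuotientMap.surjective x
  exact ((h.gaussPoint_specializes hR ((mem_specialFiber_iff M y).1 hx)).map
    M.q.continuous).mem_closure

/-- The group preserves the special fiber, hence fixes its unique generic point. -/
lemma action_gaussPoint (g : Gal(L/K)) : (M.ρ g).hom (h.gaussPoint hR) = h.gaussPoint hR := by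
  have hmem : ∀ g, h.gaussPoint hR ⤳ (M.ρ g).hom (h.gaussPoint hR) := by
    intro g
    refine h.gaussPoint_specializes hR ((mem_specialFiber_iff M _).1 ?_)
    rw [← Scheme.Hom.comp_apply, M.isQuotient.invariant]
    exact (mem_specialFiber_iff M _).2 (h.gaussPoint_mem_closedFiber hR)
  refine ((hmem g).antisymm ?_).eq.symm
  have h1 := (hmem g⁻¹).map (M.ρ g).hom.continuous
  have h2 : (M.ρ g).hom ((M.ρ g⁻¹).hom (h.gaussPoint hR)) = h.gaussPoint hR := by
    change (M.ρ g * M.ρ g⁻¹).hom (h.gaussPoint hR) = _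
    rw [← map_mul, mul_inv_cancel, map_one]
    rfl
  rwa [h2] at h1

/-- The local ring of the quotient at the generic point of its special fiber is the valuation ring
of the inductive valuation. -/
lemma mem_range_stalk_iff (f : M.X.functionField) :
    f ∈ (algebraMap (M.X.presheaf.stalk (M.q (h.gaussPoint hR))) M.X.functionField).range ↔
      0 ≤ h.stageTwo (M.ι f) := by
  have := h.finiteDimensional
  have hlocal : IsLocalRing (CommRingCat.of h.gaussRing) :=
    inferInstanceAs (IsLocalRing h.gaussRing)
  exact M.isQuotient.mem_range_stalk_iff h.gaussRing h.genericPointY_apply M.ρ_compat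
    (P1.specMap_subtype_comp_localPoint h.gaussRing (h.algebraMap_mem_gaussRing hR)
      h.yCoord_mem_gaussRing) rfl (h.action_gaussPoint hR M)
    (Scheme.Spec_stalkClosedPointTo_fromSpecStalk (R := .of h.gaussRing) _)
    (P1.stalkClosedPointTo_surjective h.gaussRing (h.algebraMap_mem_gaussRing hR)
      h.yCoord_mem_gaussRing (h.exists_eq_div_of_mem_gaussRing hR))
    ((specMap_comp_of_eq (J := (coeffMap (algebraMap K L)).comp M.ι.toRingHom) rfl _).trans
      M.ι_compat.symm) f

theorem componentValuations_eq : componentValuations vK M.f M.ι = {h.stageTwo} := by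
  have hst : ∀ c, h.stageTwo (algebraMap K (RatFunc K) c) = vK c := h.discRestrict_algebraMap _ _ _
  ext v
  rw [Set.mem_singleton_iff]
  constructor
  · rintro ⟨hv, ξ, hξ, hvξ⟩
    rw [isComponentPoint_iff (h.isGenericPoint_specialFiber hR M)] at hξ
    subst hξ
    refine h.eq_stageTwo hv fun f => ?_
    obtain ⟨f', rfl⟩ := M.ι.surjective f
    rw [hvξ, h.mem_range_stalk_iff hR M]
  · rintro rfl
    exact ⟨hst, _, (isComponentPoint_iff (h.isGenericPoint_specialFiber hR M) _).2 rfl,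
      fun f => (h.mem_range_stalk_iff hR M f).symm⟩

lemma isIrreducible_specialFiber : IsIrreducible (specialFiber M.f) := by
  rw [← (h.isGenericPoint_specialFiber hR M).def]
  exact isIrreducible_singleton.closure

end Model

end IsWildExtension

/-! ### Totally ramified extensions of number fields -/

section NumberField

variable {K L : Type u} [Field K] [NumberField K] [Field L] [NumberField L] [Algebra K L]
  [IsGalois K L] {p m : ℕ} {𝔭 : IsDedekindDomain.HeightOneSpectrum (𝓞 K)}
  {𝔓 : IsDedekindDomain.HeightOneSpectrum (𝓞 L)} {σ : Gal(L/K)} {π : L}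

omit [IsGalois K L] in
/-- The hypotheses on number fields give the valuation-theoretic ones. -/
lemma isWildExtension (hp : p.Prime) (hdeg : Module.finrank K L = p)
    (hp𝔭 : (p : 𝓞 K) ∈ 𝔭.asIdeal)
    (hram : 𝔭.asIdeal.map (algebraMap (𝓞 K) (𝓞 L)) = 𝔓.asIdeal ^ p)
    (hσ : ∀ g : Gal(L/K), g ∈ Subgroup.zpowers σ)
    (hπ : 𝔓.valuation L π = WithZero.exp (-1 : ℤ))
    (hm : 𝔓.valuation L (σ π - π) = WithZero.exp (-(m : ℤ))) :
    IsWildExtension p m (ratValuation (𝔭.valuation K) 1) (ratValuation (𝔓.valuation L) p) σ π where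
  prime := hp
  finrank := hdeg
  map_algebraMap := ratValuation_algebraMap hp.ne_zero hram
  map_gal := ratValuation_gal hp.ne_zero hram
  int c hc := ⟨_, by rw [ratValuation_of_ne_zero _ _ hc, Nat.cast_one, div_one]⟩
  uniformizer := by rw [ratValuation_of_eq_exp _ _ hπ, Int.cast_one]
  exists_uniformizer := by
    obtain ⟨ϖ, hϖ⟩ := 𝔭.valuation_exists_uniformizer K
    exact ⟨ϖ, by rw [ratValuation_of_eq_exp _ _ hϖ]; simp⟩
  generator := hσ
  shift := by rw [ratValuation_of_eq_exp _ _ hm, Int.cast_natCast]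
  residueChar := by
    rw [ratValuation_pos_iff _ one_pos, ← map_natCast (algebraMap (𝓞 K) K),
      𝔭.valuation_lt_one_iff_mem]
    exact hp𝔭

lemma mem_range_baseRing_iff (c : K) : c ∈ (algebraMap (baseRing 𝔭) K).range ↔
    0 ≤ ratValuation (𝔭.valuation K) 1 c := by
  rw [ratValuation_nonneg_iff _ one_pos, ← Valuation.mem_valuationSubring_iff]
  exact ⟨by rintro ⟨r, rfl⟩; exact r.2, fun hc => ⟨⟨c, hc⟩, rfl⟩⟩

end NumberField

end WildQuotient

end

theorem mainTheorem4 {K L : Type u} [Field K] [NumberField K] [Field L] [NumberField L]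
    [Algebra K L] [IsGalois K L] (p : ℕ) (hp : p.Prime)
    (hdeg : Module.finrank K L = p)
    (𝔭 : IsDedekindDomain.HeightOneSpectrum (𝓞 K)) (hp𝔭 : (p : 𝓞 K) ∈ 𝔭.asIdeal)
    (𝔓 : IsDedekindDomain.HeightOneSpectrum (𝓞 L))
    (hram : 𝔭.asIdeal.map (algebraMap (𝓞 K) (𝓞 L)) = 𝔓.asIdeal ^ p)
    (σ : Gal(L/K)) (hσ : ∀ g : Gal(L/K), g ∈ Subgroup.zpowers σ)
    (πL : L) (hπL : 𝔓.valuation L πL = WithZero.exp (-1 : ℤ))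
    (m : ℕ) (hm : 𝔓.valuation L (σ πL - πL) = WithZero.exp (-(m : ℤ))) :
    Nonempty (WildQuotient.QuotientModel 𝔭 πL m) ∧
    ∃ v : AddValuation (RatFunc K) (WithTop ℚ),
      WildQuotient.IsInductiveValuation (WildQuotient.ratValuation (𝔭.valuation K) 1)
        [(Polynomial.X, 1 / (p : ℚ)), (minpoly K πL, (m : ℚ))] v ∧
      (∃ w : AddValuation (RatFunc L) (WithTop ℚ),
        WildQuotient.IsGaussValuation (WildQuotient.ratValuation (𝔓.valuation L) p)
          (WildQuotient.yCoord πL m) w ∧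
        ∀ h : RatFunc K, v h = w (WildQuotient.coeffMap (algebraMap K L) h)) ∧
      ∀ M : WildQuotient.QuotientModel 𝔭 πL m,
        IsIrreducible (WildQuotient.specialFiber M.f) ∧
        WildQuotient.componentValuations (WildQuotient.ratValuation (𝔭.valuation K) 1) M.f M.ι =
          {v} := by
  have h := WildQuotient.isWildExtension hp hdeg hp𝔭 hram hσ hπL hm
  have hR := WildQuotient.mem_range_baseRing_iff (𝔭 := 𝔭)
  exact ⟨h.nonempty_quotientModel hR, h.stageTwo, h.isInductiveValuation_stageTwo,
    ⟨_, h.isGaussValuation_yCoord, fun _ => rfl⟩, fun M =>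
      ⟨h.isIrreducible_specialFiber hR M, h.componentValuations_eq hR M⟩⟩
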